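/- **Setting.** $\mathrm{PILL}_Y$ is the polymorphic dual intuitionistic/linear lambda calculus with types $\sigma ::= \alpha \mid I \mid \sigma\otimes\sigma \mid \sigma\multimap\sigma \mid {!}\sigma \mid \prod\alpha.\sigma$ and a polymorphic fixed point combinator $Y:\prod\alpha.(\alpha\to\alpha)\to\alpha$, where $\sigma\to\tau = {!}\sigma\multimap\tau$, taken over an arbitrary signature of type constants (with arities) and term constants (of closed type). Linear Abadi–Plotkin Logic (LAPL) is the second-order intuitionistic predicate logic over $\mathrm{PILL}_Y$ in which one may quantify over types, over terms, over relations $R:\mathrm{Rel}(\sigma,\tau)$ and over admissible relations $S:\mathrm{Adm}(\sigma,\tau)$. The admissible relations are the definable relations generated by: admissible relation variables; equality; reindexing along linear maps; conjunction; opposites; $\top$; implications $\phi\supset\rho$ with $\rho$ admissible; universal quantification over types, terms, relations and admissible relations; provable equivalence $\equiv$; and the relational interpretations $\sigma[\vec\rho]$ of types at admissible relations $\vec\rho$. The logic contains axioms stating that $\sigma[\vec\rho]$ is computed, up to $\equiv$, by induction on the type constructors (and depends only on the relations assigned to the variables of $\sigma$), and that $Y$ is related to itself. For relations, $\rho\multimap\rho'$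 is $(f,g).\,\forall x,y.\ \rho(x,y)\supset\rho'(f\,x,g\,y)$, and $(t,u):\rho\multimap\rho'$ means $(\rho\multimap\rho')(t,u)$. Let $\alpha\vdash\sigma(\alpha)$ be an inductively constructed type, i.e. one built from type variables and closed types by the type constructors $\multimap,\otimes,I,!,\prod$, in which $\alpha$ occurs only positively. For $f:\tau\multimap\tau'$ let $\sigma(f):\sigma(\tau)\multimap\sigma(\tau')$ be the functorial action of $\sigma$, defined by structural recursion on $\sigma$. Put $$\mu\alpha.\sigma(\alpha)=\textstyle\prod\alpha.(\sigma(\alpha)\multimap\alpha)\to\alpha,$$ $$\mathit{fold}=\Lambda\alpha.\lambda f:\sigma(\alpha)\multimap\alpha.\lambda^\circ u:\mu\alpha.\sigma(\alpha).\ u\,\alpha\,{!}f,$$ $$\mathit{in}=\lambda^\circ z:\sigma(\mu\alpha.\sigma(\alpha)).\Lambda\alpha.\lambda f:\sigma(\alpha)\multimap\alpha.\ f\,(\sigma(\mathit{fold}\,\alpha\,{!}f)\,z),$$ so that $\mathit{in}:\sigma(\mu\alpha.\sigma(\alpha))\multimap\mu\alpha.\sigma(\alpha)$. **Theorem (Induction).**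 In LAPL extended by the two extensionality schemes $(\forall x:\sigma.\ t\,x=u\,x)\supset t=_{\sigma\multimap\tau}u$ and $(\forall\alpha.\ t\,\alpha=u\,\alpha)\supset t=_{\prod\alpha.\tau}u$ and the identity extension scheme $\forall\vec\alpha.\ \sigma[\mathit{eq}_{\vec\alpha}]\equiv\mathit{eq}_{\sigma(\vec\alpha)}$, the following holds. For every context $\Xi\mid\Gamma\mid\Theta$, every list $\Phi$ of propositions in that context and every admissible relation $R:\mathrm{Adm}(\mu\alpha.\sigma(\alpha),\mu\alpha.\sigma(\alpha))$ in that context, $$\Xi\mid\Gamma\mid\Theta\mid\Phi\ \vdash\ \big((\mathit{in},\mathit{in}):\sigma[R]\multimap R\big)\ \supset\ \forall x:\mu\alpha.\sigma(\alpha).\ R(x,x).$$ -/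

import Mathlib

/-! Linear Abadi-Plotkin Logic (LAPL) over polymorphic intuitionistic/linear lambda calculus with
fixed points (PILL_Y). Type variables are well-scoped de Bruijn indices (`Ty S n` is the set of
types in a kind context with `n` variables); term variables and relation variables are de Bruijn
indices in `ℕ`, index `0` being the variable bound last. A context is a list whose head is the
variable declared last. -/

namespace LAPL

universe u

/-! ### Types -/

/-- Type constants, each with an arity. -/
structure TySig where
  TyCon : Type u
  arity : TyCon → ℕ

/-- `n` type variables `⊢ σ : Type`. -/
inductive Ty (S : TySig.{u}) : ℕ → Type u
  | var {n : ℕ} (i : Fin n) : Ty S n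
  | con {n : ℕ} (c : S.TyCon) (args : Fin (S.arity c) → Ty S n) : Ty S n
  | unit {n : ℕ} : Ty S n
  | tensor {n : ℕ} (σ τ : Ty S n) : Ty S n
  | lolli {n : ℕ} (σ τ : Ty S n) : Ty S n
  | bang {n : ℕ} (σ : Ty S n) : Ty S n
  | pi {n : ℕ} (σ : Ty S (n + 1)) : Ty S n

/-- Lift a renaming under a binder. -/
def liftF {n m : ℕ} (ξ : Fin n → Fin m) : Fin (n + 1) → Fin (m + 1) :=
  Fin.cases 0 (fun i => (ξ i).succ)

/-- Lift a renaming under a binder. -/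
def liftN (ζ : ℕ → ℕ) : ℕ → ℕ
  | 0 => 0
  | i + 1 => ζ i + 1

namespace Ty

variable {S : TySig.{u}}

def rename : {n : ℕ} → Ty S n → {m : ℕ} → (Fin n → Fin m) → Ty S m
  | _, var i, _, ξ => var (ξ i)
  | _, con c args, _, ξ => con c (fun j => (args j).rename ξ)
  | _, unit, _, _ => unit
  | _, tensor σ τ, _, ξ => tensor (σ.rename ξ) (τ.rename ξ)
  | _, lolli σ τ, _, ξ => lolli (σ.rename ξ) (τ.rename ξ)
  | _, bang σ, _, ξ => bang (σ.rename ξ)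
  | _, pi σ, _, ξ => pi (σ.rename (liftF ξ))

/-- Weakening by one type variable. -/
def wk {n : ℕ} (σ : Ty S n) : Ty S (n + 1) := σ.rename Fin.succ

/-- Lift a substitution under a binder. -/
def up {n m : ℕ} (θ : Fin n → Ty S m) : Fin (n + 1) → Ty S (m + 1) :=
  Fin.cases (var 0) (fun i => (θ i).wk)

/-- Simultaneous substitution `σ(τ₁, …, τₙ)`. -/
def subst : {n : ℕ} → Ty S n → {m : ℕ} → (Fin n → Ty S m) → Ty S m
  | _, var i, _, θ => θ i
  | _, con c args, _, θ => con c (fun j => (args j).subst θ)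
  | _, unit, _, _ => unit
  | _, tensor σ τ, _, θ => tensor (σ.subst θ) (τ.subst θ)
  | _, lolli σ τ, _, θ => lolli (σ.subst θ) (τ.subst θ)
  | _, bang σ, _, θ => bang (σ.subst θ)
  | _, pi σ, _, θ => pi (σ.subst (up θ))

/-- The substitution replacing the last type variable by `τ`. -/
def single {n : ℕ} (τ : Ty S n) : Fin (n + 1) → Ty S n := Fin.cases τ var

/-- `σ[τ/α]` for the last type variable `α`. -/
def inst {n : ℕ} (σ : Ty S (n + 1)) (τ : Ty S n) : Ty S n := σ.subst (single τ)

/-- `σ(τ)` for a type `α ⊢ σ(α)` in exactly one variable and `τ` in any kind context. -/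
def at1 {n : ℕ} (σ : Ty S 1) (τ : Ty S n) : Ty S n := σ.subst (fun _ => τ)

/-- Intuitionistic function type `σ → τ = !σ ⊸ τ`. -/
def arrow {n : ℕ} (σ τ : Ty S n) : Ty S n := lolli (bang σ) τ

/-- `Πα. (α → α) → α`, the type of the fixed point combinator. -/
def fix {n : ℕ} : Ty S n := pi (arrow (arrow (var 0) (var 0)) (var 0))

/-- Inductively constructed types: built from type variables and closed types by the type
constructors of the calculus. -/
inductive IndCon : {n : ℕ} → Ty S n → Prop
  | var {n : ℕ} (i : Fin n) : IndCon (var i)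
  | closed {n : ℕ} (σ : Ty S 0) : IndCon (n := n) (σ.rename Fin.elim0)
  | unit {n : ℕ} : IndCon (n := n) unit
  | tensor {n : ℕ} {σ τ : Ty S n} : IndCon σ → IndCon τ → IndCon (tensor σ τ)
  | lolli {n : ℕ} {σ τ : Ty S n} : IndCon σ → IndCon τ → IndCon (lolli σ τ)
  | bang {n : ℕ} {σ : Ty S n} : IndCon σ → IndCon (bang σ)
  | pi {n : ℕ} {σ : Ty S (n + 1)} : IndCon σ → IndCon (pi σ)

/-- `Occurs true σ i`: the variable `i` has a positive occurrence in `σ`; `Occurs false σ i`: it has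
a negative one. An occurrence in an argument of a type constant counts as both. -/
def Occurs : {n : ℕ} → Bool → Ty S n → Fin n → Prop
  | _, p, var j, i => p = true ∧ i = j
  | _, _, con _ args, i => ∃ j, Occurs true (args j) i ∨ Occurs false (args j) i
  | _, _, unit, _ => False
  | _, p, tensor σ τ, i => Occurs p σ i ∨ Occurs p τ i
  | _, p, lolli σ τ, i => Occurs (!p) σ i ∨ Occurs p τ i
  | _, p, bang σ, i => Occurs p σ i
  | _, p, pi σ, i => Occurs p σ i.succ

/-- The variable `i` occurs only positively in `σ`. -/
def OnlyPositive {n : ℕ} (σ : Ty S n) (i : Fin n) : Prop := ¬ Occurs false σ i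

/-- The type `μα. σ(α) = Πα. (σ(α) ⊸ α) → α`, closed, viewed in a kind context of length `n`. -/
def mu {n : ℕ} (σ : Ty S 1) : Ty S n :=
  pi (arrow (lolli (σ.at1 (var 0)) (var 0)) (var 0))

end Ty

/-! ### Terms -/

/-- A polymorphic signature: type constants, and term constants of closed type. -/
structure Sig extends TySig.{u} where
  TmCon : Type u
  tmTy : TmCon → Ty toTySig 0

/-- Raw terms with `n` type variables. `letT σ τ s t` is `let x:σ ⊗ y:τ be s in t` (in `t`, `x` is
index `1` and `y` is index `0`), `letB σ s t` is `let !x:!σ be s in t`, and `letU s t` is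
`let ⋆ be s in t`. -/
inductive Tm (S : Sig.{u}) : ℕ → Type u
  | var {n : ℕ} (i : ℕ) : Tm S n
  | con {n : ℕ} (c : S.TmCon) : Tm S n
  | star {n : ℕ} : Tm S n
  | fixY {n : ℕ} : Tm S n
  | lam {n : ℕ} (σ : Ty S.toTySig n) (t : Tm S n) : Tm S n
  | app {n : ℕ} (t s : Tm S n) : Tm S n
  | tensor {n : ℕ} (t s : Tm S n) : Tm S n
  | bang {n : ℕ} (t : Tm S n) : Tm S n
  | tlam {n : ℕ} (t : Tm S (n + 1)) : Tm S n
  | tapp {n : ℕ} (t : Tm S n) (σ : Ty S.toTySig n) : Tm S n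
  | letT {n : ℕ} (σ τ : Ty S.toTySig n) (s t : Tm S n) : Tm S n
  | letB {n : ℕ} (σ : Ty S.toTySig n) (s t : Tm S n) : Tm S n
  | letU {n : ℕ} (s t : Tm S n) : Tm S n

namespace Tm

variable {S : Sig.{u}}

/-- Renaming of type variables (`ξ`) and term variables (`ζ`). -/
def rename : {n : ℕ} → Tm S n → {m : ℕ} → (Fin n → Fin m) → (ℕ → ℕ) → Tm S m
  | _, var i, _, _, ζ => var (ζ i)
  | _, con c, _, _, _ => con c
  | _, star, _, _, _ => star
  | _, fixY, _, _, _ => fixY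
  | _, lam σ t, _, ξ, ζ => lam (σ.rename ξ) (t.rename ξ (liftN ζ))
  | _, app t s, _, ξ, ζ => app (t.rename ξ ζ) (s.rename ξ ζ)
  | _, tensor t s, _, ξ, ζ => tensor (t.rename ξ ζ) (s.rename ξ ζ)
  | _, bang t, _, ξ, ζ => bang (t.rename ξ ζ)
  | _, tlam t, _, ξ, ζ => tlam (t.rename (liftF ξ) ζ)
  | _, tapp t σ, _, ξ, ζ => tapp (t.rename ξ ζ) (σ.rename ξ)
  | _, letT σ τ s t, _, ξ, ζ =>
      letT (σ.rename ξ) (τ.rename ξ) (s.rename ξ ζ) (t.rename ξ (liftN (liftN ζ)))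
  | _, letB σ s t, _, ξ, ζ => letB (σ.rename ξ) (s.rename ξ ζ) (t.rename ξ (liftN ζ))
  | _, letU s t, _, ξ, ζ => letU (s.rename ξ ζ) (t.rename ξ ζ)

/-- Weakening by one term variable. -/
def wk {n : ℕ} (t : Tm S n) : Tm S n := t.rename id Nat.succ

/-- Weakening by one type variable. -/
def wkTy {n : ℕ} (t : Tm S n) : Tm S (n + 1) := t.rename Fin.succ id

/-- Lift a substitution of terms under a term binder. -/
def up {n : ℕ} (s : ℕ → Tm S n) : ℕ → Tm S n
  | 0 => var 0
  | i + 1 => (s i).wk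

/-- Simultaneous substitution of types (`θ`) and terms (`s`). -/
def subst : {n : ℕ} → Tm S n → {m : ℕ} → (Fin n → Ty S.toTySig m) → (ℕ → Tm S m) → Tm S m
  | _, var i, _, _, s => s i
  | _, con c, _, _, _ => con c
  | _, star, _, _, _ => star
  | _, fixY, _, _, _ => fixY
  | _, lam σ t, _, θ, s => lam (σ.subst θ) (t.subst θ (up s))
  | _, app t t', _, θ, s => app (t.subst θ s) (t'.subst θ s)
  | _, tensor t t', _, θ, s => tensor (t.subst θ s) (t'.subst θ s)
  | _, bang t, _, θ, s => bang (t.subst θ s)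
  | _, tlam t, _, θ, s => tlam (t.subst (Ty.up θ) (fun i => (s i).wkTy))
  | _, tapp t σ, _, θ, s => tapp (t.subst θ s) (σ.subst θ)
  | _, letT σ τ t t', _, θ, s =>
      letT (σ.subst θ) (τ.subst θ) (t.subst θ s) (t'.subst θ (up (up s)))
  | _, letB σ t t', _, θ, s => letB (σ.subst θ) (t.subst θ s) (t'.subst θ (up s))
  | _, letU t t', _, θ, s => letU (t.subst θ s) (t'.subst θ s)

/-- The substitution replacing the last term variable by `t`. -/
def single {n : ℕ} (t : Tm S n) : ℕ → Tm S n
  | 0 => t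
  | i + 1 => var i

/-- The substitution replacing the last two term variables `x`, `y` by `t`, `s`. -/
def pair {n : ℕ} (t s : Tm S n) : ℕ → Tm S n
  | 0 => s
  | 1 => t
  | i + 2 => var i

/-- `t[s/x]` for the last term variable `x`. -/
def inst {n : ℕ} (t s : Tm S n) : Tm S n := t.subst Ty.var (single s)

/-- `t[s, s'/x, y]` for the last two term variables `x`, `y`. -/
def inst₂ {n : ℕ} (t s s' : Tm S n) : Tm S n := t.subst Ty.var (pair s s')

/-- `t[σ/α]` for the last type variable `α`. -/
def instTy {n : ℕ} (t : Tm S (n + 1)) (σ : Ty S.toTySig n) : Tm S n :=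
  t.subst (Ty.single σ) var

/-- The identity map `λ°x:σ. x`. -/
def idm {n : ℕ} (σ : Ty S.toTySig n) : Tm S n := lam σ (var 0)

/-- Intuitionistic abstraction `λx:σ. t = λ°y:!σ. let !x be y in t` with `y` fresh. -/
def ilam {n : ℕ} (σ : Ty S.toTySig n) (t : Tm S n) : Tm S n :=
  lam (Ty.bang σ) (letB σ (var 0) (t.rename id (liftN Nat.succ)))

end Tm

/-- A declaration of a term variable: linear if `lin` is true, intuitionistic otherwise. -/
structure TmDecl (S : TySig.{u}) (n : ℕ) where
  lin : Bool
  ty : Ty S n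

variable {S : Sig.{u}}

/-- Weakening of a declaration by one type variable. -/
def TmDecl.wk {S : TySig.{u}} {n : ℕ} (d : TmDecl S n) : TmDecl S (n + 1) := ⟨d.lin, d.ty.wk⟩

/-- A list of types as a purely intuitionistic context `Γ; -`. -/
def intCtx {S : TySig.{u}} {n : ℕ} (Γ : List (Ty S n)) : List (TmDecl S n) :=
  Γ.map (fun σ => ⟨false, σ⟩)

/-- The typing judgement `Ξ | Γ; Δ ⊢ t : τ`. Both kinds of term variables are declared in the list
`G`; `Γ` consists of all its intuitionistic variables and `Δ` of those linear variables whose index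
lies in the finite set `L`. -/
inductive HasTy : {n : ℕ} → List (TmDecl S.toTySig n) → Finset ℕ → Tm S n →
    Ty S.toTySig n → Prop
  | star {n : ℕ} {G : List (TmDecl S.toTySig n)} : HasTy G ∅ Tm.star Ty.unit
  | fixY {n : ℕ} {G : List (TmDecl S.toTySig n)} : HasTy G ∅ Tm.fixY Ty.fix
  | con {n : ℕ} {G : List (TmDecl S.toTySig n)} (c : S.TmCon) :
      HasTy G ∅ (Tm.con c) ((S.tmTy c).rename Fin.elim0)
  | ivar {n : ℕ} {G : List (TmDecl S.toTySig n)} {i : ℕ} {σ : Ty S.toTySig n} :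
      G[i]? = some ⟨false, σ⟩ → HasTy G ∅ (Tm.var i) σ
  | lvar {n : ℕ} {G : List (TmDecl S.toTySig n)} {i : ℕ} {σ : Ty S.toTySig n} :
      G[i]? = some ⟨true, σ⟩ → HasTy G {i} (Tm.var i) σ
  | app {n : ℕ} {G : List (TmDecl S.toTySig n)} {L L' : Finset ℕ} {t s : Tm S n}
      {σ τ : Ty S.toTySig n} :
      HasTy G L t (Ty.lolli σ τ) → HasTy G L' s σ → Disjoint L L' →
      HasTy G (L ∪ L') (Tm.app t s) τ
  | lam {n : ℕ} {G : List (TmDecl S.toTySig n)} {L : Finset ℕ} {t : Tm S n}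
      {σ τ : Ty S.toTySig n} :
      HasTy (⟨true, σ⟩ :: G) (insert 0 (L.image Nat.succ)) t τ →
      HasTy G L (Tm.lam σ t) (Ty.lolli σ τ)
  | tensor {n : ℕ} {G : List (TmDecl S.toTySig n)} {L L' : Finset ℕ} {t s : Tm S n}
      {σ τ : Ty S.toTySig n} :
      HasTy G L t σ → HasTy G L' s τ → Disjoint L L' →
      HasTy G (L ∪ L') (Tm.tensor t s) (Ty.tensor σ τ)
  | bang {n : ℕ} {G : List (TmDecl S.toTySig n)} {t : Tm S n} {σ : Ty S.toTySig n} :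
      HasTy G ∅ t σ → HasTy G ∅ (Tm.bang t) (Ty.bang σ)
  | tlam {n : ℕ} {G : List (TmDecl S.toTySig n)} {L : Finset ℕ} {t : Tm S (n + 1)}
      {σ : Ty S.toTySig (n + 1)} :
      HasTy (G.map TmDecl.wk) L t σ → HasTy G L (Tm.tlam t) (Ty.pi σ)
  | tapp {n : ℕ} {G : List (TmDecl S.toTySig n)} {L : Finset ℕ} {t : Tm S n}
      {σ : Ty S.toTySig (n + 1)} (τ : Ty S.toTySig n) :
      HasTy G L t (Ty.pi σ) → HasTy G L (Tm.tapp t τ) (σ.inst τ)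
  | letT {n : ℕ} {G : List (TmDecl S.toTySig n)} {L L' : Finset ℕ} {s t : Tm S n}
      {σ σ' τ : Ty S.toTySig n} :
      HasTy G L s (Ty.tensor σ σ') →
      HasTy (⟨true, σ'⟩ :: ⟨true, σ⟩ :: G) (insert 0 (insert 1 (L'.image (· + 2)))) t τ →
      Disjoint L L' → HasTy G (L ∪ L') (Tm.letT σ σ' s t) τ
  | letB {n : ℕ} {G : List (TmDecl S.toTySig n)} {L L' : Finset ℕ} {s t : Tm S n}
      {σ τ : Ty S.toTySig n} :
      HasTy G L s (Ty.bang σ) → HasTy (⟨false, σ⟩ :: G) (L'.image Nat.succ) t τ →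
      Disjoint L L' → HasTy G (L ∪ L') (Tm.letB σ s t) τ
  | letU {n : ℕ} {G : List (TmDecl S.toTySig n)} {L L' : Finset ℕ} {s t : Tm S n}
      {σ : Ty S.toTySig n} :
      HasTy G L s Ty.unit → HasTy G L' t σ → Disjoint L L' →
      HasTy G (L ∪ L') (Tm.letU s t) σ

/-! ### External equality -/

/-- Terms with exactly one hole. An element of `Cx S n m` has `n` type variables outside and `m`
type variables at the hole. -/
inductive Cx (S : Sig.{u}) : ℕ → ℕ → Type u
  | hole {n : ℕ} : Cx S n n
  | letU₁ {n m : ℕ} (C : Cx S n m) (t : Tm S n) : Cx S n m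
  | letU₂ {n m : ℕ} (t : Tm S n) (C : Cx S n m) : Cx S n m
  | tensor₁ {n m : ℕ} (C : Cx S n m) (t : Tm S n) : Cx S n m
  | tensor₂ {n m : ℕ} (t : Tm S n) (C : Cx S n m) : Cx S n m
  | letT₁ {n m : ℕ} (σ τ : Ty S.toTySig n) (C : Cx S n m) (t : Tm S n) : Cx S n m
  | letT₂ {n m : ℕ} (σ τ : Ty S.toTySig n) (t : Tm S n) (C : Cx S n m) : Cx S n m
  | lam {n m : ℕ} (σ : Ty S.toTySig n) (C : Cx S n m) : Cx S n m
  | app₁ {n m : ℕ} (C : Cx S n m) (t : Tm S n) : Cx S n m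
  | app₂ {n m : ℕ} (t : Tm S n) (C : Cx S n m) : Cx S n m
  | bang {n m : ℕ} (C : Cx S n m) : Cx S n m
  | letB₁ {n m : ℕ} (σ : Ty S.toTySig n) (C : Cx S n m) (t : Tm S n) : Cx S n m
  | letB₂ {n m : ℕ} (σ : Ty S.toTySig n) (t : Tm S n) (C : Cx S n m) : Cx S n m
  | tlam {n m : ℕ} (C : Cx S (n + 1) m) : Cx S n m
  | tapp {n m : ℕ} (C : Cx S n m) (σ : Ty S.toTySig n) : Cx S n m

namespace Cx

/-- `C[t]`; variables of `t` may be captured. -/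
def plug : {n m : ℕ} → Cx S n m → Tm S m → Tm S n
  | _, _, hole, u => u
  | _, _, letU₁ C t, u => Tm.letU (C.plug u) t
  | _, _, letU₂ t C, u => Tm.letU t (C.plug u)
  | _, _, tensor₁ C t, u => Tm.tensor (C.plug u) t
  | _, _, tensor₂ t C, u => Tm.tensor t (C.plug u)
  | _, _, letT₁ σ τ C t, u => Tm.letT σ τ (C.plug u) t
  | _, _, letT₂ σ τ t C, u => Tm.letT σ τ t (C.plug u)
  | _, _, lam σ C, u => Tm.lam σ (C.plug u)
  | _, _, app₁ C t, u => Tm.app (C.plug u) t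
  | _, _, app₂ t C, u => Tm.app t (C.plug u)
  | _, _, bang C, u => Tm.bang (C.plug u)
  | _, _, letB₁ σ C t, u => Tm.letB σ (C.plug u) t
  | _, _, letB₂ σ t C, u => Tm.letB σ t (C.plug u)
  | _, _, tlam C, u => Tm.tlam (C.plug u)
  | _, _, tapp C σ, u => Tm.tapp (C.plug u) σ

/-- A context is linear if it has no subcontext of the form `!C`. -/
def Linear : {n m : ℕ} → Cx S n m → Prop
  | _, _, hole => True
  | _, _, letU₁ C _ => C.Linear
  | _, _, letU₂ _ C => C.Linear
  | _, _, tensor₁ C _ => C.Linear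
  | _, _, tensor₂ _ C => C.Linear
  | _, _, letT₁ _ _ C _ => C.Linear
  | _, _, letT₂ _ _ _ C => C.Linear
  | _, _, lam _ C => C.Linear
  | _, _, app₁ C _ => C.Linear
  | _, _, app₂ _ C => C.Linear
  | _, _, bang _ => False
  | _, _, letB₁ _ C _ => C.Linear
  | _, _, letB₂ _ _ C => C.Linear
  | _, _, tlam C => C.Linear
  | _, _, tapp C _ => C.Linear

/-- The number of term variables bound at the hole. -/
def depth : {n m : ℕ} → Cx S n m → ℕ
  | _, _, hole => 0
  | _, _, letU₁ C _ => C.depth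
  | _, _, letU₂ _ C => C.depth
  | _, _, tensor₁ C _ => C.depth
  | _, _, tensor₂ _ C => C.depth
  | _, _, letT₁ _ _ C _ => C.depth
  | _, _, letT₂ _ _ _ C => C.depth + 2
  | _, _, lam _ C => C.depth + 1
  | _, _, app₁ C _ => C.depth
  | _, _, app₂ _ C => C.depth
  | _, _, bang C => C.depth
  | _, _, letB₁ _ C _ => C.depth
  | _, _, letB₂ _ _ C => C.depth + 1
  | _, _, tlam C => C.depth
  | _, _, tapp C _ => C.depth

/-- The inclusion of the outer type variables into those available at the hole. -/
def tyIncl : {n m : ℕ} → Cx S n m → Fin n → Fin m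
  | _, _, hole => id
  | _, _, letU₁ C _ => C.tyIncl
  | _, _, letU₂ _ C => C.tyIncl
  | _, _, tensor₁ C _ => C.tyIncl
  | _, _, tensor₂ _ C => C.tyIncl
  | _, _, letT₁ _ _ C _ => C.tyIncl
  | _, _, letT₂ _ _ _ C => C.tyIncl
  | _, _, lam _ C => C.tyIncl
  | _, _, app₁ C _ => C.tyIncl
  | _, _, app₂ _ C => C.tyIncl
  | _, _, bang C => C.tyIncl
  | _, _, letB₁ _ C _ => C.tyIncl
  | _, _, letB₂ _ _ C => C.tyIncl
  | _, _, tlam C => fun i => C.tyIncl i.succ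
  | _, _, tapp C _ => C.tyIncl

/-- A type from outside the context, at the hole. -/
def inTy {n m : ℕ} (C : Cx S n m) (σ : Ty S.toTySig n) : Ty S.toTySig m := σ.rename C.tyIncl

/-- A term from outside the context, at the hole (no variable is captured). -/
def inTm {n m : ℕ} (C : Cx S n m) (t : Tm S n) : Tm S m := t.rename C.tyIncl (· + C.depth)

/-- Renaming of the free term variables of a context. -/
def rename : {n m : ℕ} → Cx S n m → (ℕ → ℕ) → Cx S n m
  | _, _, hole, _ => hole
  | _, _, letU₁ C t, ζ => letU₁ (C.rename ζ) (t.rename id ζ)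
  | _, _, letU₂ t C, ζ => letU₂ (t.rename id ζ) (C.rename ζ)
  | _, _, tensor₁ C t, ζ => tensor₁ (C.rename ζ) (t.rename id ζ)
  | _, _, tensor₂ t C, ζ => tensor₂ (t.rename id ζ) (C.rename ζ)
  | _, _, letT₁ σ τ C t, ζ => letT₁ σ τ (C.rename ζ) (t.rename id (liftN (liftN ζ)))
  | _, _, letT₂ σ τ t C, ζ => letT₂ σ τ (t.rename id ζ) (C.rename (liftN (liftN ζ)))
  | _, _, lam σ C, ζ => lam σ (C.rename (liftN ζ))
  | _, _, app₁ C t, ζ => app₁ (C.rename ζ) (t.rename id ζ)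
  | _, _, app₂ t C, ζ => app₂ (t.rename id ζ) (C.rename ζ)
  | _, _, bang C, ζ => bang (C.rename ζ)
  | _, _, letB₁ σ C t, ζ => letB₁ σ (C.rename ζ) (t.rename id (liftN ζ))
  | _, _, letB₂ σ t C, ζ => letB₂ σ (t.rename id ζ) (C.rename (liftN ζ))
  | _, _, tlam C, ζ => tlam (C.rename ζ)
  | _, _, tapp C σ, ζ => tapp (C.rename ζ) σ

end Cx

/-- Exchange of two adjacent blocks of variables: the innermost `k` variables are moved outside the
next `d` ones. -/
def exch (k d : ℕ) (i : ℕ) : ℕ := if i < k then i + d else if i < k + d then i - k else i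

/-- External equality `Ξ | Γ; Δ ⊢ t = u : τ`. In the commuting conversions for `let x ⊗ y` and
`let !x`, the term `u` is written as it stands on the right-hand side, where `x`, `y` are bound
inside `C`; on the left-hand side they are bound outside `C`, hence the exchange of variables in `u`
and the weakening of `C`. -/
inductive ExtEq : {n : ℕ} → List (TmDecl S.toTySig n) → Finset ℕ → Tm S n → Tm S n →
    Ty S.toTySig n → Prop
  | refl {n : ℕ} {G : List (TmDecl S.toTySig n)} {L : Finset ℕ} {t : Tm S n}
      {τ : Ty S.toTySig n} : HasTy G L t τ → ExtEq G L t t τ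
  | symm {n : ℕ} {G : List (TmDecl S.toTySig n)} {L : Finset ℕ} {t u : Tm S n}
      {τ : Ty S.toTySig n} : ExtEq G L t u τ → ExtEq G L u t τ
  | trans {n : ℕ} {G : List (TmDecl S.toTySig n)} {L : Finset ℕ} {t u v : Tm S n}
      {τ : Ty S.toTySig n} : ExtEq G L t u τ → ExtEq G L u v τ → ExtEq G L t v τ
  | betaTm {n : ℕ} {G : List (TmDecl S.toTySig n)} {L : Finset ℕ} {t u : Tm S n}
      {σ τ : Ty S.toTySig n} : HasTy G L (Tm.app (Tm.lam σ t) u) τ →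
      ExtEq G L (Tm.app (Tm.lam σ t) u) (t.inst u) τ
  | betaTy {n : ℕ} {G : List (TmDecl S.toTySig n)} {L : Finset ℕ} {t : Tm S (n + 1)}
      {σ τ : Ty S.toTySig n} : HasTy G L (Tm.tapp (Tm.tlam t) σ) τ →
      ExtEq G L (Tm.tapp (Tm.tlam t) σ) (t.instTy σ) τ
  | etaTm {n : ℕ} {G : List (TmDecl S.toTySig n)} {L : Finset ℕ} {t : Tm S n}
      {σ τ : Ty S.toTySig n} : HasTy G L t (Ty.lolli σ τ) →
      ExtEq G L (Tm.lam σ (Tm.app t.wk (Tm.var 0))) t (Ty.lolli σ τ)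
  | etaTy {n : ℕ} {G : List (TmDecl S.toTySig n)} {L : Finset ℕ} {t : Tm S n}
      {τ : Ty S.toTySig (n + 1)} : HasTy G L t (Ty.pi τ) →
      ExtEq G L (Tm.tlam (Tm.tapp t.wkTy (Ty.var 0))) t (Ty.pi τ)
  | betaI {n : ℕ} {G : List (TmDecl S.toTySig n)} {L : Finset ℕ} {t : Tm S n}
      {τ : Ty S.toTySig n} : HasTy G L t τ → ExtEq G L (Tm.letU Tm.star t) t τ
  | etaI {n : ℕ} {G : List (TmDecl S.toTySig n)} {L : Finset ℕ} {t : Tm S n} :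
      HasTy G L t Ty.unit → ExtEq G L (Tm.letU t Tm.star) t Ty.unit
  | betaT {n : ℕ} {G : List (TmDecl S.toTySig n)} {L : Finset ℕ} {s u t : Tm S n}
      {σ σ' τ : Ty S.toTySig n} : HasTy G L (Tm.letT σ σ' (Tm.tensor s u) t) τ →
      ExtEq G L (Tm.letT σ σ' (Tm.tensor s u) t) (t.inst₂ s u) τ
  | etaT {n : ℕ} {G : List (TmDecl S.toTySig n)} {L : Finset ℕ} {t : Tm S n}
      {σ σ' : Ty S.toTySig n} : HasTy G L t (Ty.tensor σ σ') →
      ExtEq G L (Tm.letT σ σ' t (Tm.tensor (Tm.var 1) (Tm.var 0))) t (Ty.tensor σ σ')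
  | betaB {n : ℕ} {G : List (TmDecl S.toTySig n)} {L : Finset ℕ} {u t : Tm S n}
      {σ τ : Ty S.toTySig n} : HasTy G L (Tm.letB σ (Tm.bang u) t) τ →
      ExtEq G L (Tm.letB σ (Tm.bang u) t) (t.inst u) τ
  | etaB {n : ℕ} {G : List (TmDecl S.toTySig n)} {L : Finset ℕ} {t : Tm S n}
      {σ : Ty S.toTySig n} : HasTy G L t (Ty.bang σ) →
      ExtEq G L (Tm.letB σ t (Tm.bang (Tm.var 0))) t (Ty.bang σ)
  | congr {n m : ℕ} {G : List (TmDecl S.toTySig m)} {L : Finset ℕ} {t s : Tm S m}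
      {σ : Ty S.toTySig m} {G' : List (TmDecl S.toTySig n)} {L' : Finset ℕ}
      {τ : Ty S.toTySig n} (C : Cx S n m) :
      ExtEq G L t s σ → (∀ u : Tm S m, HasTy G L u σ → HasTy G' L' (C.plug u) τ) →
      ExtEq G' L' (C.plug t) (C.plug s) τ
  | commI {n m : ℕ} {G : List (TmDecl S.toTySig n)} {L : Finset ℕ} {t : Tm S n} {u : Tm S m}
      {τ : Ty S.toTySig n} (C : Cx S n m) : C.Linear →
      HasTy G L (Tm.letU t (C.plug u)) τ →
      ExtEq G L (Tm.letU t (C.plug u)) (C.plug (Tm.letU (C.inTm t) u)) τ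
  | commT {n m : ℕ} {G : List (TmDecl S.toTySig n)} {L : Finset ℕ} {t : Tm S n} {u : Tm S m}
      {σ σ' τ : Ty S.toTySig n} (C : Cx S n m) : C.Linear →
      HasTy G L
        (Tm.letT σ σ' t ((C.rename (· + 2)).plug (u.rename id (exch 2 C.depth)))) τ →
      ExtEq G L
        (Tm.letT σ σ' t ((C.rename (· + 2)).plug (u.rename id (exch 2 C.depth))))
        (C.plug (Tm.letT (C.inTy σ) (C.inTy σ') (C.inTm t) u)) τ
  | commB {n m : ℕ} {G : List (TmDecl S.toTySig n)} {L : Finset ℕ} {t : Tm S n} {u : Tm S m}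
      {σ τ : Ty S.toTySig n} (C : Cx S n m) : C.Linear →
      HasTy G L
        (Tm.letB σ t ((C.rename (· + 1)).plug (u.rename id (exch 1 C.depth)))) τ →
      ExtEq G L
        (Tm.letB σ t ((C.rename (· + 1)).plug (u.rename id (exch 1 C.depth))))
        (C.plug (Tm.letB (C.inTy σ) (C.inTm t) u)) τ
  | fixpoint {n : ℕ} {G : List (TmDecl S.toTySig n)} {f : Tm S n} {σ : Ty S.toTySig n} :
      HasTy G ∅ f (Ty.lolli (Ty.bang σ) σ) →
      ExtEq G ∅ (Tm.app f (Tm.bang (Tm.app (Tm.tapp Tm.fixY σ) (Tm.bang f))))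
        (Tm.app (Tm.tapp Tm.fixY σ) (Tm.bang f)) σ

/-! ### The functorial action of a type, and the combinators `fold` and `in` -/

/-- The role of a free type variable of `σ` in the definition of its functorial action: either it is
the distinguished variable, or it is the parameter `i`. -/
inductive Role (n : ℕ) : Type
  | hole : Role n
  | par (i : Fin n) : Role n

namespace Role

def shift {n : ℕ} (k : ℕ) : Role n → Role (n + k)
  | hole => hole
  | par i => par (i.addNat k)

/-- The type substituted for a variable when `τ` is substituted for the distinguished one. -/
def toTy {S : TySig.{u}} {n : ℕ} (τ : Ty S n) : Role n → Ty S n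
  | hole => τ
  | par i => Ty.var i

/-- The roles under a binder `Πω`: the bound variable `ω` is a parameter. -/
def cons {n k : ℕ} (r : Fin k → Role (n + 1)) : Fin (k + 1) → Role (n + 1) :=
  Fin.cases (par 0) r

end Role

/-- `Λα. Λβ. λf:α ⊸ β. λ°z:σ(p). t`, where `σ(p)` is `σ(α)` if `p` is true and `σ(β)`
otherwise; in `t`, `α` and `β` are the type variables `1` and `0`, `z` is the term variable `0` and
`f` the term variable `1`. -/
def actWrap {n k : ℕ} (σ : Ty S.toTySig k) (p : Bool) (r : Fin k → Role n)
    (t : Tm S (n + 2)) : Tm S n :=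
  Tm.tlam (Tm.tlam (Tm.ilam (Ty.lolli (Ty.var 1) (Ty.var 0))
    (Tm.lam (σ.subst (fun i => ((r i).shift 2).toTy (Ty.var (if p then 1 else 0)))) t)))

/-- The functorial action `M_σ` of a type `σ` in its distinguished variable. If the latter occurs
only positively (`p = true`), then `M_σ : Πα. Πβ. (α ⊸ β) → σ(α) ⊸ σ(β)`; if it occurs only
negatively (`p = false`), then `M_σ : Πα. Πβ. (α ⊸ β) → σ(β) ⊸ σ(α)`. -/
def act : {k : ℕ} → Ty S.toTySig k → {n : ℕ} → Bool → (Fin k → Role n) → Tm S n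
  | _, Ty.var i, _, p, r =>
      match r i with
      | Role.hole =>
          Tm.tlam (Tm.tlam (Tm.ilam (Ty.lolli (Ty.var 1) (Ty.var 0)) (Tm.var 0)))
      | Role.par _ => actWrap (Ty.var i) p r (Tm.var 0)
  | _, Ty.con c args, _, p, r => actWrap (Ty.con c args) p r (Tm.var 0)
  | _, Ty.unit, _, p, r => actWrap Ty.unit p r (Tm.var 0)
  | _, Ty.tensor σ τ, _, p, r =>
      actWrap (Ty.tensor σ τ) p r
        (Tm.letT
          (σ.subst (fun i => ((r i).shift 2).toTy (Ty.var (if p then 1 else 0))))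
          (τ.subst (fun i => ((r i).shift 2).toTy (Ty.var (if p then 1 else 0))))
          (Tm.var 0)
          (Tm.tensor
            (Tm.app (Tm.app (Tm.tapp (Tm.tapp (act σ p (fun i => (r i).shift 2))
              (Ty.var 1)) (Ty.var 0)) (Tm.bang (Tm.var 3))) (Tm.var 1))
            (Tm.app (Tm.app (Tm.tapp (Tm.tapp (act τ p (fun i => (r i).shift 2))
              (Ty.var 1)) (Ty.var 0)) (Tm.bang (Tm.var 3))) (Tm.var 0))))
  | _, Ty.lolli σ τ, _, p, r =>
      actWrap (Ty.lolli σ τ) p r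
        (Tm.lam (σ.subst (fun i => ((r i).shift 2).toTy (Ty.var (if p then 0 else 1))))
          (Tm.app
            (Tm.app (Tm.tapp (Tm.tapp (act τ p (fun i => (r i).shift 2))
              (Ty.var 1)) (Ty.var 0)) (Tm.bang (Tm.var 2)))
            (Tm.app (Tm.var 1)
              (Tm.app
                (Tm.app (Tm.tapp (Tm.tapp (act σ (!p) (fun i => (r i).shift 2))
                  (Ty.var 1)) (Ty.var 0)) (Tm.bang (Tm.var 2)))
                (Tm.var 0)))))
  | _, Ty.bang σ, _, p, r =>
      actWrap (Ty.bang σ) p r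
        (Tm.letB
          (σ.subst (fun i => ((r i).shift 2).toTy (Ty.var (if p then 1 else 0))))
          (Tm.var 0)
          (Tm.bang
            (Tm.app (Tm.app (Tm.tapp (Tm.tapp (act σ p (fun i => (r i).shift 2))
              (Ty.var 1)) (Ty.var 0)) (Tm.bang (Tm.var 2))) (Tm.var 0))))
  | _, Ty.pi σ, _, p, r =>
      actWrap (Ty.pi σ) p r
        (Tm.tlam
          (Tm.app (Tm.app (Tm.tapp (Tm.tapp
              (act σ p (Role.cons (fun i => (r i).shift 3)))
              (Ty.var 2)) (Ty.var 1)) (Tm.bang (Tm.var 1)))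
            (Tm.tapp (Tm.var 0) (Ty.var 0))))

/-- `σ(f) = M_σ τ τ' !f : σ(τ) ⊸ σ(τ')` for `f : τ ⊸ τ'`, where `α` occurs only positively in
`α ⊢ σ(α)`. -/
def fmap {n : ℕ} (σ : Ty S.toTySig 1) (τ τ' : Ty S.toTySig n) (f : Tm S n) : Tm S n :=
  Tm.app (Tm.tapp (Tm.tapp (act σ true (fun _ => Role.hole)) τ) τ') (Tm.bang f)

/-- `fold = Λα. λf:σ(α) ⊸ α. λ°u:μα.σ(α). u α !f`. -/
def fold {n : ℕ} (σ : Ty S.toTySig 1) : Tm S n :=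
  Tm.tlam (Tm.ilam (Ty.lolli (σ.at1 (Ty.var 0)) (Ty.var 0))
    (Tm.lam σ.mu (Tm.app (Tm.tapp (Tm.var 0) (Ty.var 0)) (Tm.bang (Tm.var 1)))))

/-- `in = λ°z:σ(μα.σ(α)). Λα. λf:σ(α) ⊸ α. f (σ(fold α !f) z)`. -/
def inMap {n : ℕ} (σ : Ty S.toTySig 1) : Tm S n :=
  Tm.lam (σ.at1 σ.mu)
    (Tm.tlam (Tm.ilam (Ty.lolli (σ.at1 (Ty.var 0)) (Ty.var 0))
      (Tm.app (Tm.var 0)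
        (Tm.app
          (fmap σ σ.mu (Ty.var 0)
            (Tm.app (Tm.tapp (fold σ) (Ty.var 0)) (Tm.bang (Tm.var 0))))
          (Tm.var 1)))))

/-! ### Propositions and definable relations -/

/-- Arbitrary definable relations (`any`), or admissible ones (`adm`). -/
inductive RelKind : Type
  | any : RelKind
  | adm : RelKind

inductive Quant : Type
  | all : Quant
  | ex : Quant

/-- The two classes of expressions of the logic. -/
inductive Srt : Type
  | prop : Srt
  | rel : Srt

/-- Raw propositions and raw definable relations with `n` type variables. `abs σ τ φ` is
`(x:σ, y:τ). φ`, where `x` is index `1` and `y` is index `0`. `interp σ ρs` is the relational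
interpretation `σ[ρ₁, …, ρₖ]` of a type `α₁, …, αₖ ⊢ σ`. -/
inductive Ex (S : Sig.{u}) : Srt → ℕ → Type u
  | eq {n : ℕ} (σ : Ty S.toTySig n) (t s : Tm S n) : Ex S Srt.prop n
  | rapp {n : ℕ} (ρ : Ex S Srt.rel n) (t s : Tm S n) : Ex S Srt.prop n
  | imp {n : ℕ} (φ ψ : Ex S Srt.prop n) : Ex S Srt.prop n
  | bot {n : ℕ} : Ex S Srt.prop n
  | top {n : ℕ} : Ex S Srt.prop n
  | and {n : ℕ} (φ ψ : Ex S Srt.prop n) : Ex S Srt.prop n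
  | or {n : ℕ} (φ ψ : Ex S Srt.prop n) : Ex S Srt.prop n
  | qTy {n : ℕ} (q : Quant) (φ : Ex S Srt.prop (n + 1)) : Ex S Srt.prop n
  | qTm {n : ℕ} (q : Quant) (σ : Ty S.toTySig n) (φ : Ex S Srt.prop n) : Ex S Srt.prop n
  | qRel {n : ℕ} (q : Quant) (k : RelKind) (σ τ : Ty S.toTySig n) (φ : Ex S Srt.prop n) :
      Ex S Srt.prop n
  | rvar {n : ℕ} (i : ℕ) : Ex S Srt.rel n
  | abs {n : ℕ} (σ τ : Ty S.toTySig n) (φ : Ex S Srt.prop n) : Ex S Srt.rel n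
  | interp {n k : ℕ} (σ : Ty S.toTySig k) (ρs : Fin k → Ex S Srt.rel n) : Ex S Srt.rel n

/-- Propositions. -/
abbrev Fml (S : Sig.{u}) (n : ℕ) : Type u := Ex S Srt.prop n

/-- Definable relations. -/
abbrev DRel (S : Sig.{u}) (n : ℕ) : Type u := Ex S Srt.rel n

namespace Ex

/-- Renaming of type variables (`ξ`), term variables (`ζ`) and relation variables (`η`). -/
def rename : {s : Srt} → {n : ℕ} → Ex S s n → {m : ℕ} → (Fin n → Fin m) → (ℕ → ℕ) →
    (ℕ → ℕ) → Ex S s m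
  | _, _, eq σ t u, _, ξ, ζ, _ => eq (σ.rename ξ) (t.rename ξ ζ) (u.rename ξ ζ)
  | _, _, rapp ρ t u, _, ξ, ζ, η => rapp (ρ.rename ξ ζ η) (t.rename ξ ζ) (u.rename ξ ζ)
  | _, _, imp φ ψ, _, ξ, ζ, η => imp (φ.rename ξ ζ η) (ψ.rename ξ ζ η)
  | _, _, bot, _, _, _, _ => bot
  | _, _, top, _, _, _, _ => top
  | _, _, and φ ψ, _, ξ, ζ, η => and (φ.rename ξ ζ η) (ψ.rename ξ ζ η)
  | _, _, or φ ψ, _, ξ, ζ, η => or (φ.rename ξ ζ η) (ψ.rename ξ ζ η)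
  | _, _, qTy q φ, _, ξ, ζ, η => qTy q (φ.rename (liftF ξ) ζ η)
  | _, _, qTm q σ φ, _, ξ, ζ, η => qTm q (σ.rename ξ) (φ.rename ξ (liftN ζ) η)
  | _, _, qRel q k σ τ φ, _, ξ, ζ, η =>
      qRel q k (σ.rename ξ) (τ.rename ξ) (φ.rename ξ ζ (liftN η))
  | _, _, rvar i, _, _, _, η => rvar (η i)
  | _, _, abs σ τ φ, _, ξ, ζ, η =>
      abs (σ.rename ξ) (τ.rename ξ) (φ.rename ξ (liftN (liftN ζ)) η)
  | _, _, interp σ ρs, _, ξ, ζ, η => interp σ (fun i => (ρs i).rename ξ ζ η)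

/-- Weakening by one type variable. -/
def wkTy {s : Srt} {n : ℕ} (e : Ex S s n) : Ex S s (n + 1) := e.rename Fin.succ id id

/-- Weakening by `k` term variables. -/
def wkTm {s : Srt} {n : ℕ} (k : ℕ) (e : Ex S s n) : Ex S s n := e.rename id (· + k) id

/-- Weakening by one relation variable. -/
def wkRel {s : Srt} {n : ℕ} (e : Ex S s n) : Ex S s n := e.rename id id Nat.succ

/-- Lift a substitution of relations under a relation binder. -/
def up {n : ℕ} (r : ℕ → DRel S n) : ℕ → DRel S n
  | 0 => rvar 0
  | i + 1 => (r i).wkRel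

/-- Simultaneous substitution of types (`θ`), terms (`v`) and relations (`r`). -/
def subst : {s : Srt} → {n : ℕ} → Ex S s n → {m : ℕ} → (Fin n → Ty S.toTySig m) →
    (ℕ → Tm S m) → (ℕ → DRel S m) → Ex S s m
  | _, _, eq σ t u, _, θ, v, _ => eq (σ.subst θ) (t.subst θ v) (u.subst θ v)
  | _, _, rapp ρ t u, _, θ, v, r => rapp (ρ.subst θ v r) (t.subst θ v) (u.subst θ v)
  | _, _, imp φ ψ, _, θ, v, r => imp (φ.subst θ v r) (ψ.subst θ v r)
  | _, _, bot, _, _, _, _ => bot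
  | _, _, top, _, _, _, _ => top
  | _, _, and φ ψ, _, θ, v, r => and (φ.subst θ v r) (ψ.subst θ v r)
  | _, _, or φ ψ, _, θ, v, r => or (φ.subst θ v r) (ψ.subst θ v r)
  | _, _, qTy q φ, _, θ, v, r =>
      qTy q (φ.subst (Ty.up θ) (fun i => (v i).wkTy) (fun i => (r i).wkTy))
  | _, _, qTm q σ φ, _, θ, v, r =>
      qTm q (σ.subst θ) (φ.subst θ (Tm.up v) (fun i => (r i).wkTm 1))
  | _, _, qRel q k σ τ φ, _, θ, v, r =>
      qRel q k (σ.subst θ) (τ.subst θ) (φ.subst θ v (up r))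
  | _, _, rvar i, _, _, _, r => r i
  | _, _, abs σ τ φ, _, θ, v, r =>
      abs (σ.subst θ) (τ.subst θ) (φ.subst θ (Tm.up (Tm.up v)) (fun i => (r i).wkTm 2))
  | _, _, interp σ ρs, _, θ, v, r => interp σ (fun i => (ρs i).subst θ v r)

/-- The substitution replacing the last relation variable by `ρ`. -/
def single {n : ℕ} (ρ : DRel S n) : ℕ → DRel S n
  | 0 => ρ
  | i + 1 => rvar i

/-- `φ[σ/α]` for the last type variable `α`. -/
def instTy {n : ℕ} (φ : Fml S (n + 1)) (σ : Ty S.toTySig n) : Fml S n :=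
  φ.subst (Ty.single σ) Tm.var rvar

/-- `φ[t/x]` for the last term variable `x`. -/
def instTm {n : ℕ} (φ : Fml S n) (t : Tm S n) : Fml S n := φ.subst Ty.var (Tm.single t) rvar

/-- `φ[t, s/x, y]` for the last two term variables `x`, `y`. -/
def instTm₂ {n : ℕ} (φ : Fml S n) (t s : Tm S n) : Fml S n :=
  φ.subst Ty.var (Tm.pair t s) rvar

/-- `φ[ρ/R]` for the last relation variable `R`. -/
def instRel {n : ℕ} (φ : Fml S n) (ρ : DRel S n) : Fml S n := φ.subst Ty.var Tm.var (single ρ)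

/-- Biimplication. -/
def iff {n : ℕ} (φ ψ : Fml S n) : Fml S n := and (imp φ ψ) (imp ψ φ)

/-- `∀α. φ`. -/
def allTy {n : ℕ} (φ : Fml S (n + 1)) : Fml S n := qTy Quant.all φ

/-- `∀x:σ. φ`. -/
def allTm {n : ℕ} (σ : Ty S.toTySig n) (φ : Fml S n) : Fml S n := qTm Quant.all σ φ

/-- `∀S : Adm(σ, τ). φ`. -/
def allAdm {n : ℕ} (σ τ : Ty S.toTySig n) (φ : Fml S n) : Fml S n :=
  qRel Quant.all RelKind.adm σ τ φ

/-- `∀R : Rel(σ, τ). φ`. -/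
def allRel {n : ℕ} (σ τ : Ty S.toTySig n) (φ : Fml S n) : Fml S n :=
  qRel Quant.all RelKind.any σ τ φ

/-- `ρ ≡ ρ'`, i.e. `∀x:σ. ∀y:τ. ρ(x, y) ⊃⊂ ρ'(x, y)`. -/
def equiv {n : ℕ} (σ τ : Ty S.toTySig n) (ρ ρ' : DRel S n) : Fml S n :=
  allTm σ (allTm τ (iff (rapp (ρ.wkTm 2) (Tm.var 1) (Tm.var 0))
    (rapp (ρ'.wkTm 2) (Tm.var 1) (Tm.var 0))))

/-! ### Constructions on definable relations -/

/-- The graph `⟨f⟩ = (x:σ, y:τ). f x =_τ y`. -/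
def graph {n : ℕ} (σ τ : Ty S.toTySig n) (f : Tm S n) : DRel S n :=
  abs σ τ (eq τ (Tm.app f.wk.wk (Tm.var 1)) (Tm.var 0))

/-- The equality relation: the graph of the identity. -/
def eqRel {n : ℕ} (σ : Ty S.toTySig n) : DRel S n := graph σ σ (Tm.idm σ)

/-- Reindexing `(f, g)^*ρ = (x:σ', y:τ'). ρ(f x, g y)`. -/
def reindex {n : ℕ} (σ' τ' : Ty S.toTySig n) (f g : Tm S n) (ρ : DRel S n) : DRel S n :=
  abs σ' τ' (rapp (ρ.wkTm 2) (Tm.app f.wk.wk (Tm.var 1)) (Tm.app g.wk.wk (Tm.var 0)))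

/-- `ρ ⊸ ρ'` for `ρ : Rel(σ, τ)` and `ρ' : Rel(σ', τ')`. -/
def lolliR {n : ℕ} (σ τ σ' τ' : Ty S.toTySig n) (ρ ρ' : DRel S n) : DRel S n :=
  abs (Ty.lolli σ σ') (Ty.lolli τ τ')
    (allTm σ (allTm τ (imp (rapp (ρ.wkTm 4) (Tm.var 1) (Tm.var 0))
      (rapp (ρ'.wkTm 4) (Tm.app (Tm.var 3) (Tm.var 1)) (Tm.app (Tm.var 2) (Tm.var 0))))))

/-- `ρ → ρ'` for `ρ : Rel(σ, τ)` and `ρ' : Rel(σ', τ')`. -/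
def arrowR {n : ℕ} (σ τ σ' τ' : Ty S.toTySig n) (ρ ρ' : DRel S n) : DRel S n :=
  abs (Ty.arrow σ σ') (Ty.arrow τ τ')
    (allTm σ (allTm τ (imp (rapp (ρ.wkTm 4) (Tm.var 1) (Tm.var 0))
      (rapp (ρ'.wkTm 4) (Tm.app (Tm.var 3) (Tm.bang (Tm.var 1)))
        (Tm.app (Tm.var 2) (Tm.bang (Tm.var 0)))))))

/-- `∀(α, β, R : Adm(α, β)). ρ : Rel(Πα.σ, Πβ.τ)`, where `ρ` has `α`, `β` as its type variables
`1`, `0` and `R` as its relation variable `0`. -/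
def piR {n : ℕ} (σ τ : Ty S.toTySig (n + 1)) (ρ : DRel S (n + 2)) : DRel S n :=
  abs (Ty.pi σ) (Ty.pi τ)
    (allTy (allTy (allAdm (Ty.var 1) (Ty.var 0)
      (rapp (ρ.wkTm 2) (Tm.tapp (Tm.var 1) (Ty.var 1)) (Tm.tapp (Tm.var 0) (Ty.var 0))))))

/-- Weakening of a relation to the scope of `∀(α, β, R : Adm(α, β))`. -/
def wkPi {n : ℕ} (ρ : DRel S n) : DRel S (n + 2) := ρ.wkTy.wkTy.wkRel

/-- `λ°x:σ ⊗ σ'. let x' ⊗ x'' be x in Λα. λ°h:σ ⊸ σ' ⊸ α. h x' x''`. -/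
def tensorMap {n : ℕ} (σ σ' : Ty S.toTySig n) : Tm S n :=
  Tm.lam (Ty.tensor σ σ') (Tm.letT σ σ' (Tm.var 0)
    (Tm.tlam (Tm.lam (Ty.lolli σ.wk (Ty.lolli σ'.wk (Ty.var 0)))
      (Tm.app (Tm.app (Tm.var 0) (Tm.var 2)) (Tm.var 1)))))

/-- `ρ ⊗ ρ'` for `ρ : Rel(σ, τ)` and `ρ' : Rel(σ', τ')`: the reindexing of
`∀(α, β, R : Adm(α, β)). (ρ ⊸ ρ' ⊸ R) ⊸ R`. -/
def tensorR {n : ℕ} (σ τ σ' τ' : Ty S.toTySig n) (ρ ρ' : DRel S n) : DRel S n :=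
  reindex (Ty.tensor σ σ') (Ty.tensor τ τ') (tensorMap σ σ') (tensorMap τ τ')
    (piR (Ty.lolli (Ty.lolli σ.wk (Ty.lolli σ'.wk (Ty.var 0))) (Ty.var 0))
      (Ty.lolli (Ty.lolli τ.wk (Ty.lolli τ'.wk (Ty.var 0))) (Ty.var 0))
      (lolliR (Ty.lolli σ.wk.wk (Ty.lolli σ'.wk.wk (Ty.var 1)))
        (Ty.lolli τ.wk.wk (Ty.lolli τ'.wk.wk (Ty.var 0))) (Ty.var 1) (Ty.var 0)
        (lolliR σ.wk.wk τ.wk.wk (Ty.lolli σ'.wk.wk (Ty.var 1)) (Ty.lolli τ'.wk.wk (Ty.var 0))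
          (wkPi ρ)
          (lolliR σ'.wk.wk τ'.wk.wk (Ty.var 1) (Ty.var 0) (wkPi ρ') (rvar 0)))
        (rvar 0)))

/-- `λ°x:I. let ⋆ be x in Λα. λ°y:α. y`. -/
def unitMap {n : ℕ} : Tm S n :=
  Tm.lam Ty.unit (Tm.letU (Tm.var 0) (Tm.tlam (Tm.idm (Ty.var 0))))

/-- `I_Rel`: the reindexing of `∀(α, β, R : Adm(α, β)). R ⊸ R`. -/
def unitR {n : ℕ} : DRel S n :=
  reindex Ty.unit Ty.unit unitMap unitMap
    (piR (Ty.lolli (Ty.var 0) (Ty.var 0)) (Ty.lolli (Ty.var 0) (Ty.var 0))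
      (lolliR (Ty.var 1) (Ty.var 0) (Ty.var 1) (Ty.var 0) (rvar 0) (rvar 0)))

/-- `λ°x:!σ. Λα. λ°g:σ → α. g x`. -/
def bangMap {n : ℕ} (σ : Ty S.toTySig n) : Tm S n :=
  Tm.lam (Ty.bang σ) (Tm.tlam (Tm.lam (Ty.arrow σ.wk (Ty.var 0))
    (Tm.app (Tm.var 0) (Tm.var 1))))

/-- `!ρ` for `ρ : Rel(σ, τ)`: the reindexing of `∀(α, β, R : Adm(α, β)). (ρ → R) ⊸ R`. -/
def bangR {n : ℕ} (σ τ : Ty S.toTySig n) (ρ : DRel S n) : DRel S n :=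
  reindex (Ty.bang σ) (Ty.bang τ) (bangMap σ) (bangMap τ)
    (piR (Ty.lolli (Ty.arrow σ.wk (Ty.var 0)) (Ty.var 0))
      (Ty.lolli (Ty.arrow τ.wk (Ty.var 0)) (Ty.var 0))
      (lolliR (Ty.arrow σ.wk.wk (Ty.var 1)) (Ty.arrow τ.wk.wk (Ty.var 0))
        (Ty.var 1) (Ty.var 0)
        (arrowR σ.wk.wk τ.wk.wk (Ty.var 1) (Ty.var 0) (wkPi ρ) (rvar 0)) (rvar 0)))

/-- `(t, s) : ρ ⊸ ρ'`. -/
def maps {n : ℕ} (σ τ σ' τ' : Ty S.toTySig n) (ρ ρ' : DRel S n) (t s : Tm S n) : Fml S n :=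
  rapp (lolliR σ τ σ' τ' ρ ρ') t s

end Ex

/-! ### Judgements of the logic -/

/-- A declaration `R : Rel(σ, τ)` or `S : Adm(σ, τ)` of a relation variable. -/
structure RelDecl (S : TySig.{u}) (n : ℕ) where
  kind : RelKind
  dom : Ty S n
  cod : Ty S n

namespace RelDecl

variable {T : TySig.{u}}

def wk {n : ℕ} (d : RelDecl T n) : RelDecl T (n + 1) := ⟨d.kind, d.dom.wk, d.cod.wk⟩

def subst {n m : ℕ} (d : RelDecl T n) (θ : Fin n → Ty T m) : RelDecl T m :=
  ⟨d.kind, d.dom.subst θ, d.cod.subst θ⟩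

end RelDecl

/-- Families of additional axioms: `Ax Γ Θ φ` says that `φ` is an axiom in context. -/
abbrev Axioms (S : Sig.{u}) : Type u :=
  ⦃n : ℕ⦄ → List (Ty S.toTySig n) → List (RelDecl S.toTySig n) → Fml S n → Prop

mutual

/-- `Ξ | Γ | Θ ⊢ φ : Prop`. -/
inductive IsProp {S : Sig.{u}} (Ax : Axioms S) : {n : ℕ} → List (Ty S.toTySig n) →
    List (RelDecl S.toTySig n) → Fml S n → Prop
  | eq {n : ℕ} {Γ : List (Ty S.toTySig n)} {Θ : List (RelDecl S.toTySig n)}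
      {σ : Ty S.toTySig n} {t s : Tm S n} :
      HasTy (intCtx Γ) ∅ t σ → HasTy (intCtx Γ) ∅ s σ → IsProp Ax Γ Θ (Ex.eq σ t s)
  | rapp {n : ℕ} {Γ : List (Ty S.toTySig n)} {Θ : List (RelDecl S.toTySig n)}
      {σ τ : Ty S.toTySig n} {ρ : DRel S n} {t s : Tm S n} :
      IsRel Ax Γ Θ ρ σ τ → HasTy (intCtx Γ) ∅ t σ → HasTy (intCtx Γ) ∅ s τ →
      IsProp Ax Γ Θ (Ex.rapp ρ t s)
  | imp {n : ℕ} {Γ : List (Ty S.toTySig n)} {Θ : List (RelDecl S.toTySig n)} {φ ψ : Fml S n} :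
      IsProp Ax Γ Θ φ → IsProp Ax Γ Θ ψ → IsProp Ax Γ Θ (Ex.imp φ ψ)
  | bot {n : ℕ} {Γ : List (Ty S.toTySig n)} {Θ : List (RelDecl S.toTySig n)} :
      IsProp Ax Γ Θ Ex.bot
  | top {n : ℕ} {Γ : List (Ty S.toTySig n)} {Θ : List (RelDecl S.toTySig n)} :
      IsProp Ax Γ Θ Ex.top
  | and {n : ℕ} {Γ : List (Ty S.toTySig n)} {Θ : List (RelDecl S.toTySig n)} {φ ψ : Fml S n} :
      IsProp Ax Γ Θ φ → IsProp Ax Γ Θ ψ → IsProp Ax Γ Θ (Ex.and φ ψ)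
  | or {n : ℕ} {Γ : List (Ty S.toTySig n)} {Θ : List (RelDecl S.toTySig n)} {φ ψ : Fml S n} :
      IsProp Ax Γ Θ φ → IsProp Ax Γ Θ ψ → IsProp Ax Γ Θ (Ex.or φ ψ)
  | qTy {n : ℕ} {Γ : List (Ty S.toTySig n)} {Θ : List (RelDecl S.toTySig n)} (q : Quant)
      {φ : Fml S (n + 1)} :
      IsProp Ax (Γ.map Ty.wk) (Θ.map RelDecl.wk) φ → IsProp Ax Γ Θ (Ex.qTy q φ)
  | qTm {n : ℕ} {Γ : List (Ty S.toTySig n)} {Θ : List (RelDecl S.toTySig n)} (q : Quant)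
      {σ : Ty S.toTySig n} {φ : Fml S n} :
      IsProp Ax (σ :: Γ) Θ φ → IsProp Ax Γ Θ (Ex.qTm q σ φ)
  | qRel {n : ℕ} {Γ : List (Ty S.toTySig n)} {Θ : List (RelDecl S.toTySig n)} (q : Quant)
      {k : RelKind} {σ τ : Ty S.toTySig n} {φ : Fml S n} :
      IsProp Ax Γ (⟨k, σ, τ⟩ :: Θ) φ → IsProp Ax Γ Θ (Ex.qRel q k σ τ φ)

/-- `Ξ | Γ | Θ ⊢ ρ : Rel(σ, τ)`. -/
inductive IsRel {S : Sig.{u}} (Ax : Axioms S) : {n : ℕ} → List (Ty S.toTySig n) →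
    List (RelDecl S.toTySig n) → DRel S n → Ty S.toTySig n → Ty S.toTySig n → Prop
  | rvar {n : ℕ} {Γ : List (Ty S.toTySig n)} {Θ : List (RelDecl S.toTySig n)} {i : ℕ}
      {σ τ : Ty S.toTySig n} :
      Θ[i]? = some ⟨RelKind.any, σ, τ⟩ → IsRel Ax Γ Θ (Ex.rvar i) σ τ
  | abs {n : ℕ} {Γ : List (Ty S.toTySig n)} {Θ : List (RelDecl S.toTySig n)}
      {σ τ : Ty S.toTySig n} {φ : Fml S n} :
      IsProp Ax (τ :: σ :: Γ) Θ φ → IsRel Ax Γ Θ (Ex.abs σ τ φ) σ τ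
  | ofAdm {n : ℕ} {Γ : List (Ty S.toTySig n)} {Θ : List (RelDecl S.toTySig n)}
      {σ τ : Ty S.toTySig n} {ρ : DRel S n} :
      IsAdm Ax Γ Θ ρ σ τ → IsRel Ax Γ Θ ρ σ τ

/-- `Ξ | Γ | Θ ⊢ ρ : Adm(σ, τ)`. -/
inductive IsAdm {S : Sig.{u}} (Ax : Axioms S) : {n : ℕ} → List (Ty S.toTySig n) →
    List (RelDecl S.toTySig n) → DRel S n → Ty S.toTySig n → Ty S.toTySig n → Prop
  | rvar {n : ℕ} {Γ : List (Ty S.toTySig n)} {Θ : List (RelDecl S.toTySig n)} {i : ℕ}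
      {σ τ : Ty S.toTySig n} :
      Θ[i]? = some ⟨RelKind.adm, σ, τ⟩ → IsAdm Ax Γ Θ (Ex.rvar i) σ τ
  | eqRel {n : ℕ} {Γ : List (Ty S.toTySig n)} {Θ : List (RelDecl S.toTySig n)}
      (σ : Ty S.toTySig n) : IsAdm Ax Γ Θ (Ex.eqRel σ) σ σ
  | reindex {n : ℕ} {Γ : List (Ty S.toTySig n)} {Θ : List (RelDecl S.toTySig n)}
      {σ τ σ' τ' : Ty S.toTySig n} {ρ : DRel S n} {t u : Tm S n} :
      IsAdm Ax Γ Θ ρ σ τ → HasTy (intCtx Γ) ∅ t (Ty.lolli σ' σ) →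
      HasTy (intCtx Γ) ∅ u (Ty.lolli τ' τ) →
      IsAdm Ax Γ Θ (Ex.reindex σ' τ' t u ρ) σ' τ'
  | and {n : ℕ} {Γ : List (Ty S.toTySig n)} {Θ : List (RelDecl S.toTySig n)}
      {σ τ : Ty S.toTySig n} {ρ ρ' : DRel S n} :
      IsAdm Ax Γ Θ ρ σ τ → IsAdm Ax Γ Θ ρ' σ τ →
      IsAdm Ax Γ Θ (Ex.abs σ τ (Ex.and (Ex.rapp (ρ.wkTm 2) (Tm.var 1) (Tm.var 0))
        (Ex.rapp (ρ'.wkTm 2) (Tm.var 1) (Tm.var 0)))) σ τ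
  | op {n : ℕ} {Γ : List (Ty S.toTySig n)} {Θ : List (RelDecl S.toTySig n)}
      {σ τ : Ty S.toTySig n} {ρ : DRel S n} :
      IsAdm Ax Γ Θ ρ σ τ →
      IsAdm Ax Γ Θ (Ex.abs τ σ (Ex.rapp (ρ.wkTm 2) (Tm.var 0) (Tm.var 1))) τ σ
  | top {n : ℕ} {Γ : List (Ty S.toTySig n)} {Θ : List (RelDecl S.toTySig n)}
      (σ τ : Ty S.toTySig n) : IsAdm Ax Γ Θ (Ex.abs σ τ Ex.top) σ τ
  | imp {n : ℕ} {Γ : List (Ty S.toTySig n)} {Θ : List (RelDecl S.toTySig n)}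
      {σ τ : Ty S.toTySig n} {ρ : DRel S n} {φ : Fml S n} :
      IsAdm Ax Γ Θ ρ σ τ → IsProp Ax Γ Θ φ →
      IsAdm Ax Γ Θ (Ex.abs σ τ (Ex.imp (φ.wkTm 2)
        (Ex.rapp (ρ.wkTm 2) (Tm.var 1) (Tm.var 0)))) σ τ
  | allTy {n : ℕ} {Γ : List (Ty S.toTySig n)} {Θ : List (RelDecl S.toTySig n)}
      {σ τ : Ty S.toTySig n} {ρ : DRel S (n + 1)} :
      IsAdm Ax (Γ.map Ty.wk) (Θ.map RelDecl.wk) ρ σ.wk τ.wk →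
      IsAdm Ax Γ Θ (Ex.abs σ τ (Ex.allTy
        (Ex.rapp (ρ.wkTm 2) (Tm.var 1) (Tm.var 0)))) σ τ
  | allTm {n : ℕ} {Γ : List (Ty S.toTySig n)} {Θ : List (RelDecl S.toTySig n)}
      {σ τ ω : Ty S.toTySig n} {ρ : DRel S n} :
      IsAdm Ax (ω :: Γ) Θ ρ σ τ →
      IsAdm Ax Γ Θ (Ex.abs σ τ (Ex.allTm ω
        (Ex.rapp (ρ.rename id (liftN (· + 2)) id) (Tm.var 2) (Tm.var 1)))) σ τ
  | allRel {n : ℕ} {Γ : List (Ty S.toTySig n)} {Θ : List (RelDecl S.toTySig n)}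
      {σ τ ω ω' : Ty S.toTySig n} {ρ : DRel S n} (k : RelKind) :
      IsAdm Ax Γ (⟨k, ω, ω'⟩ :: Θ) ρ σ τ →
      IsAdm Ax Γ Θ (Ex.abs σ τ (Ex.qRel Quant.all k ω ω'
        (Ex.rapp (ρ.wkTm 2) (Tm.var 1) (Tm.var 0)))) σ τ
  | equiv {n : ℕ} {Γ : List (Ty S.toTySig n)} {Θ : List (RelDecl S.toTySig n)}
      {σ τ : Ty S.toTySig n} {ρ ρ' : DRel S n} :
      IsAdm Ax Γ Θ ρ σ τ → IsRel Ax Γ Θ ρ' σ τ →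
      Prov Ax Γ Θ [] (Ex.equiv σ τ ρ ρ') → IsAdm Ax Γ Θ ρ' σ τ
  | interp {n : ℕ} {Γ : List (Ty S.toTySig n)} {Θ : List (RelDecl S.toTySig n)} {k : ℕ}
      (σ : Ty S.toTySig k) {ρs : Fin k → DRel S n} {τs τs' : Fin k → Ty S.toTySig n} :
      (∀ i, IsAdm Ax Γ Θ (ρs i) (τs i) (τs' i)) →
      IsAdm Ax Γ Θ (Ex.interp σ ρs) (σ.subst τs) (σ.subst τs')

/-- `Ξ | Γ | Θ | Φ ⊢ φ`: provability in LAPL extended by the axioms `Ax`. The empty list of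
hypotheses plays the role of the hypothesis `⊤`. -/
inductive Prov {S : Sig.{u}} (Ax : Axioms S) : {n : ℕ} → List (Ty S.toTySig n) →
    List (RelDecl S.toTySig n) → List (Fml S n) → Fml S n → Prop
  -- additional axioms
  | ax {n : ℕ} {Γ : List (Ty S.toTySig n)} {Θ : List (RelDecl S.toTySig n)} {φ : Fml S n} :
      Ax Γ Θ φ → Prov Ax Γ Θ [] φ
  -- intuitionistic propositional logic
  | hyp {n : ℕ} {Γ : List (Ty S.toTySig n)} {Θ : List (RelDecl S.toTySig n)}
      {Φ : List (Fml S n)} {φ : Fml S n} :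
      (∀ ψ ∈ Φ, IsProp Ax Γ Θ ψ) → φ ∈ Φ → Prov Ax Γ Θ Φ φ
  | weaken {n : ℕ} {Γ : List (Ty S.toTySig n)} {Θ : List (RelDecl S.toTySig n)}
      {Φ Φ' : List (Fml S n)} {φ : Fml S n} :
      (∀ ψ ∈ Φ', IsProp Ax Γ Θ ψ) → Φ ⊆ Φ' → Prov Ax Γ Θ Φ φ → Prov Ax Γ Θ Φ' φ
  | topI {n : ℕ} {Γ : List (Ty S.toTySig n)} {Θ : List (RelDecl S.toTySig n)} :
      Prov Ax Γ Θ [] Ex.top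
  | botE {n : ℕ} {Γ : List (Ty S.toTySig n)} {Θ : List (RelDecl S.toTySig n)}
      {Φ : List (Fml S n)} {φ : Fml S n} :
      Prov Ax Γ Θ Φ Ex.bot → IsProp Ax Γ Θ φ → Prov Ax Γ Θ Φ φ
  | andI {n : ℕ} {Γ : List (Ty S.toTySig n)} {Θ : List (RelDecl S.toTySig n)}
      {Φ : List (Fml S n)} {φ ψ : Fml S n} :
      Prov Ax Γ Θ Φ φ → Prov Ax Γ Θ Φ ψ → Prov Ax Γ Θ Φ (Ex.and φ ψ)
  | andE₁ {n : ℕ} {Γ : List (Ty S.toTySig n)} {Θ : List (RelDecl S.toTySig n)}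
      {Φ : List (Fml S n)} {φ ψ : Fml S n} :
      Prov Ax Γ Θ Φ (Ex.and φ ψ) → Prov Ax Γ Θ Φ φ
  | andE₂ {n : ℕ} {Γ : List (Ty S.toTySig n)} {Θ : List (RelDecl S.toTySig n)}
      {Φ : List (Fml S n)} {φ ψ : Fml S n} :
      Prov Ax Γ Θ Φ (Ex.and φ ψ) → Prov Ax Γ Θ Φ ψ
  | orI₁ {n : ℕ} {Γ : List (Ty S.toTySig n)} {Θ : List (RelDecl S.toTySig n)}
      {Φ : List (Fml S n)} {φ ψ : Fml S n} :
      Prov Ax Γ Θ Φ φ → IsProp Ax Γ Θ ψ → Prov Ax Γ Θ Φ (Ex.or φ ψ)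
  | orI₂ {n : ℕ} {Γ : List (Ty S.toTySig n)} {Θ : List (RelDecl S.toTySig n)}
      {Φ : List (Fml S n)} {φ ψ : Fml S n} :
      Prov Ax Γ Θ Φ ψ → IsProp Ax Γ Θ φ → Prov Ax Γ Θ Φ (Ex.or φ ψ)
  | orE {n : ℕ} {Γ : List (Ty S.toTySig n)} {Θ : List (RelDecl S.toTySig n)}
      {Φ : List (Fml S n)} {φ ψ χ : Fml S n} :
      Prov Ax Γ Θ Φ (Ex.or φ ψ) → Prov Ax Γ Θ (φ :: Φ) χ → Prov Ax Γ Θ (ψ :: Φ) χ →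
      Prov Ax Γ Θ Φ χ
  | impI {n : ℕ} {Γ : List (Ty S.toTySig n)} {Θ : List (RelDecl S.toTySig n)}
      {Φ : List (Fml S n)} {φ ψ : Fml S n} :
      Prov Ax Γ Θ (φ :: Φ) ψ → Prov Ax Γ Θ Φ (Ex.imp φ ψ)
  | impE {n : ℕ} {Γ : List (Ty S.toTySig n)} {Θ : List (RelDecl S.toTySig n)}
      {Φ : List (Fml S n)} {φ ψ : Fml S n} :
      Prov Ax Γ Θ Φ (Ex.imp φ ψ) → Prov Ax Γ Θ Φ φ → Prov Ax Γ Θ Φ ψ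
  -- substitution rules
  | substTm {n : ℕ} {Γ : List (Ty S.toTySig n)} {Θ : List (RelDecl S.toTySig n)}
      {σ : Ty S.toTySig n} {t : Tm S n} {φ : Fml S n} :
      Prov Ax (σ :: Γ) Θ [] φ → HasTy (intCtx Γ) ∅ t σ → Prov Ax Γ Θ [] (φ.instTm t)
  | substRel {n : ℕ} {Γ : List (Ty S.toTySig n)} {Θ : List (RelDecl S.toTySig n)}
      {σ τ : Ty S.toTySig n} {ρ : DRel S n} {φ : Fml S n} :
      Prov Ax Γ (⟨RelKind.any, σ, τ⟩ :: Θ) [] φ → IsRel Ax Γ Θ ρ σ τ →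
      Prov Ax Γ Θ [] (φ.instRel ρ)
  | substAdm {n : ℕ} {Γ : List (Ty S.toTySig n)} {Θ : List (RelDecl S.toTySig n)}
      {σ τ : Ty S.toTySig n} {ρ : DRel S n} {φ : Fml S n} :
      Prov Ax Γ (⟨RelKind.adm, σ, τ⟩ :: Θ) [] φ → IsAdm Ax Γ Θ ρ σ τ →
      Prov Ax Γ Θ [] (φ.instRel ρ)
  | substTy {n : ℕ} {Γ : List (Ty S.toTySig (n + 1))} {Θ : List (RelDecl S.toTySig (n + 1))}
      {φ : Fml S (n + 1)} (σ : Ty S.toTySig n) :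
      Prov Ax Γ Θ [] φ →
      Prov Ax (Γ.map (fun τ => τ.inst σ)) (Θ.map (fun d => d.subst (Ty.single σ))) []
        (φ.instTy σ)
  -- quantifiers; each rule is invertible
  | allTyI {n : ℕ} {Γ : List (Ty S.toTySig n)} {Θ : List (RelDecl S.toTySig n)}
      {Φ : List (Fml S n)} {ψ : Fml S (n + 1)} :
      Prov Ax (Γ.map Ty.wk) (Θ.map RelDecl.wk) (Φ.map Ex.wkTy) ψ →
      Prov Ax Γ Θ Φ (Ex.qTy Quant.all ψ)
  | allTyE {n : ℕ} {Γ : List (Ty S.toTySig n)} {Θ : List (RelDecl S.toTySig n)}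
      {Φ : List (Fml S n)} {ψ : Fml S (n + 1)} :
      Prov Ax Γ Θ Φ (Ex.qTy Quant.all ψ) →
      Prov Ax (Γ.map Ty.wk) (Θ.map RelDecl.wk) (Φ.map Ex.wkTy) ψ
  | allTmI {n : ℕ} {Γ : List (Ty S.toTySig n)} {Θ : List (RelDecl S.toTySig n)}
      {Φ : List (Fml S n)} {σ : Ty S.toTySig n} {ψ : Fml S n} :
      Prov Ax (σ :: Γ) Θ (Φ.map (Ex.wkTm 1)) ψ → Prov Ax Γ Θ Φ (Ex.qTm Quant.all σ ψ)
  | allTmE {n : ℕ} {Γ : List (Ty S.toTySig n)} {Θ : List (RelDecl S.toTySig n)}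
      {Φ : List (Fml S n)} {σ : Ty S.toTySig n} {ψ : Fml S n} :
      Prov Ax Γ Θ Φ (Ex.qTm Quant.all σ ψ) → Prov Ax (σ :: Γ) Θ (Φ.map (Ex.wkTm 1)) ψ
  | allRelI {n : ℕ} {Γ : List (Ty S.toTySig n)} {Θ : List (RelDecl S.toTySig n)}
      {Φ : List (Fml S n)} {k : RelKind} {σ τ : Ty S.toTySig n} {ψ : Fml S n} :
      Prov Ax Γ (⟨k, σ, τ⟩ :: Θ) (Φ.map Ex.wkRel) ψ →
      Prov Ax Γ Θ Φ (Ex.qRel Quant.all k σ τ ψ)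
  | allRelE {n : ℕ} {Γ : List (Ty S.toTySig n)} {Θ : List (RelDecl S.toTySig n)}
      {Φ : List (Fml S n)} {k : RelKind} {σ τ : Ty S.toTySig n} {ψ : Fml S n} :
      Prov Ax Γ Θ Φ (Ex.qRel Quant.all k σ τ ψ) →
      Prov Ax Γ (⟨k, σ, τ⟩ :: Θ) (Φ.map Ex.wkRel) ψ
  | exTyE {n : ℕ} {Γ : List (Ty S.toTySig n)} {Θ : List (RelDecl S.toTySig n)}
      {Φ : List (Fml S n)} {φ : Fml S (n + 1)} {ψ : Fml S n} :
      Prov Ax (Γ.map Ty.wk) (Θ.map RelDecl.wk) (φ :: Φ.map Ex.wkTy) ψ.wkTy →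
      Prov Ax Γ Θ (Ex.qTy Quant.ex φ :: Φ) ψ
  | exTyI {n : ℕ} {Γ : List (Ty S.toTySig n)} {Θ : List (RelDecl S.toTySig n)}
      {Φ : List (Fml S n)} {φ : Fml S (n + 1)} {ψ : Fml S n} :
      Prov Ax Γ Θ (Ex.qTy Quant.ex φ :: Φ) ψ →
      Prov Ax (Γ.map Ty.wk) (Θ.map RelDecl.wk) (φ :: Φ.map Ex.wkTy) ψ.wkTy
  | exTmE {n : ℕ} {Γ : List (Ty S.toTySig n)} {Θ : List (RelDecl S.toTySig n)}
      {Φ : List (Fml S n)} {σ : Ty S.toTySig n} {φ ψ : Fml S n} :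
      Prov Ax (σ :: Γ) Θ (φ :: Φ.map (Ex.wkTm 1)) (ψ.wkTm 1) →
      Prov Ax Γ Θ (Ex.qTm Quant.ex σ φ :: Φ) ψ
  | exTmI {n : ℕ} {Γ : List (Ty S.toTySig n)} {Θ : List (RelDecl S.toTySig n)}
      {Φ : List (Fml S n)} {σ : Ty S.toTySig n} {φ ψ : Fml S n} :
      Prov Ax Γ Θ (Ex.qTm Quant.ex σ φ :: Φ) ψ →
      Prov Ax (σ :: Γ) Θ (φ :: Φ.map (Ex.wkTm 1)) (ψ.wkTm 1)
  | exRelE {n : ℕ} {Γ : List (Ty S.toTySig n)} {Θ : List (RelDecl S.toTySig n)}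
      {Φ : List (Fml S n)} {k : RelKind} {σ τ : Ty S.toTySig n} {φ ψ : Fml S n} :
      Prov Ax Γ (⟨k, σ, τ⟩ :: Θ) (φ :: Φ.map Ex.wkRel) ψ.wkRel →
      Prov Ax Γ Θ (Ex.qRel Quant.ex k σ τ φ :: Φ) ψ
  | exRelI {n : ℕ} {Γ : List (Ty S.toTySig n)} {Θ : List (RelDecl S.toTySig n)}
      {Φ : List (Fml S n)} {k : RelKind} {σ τ : Ty S.toTySig n} {φ ψ : Fml S n} :
      Prov Ax Γ Θ (Ex.qRel Quant.ex k σ τ φ :: Φ) ψ →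
      Prov Ax Γ (⟨k, σ, τ⟩ :: Θ) (φ :: Φ.map Ex.wkRel) ψ.wkRel
  -- internal equality, and the instances of the substitution axiom
  -- `∀α,β. ∀x,x':α. ∀y,y':β. ∀R : Rel(α, β). R(x, y) ∧ x = x' ∧ y = y' ⊃ R(x', y')`
  | extEq {n : ℕ} {Γ : List (Ty S.toTySig n)} {Θ : List (RelDecl S.toTySig n)}
      {σ : Ty S.toTySig n} {t s : Tm S n} :
      ExtEq (intCtx Γ) ∅ t s σ → Prov Ax Γ Θ [] (Ex.eq σ t s)
  | eqSymm {n : ℕ} {Γ : List (Ty S.toTySig n)} {Θ : List (RelDecl S.toTySig n)}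
      {Φ : List (Fml S n)} {σ : Ty S.toTySig n} {t s : Tm S n} :
      Prov Ax Γ Θ Φ (Ex.eq σ t s) → Prov Ax Γ Θ Φ (Ex.eq σ s t)
  | eqTrans {n : ℕ} {Γ : List (Ty S.toTySig n)} {Θ : List (RelDecl S.toTySig n)}
      {Φ : List (Fml S n)} {σ : Ty S.toTySig n} {t s v : Tm S n} :
      Prov Ax Γ Θ Φ (Ex.eq σ t s) → Prov Ax Γ Θ Φ (Ex.eq σ s v) →
      Prov Ax Γ Θ Φ (Ex.eq σ t v)
  | eqSubst {n : ℕ} {Γ : List (Ty S.toTySig n)} {Θ : List (RelDecl S.toTySig n)}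
      {σ τ : Ty S.toTySig n} {ρ : DRel S n} {t t' s s' : Tm S n} :
      IsRel Ax Γ Θ ρ σ τ → HasTy (intCtx Γ) ∅ t σ → HasTy (intCtx Γ) ∅ t' σ →
      HasTy (intCtx Γ) ∅ s τ → HasTy (intCtx Γ) ∅ s' τ →
      Prov Ax Γ Θ [] (Ex.imp (Ex.and (Ex.rapp ρ t s) (Ex.and (Ex.eq σ t t') (Ex.eq τ s s')))
        (Ex.rapp ρ t' s'))
  -- definable relations
  | defRel {n : ℕ} {Γ : List (Ty S.toTySig n)} {Θ : List (RelDecl S.toTySig n)}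
      {σ τ : Ty S.toTySig n} {φ : Fml S n} {t s : Tm S n} :
      IsProp Ax (τ :: σ :: Γ) Θ φ → HasTy (intCtx Γ) ∅ t σ → HasTy (intCtx Γ) ∅ s τ →
      Prov Ax Γ Θ [] (Ex.iff (Ex.rapp (Ex.abs σ τ φ) t s) (φ.instTm₂ t s))
  -- the relational interpretation of types
  | interpVar {n : ℕ} {Γ : List (Ty S.toTySig n)} {Θ : List (RelDecl S.toTySig n)} {k : ℕ}
      {ρs : Fin k → DRel S n} {τs τs' : Fin k → Ty S.toTySig n} (i : Fin k) :
      (∀ j, IsAdm Ax Γ Θ (ρs j) (τs j) (τs' j)) →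
      Prov Ax Γ Θ [] (Ex.equiv (τs i) (τs' i) (Ex.interp (Ty.var i) ρs) (ρs i))
  | interpLolli {n : ℕ} {Γ : List (Ty S.toTySig n)} {Θ : List (RelDecl S.toTySig n)} {k : ℕ}
      {ρs : Fin k → DRel S n} {τs τs' : Fin k → Ty S.toTySig n} (σ σ' : Ty S.toTySig k) :
      (∀ j, IsAdm Ax Γ Θ (ρs j) (τs j) (τs' j)) →
      Prov Ax Γ Θ [] (Ex.equiv ((Ty.lolli σ σ').subst τs) ((Ty.lolli σ σ').subst τs')
        (Ex.interp (Ty.lolli σ σ') ρs)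
        (Ex.lolliR (σ.subst τs) (σ.subst τs') (σ'.subst τs) (σ'.subst τs')
          (Ex.interp σ ρs) (Ex.interp σ' ρs)))
  | interpTensor {n : ℕ} {Γ : List (Ty S.toTySig n)} {Θ : List (RelDecl S.toTySig n)} {k : ℕ}
      {ρs : Fin k → DRel S n} {τs τs' : Fin k → Ty S.toTySig n} (σ σ' : Ty S.toTySig k) :
      (∀ j, IsAdm Ax Γ Θ (ρs j) (τs j) (τs' j)) →
      Prov Ax Γ Θ [] (Ex.equiv ((Ty.tensor σ σ').subst τs) ((Ty.tensor σ σ').subst τs')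
        (Ex.interp (Ty.tensor σ σ') ρs)
        (Ex.tensorR (σ.subst τs) (σ.subst τs') (σ'.subst τs) (σ'.subst τs')
          (Ex.interp σ ρs) (Ex.interp σ' ρs)))
  | interpUnit {n : ℕ} {Γ : List (Ty S.toTySig n)} {Θ : List (RelDecl S.toTySig n)} {k : ℕ}
      {ρs : Fin k → DRel S n} {τs τs' : Fin k → Ty S.toTySig n} :
      (∀ j, IsAdm Ax Γ Θ (ρs j) (τs j) (τs' j)) →
      Prov Ax Γ Θ [] (Ex.equiv Ty.unit Ty.unit (Ex.interp Ty.unit ρs) Ex.unitR)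
  | interpPi {n : ℕ} {Γ : List (Ty S.toTySig n)} {Θ : List (RelDecl S.toTySig n)} {k : ℕ}
      {ρs : Fin k → DRel S n} {τs τs' : Fin k → Ty S.toTySig n} (σ : Ty S.toTySig (k + 1)) :
      (∀ j, IsAdm Ax Γ Θ (ρs j) (τs j) (τs' j)) →
      Prov Ax Γ Θ [] (Ex.equiv ((Ty.pi σ).subst τs) ((Ty.pi σ).subst τs')
        (Ex.interp (Ty.pi σ) ρs)
        (Ex.piR (σ.subst (Ty.up τs)) (σ.subst (Ty.up τs'))
          (Ex.interp σ (Fin.cases (Ex.rvar 0) (fun j => Ex.wkPi (ρs j))))))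
  | interpBang {n : ℕ} {Γ : List (Ty S.toTySig n)} {Θ : List (RelDecl S.toTySig n)} {k : ℕ}
      {ρs : Fin k → DRel S n} {τs τs' : Fin k → Ty S.toTySig n} (σ : Ty S.toTySig k) :
      (∀ j, IsAdm Ax Γ Θ (ρs j) (τs j) (τs' j)) →
      Prov Ax Γ Θ [] (Ex.equiv ((Ty.bang σ).subst τs) ((Ty.bang σ).subst τs')
        (Ex.interp (Ty.bang σ) ρs)
        (Ex.bangR (σ.subst τs) (σ.subst τs') (Ex.interp σ ρs)))
  -- `σ[ρ₁/α₁, …, ρₖ/αₖ]` does not depend on the order of the variables `αᵢ`, nor on relations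
  -- assigned to further variables that do not belong to the context of `σ`
  | interpRename {n : ℕ} {Γ : List (Ty S.toTySig n)} {Θ : List (RelDecl S.toTySig n)}
      {k m : ℕ} {ρs : Fin m → DRel S n} {τs τs' : Fin m → Ty S.toTySig n}
      (σ : Ty S.toTySig k) (ξ : Fin k → Fin m) :
      Function.Injective ξ → (∀ j, IsAdm Ax Γ Θ (ρs j) (τs j) (τs' j)) →
      Prov Ax Γ Θ [] (Ex.equiv ((σ.rename ξ).subst τs) ((σ.rename ξ).subst τs')
        (Ex.interp (σ.rename ξ) ρs) (Ex.interp σ (fun i => ρs (ξ i))))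
  -- parametricity of the fixed point combinator
  | fixParam {n : ℕ} {Γ : List (Ty S.toTySig n)} {Θ : List (RelDecl S.toTySig n)} :
      Prov Ax Γ Θ [] (Ex.rapp (Ex.interp (Ty.fix : Ty S.toTySig 0) Fin.elim0) Tm.fixY Tm.fixY)

end

/-- The two extensionality schemes and the identity extension scheme. The identity extension scheme
`∀α₁, …, αₖ. σ[eq_{α₁}, …, eq_{αₖ}] ≡ eq_{σ(α₁, …, αₖ)}` is given by its instances. -/
inductive ExtIdExt {S : Sig.{u}} : Axioms S
  | extTm {n : ℕ} {Γ : List (Ty S.toTySig n)} {Θ : List (RelDecl S.toTySig n)}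
      {σ τ : Ty S.toTySig n} {t s : Tm S n} :
      HasTy (intCtx Γ) ∅ t (Ty.lolli σ τ) → HasTy (intCtx Γ) ∅ s (Ty.lolli σ τ) →
      ExtIdExt Γ Θ (Ex.imp
        (Ex.allTm σ (Ex.eq τ (Tm.app t.wk (Tm.var 0)) (Tm.app s.wk (Tm.var 0))))
        (Ex.eq (Ty.lolli σ τ) t s))
  | extTy {n : ℕ} {Γ : List (Ty S.toTySig n)} {Θ : List (RelDecl S.toTySig n)}
      {τ : Ty S.toTySig (n + 1)} {t s : Tm S n} :
      HasTy (intCtx Γ) ∅ t (Ty.pi τ) → HasTy (intCtx Γ) ∅ s (Ty.pi τ) →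
      ExtIdExt Γ Θ (Ex.imp
        (Ex.allTy (Ex.eq τ (Tm.tapp t.wkTy (Ty.var 0)) (Tm.tapp s.wkTy (Ty.var 0))))
        (Ex.eq (Ty.pi τ) t s))
  | idExt {n : ℕ} {Γ : List (Ty S.toTySig n)} {Θ : List (RelDecl S.toTySig n)} {k : ℕ}
      (σ : Ty S.toTySig k) (τs : Fin k → Ty S.toTySig n) :
      ExtIdExt Γ Θ (Ex.equiv (σ.subst τs) (σ.subst τs)
        (Ex.interp σ (fun i => Ex.eqRel (τs i))) (Ex.eqRel (σ.subst τs)))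

end LAPL

namespace LAPL

universe u

/-! ### Substitution algebra -/

section Lifting

@[simp] theorem liftF_zero {n m : ℕ} (ξ : Fin n → Fin m) : liftF ξ 0 = 0 := rfl

@[simp] theorem liftF_succ {n m : ℕ} (ξ : Fin n → Fin m) (i : Fin n) :
    liftF ξ i.succ = (ξ i).succ := rfl

@[simp] theorem liftN_zero (ζ : ℕ → ℕ) : liftN ζ 0 = 0 := rfl

@[simp] theorem liftN_succ (ζ : ℕ → ℕ) (i : ℕ) : liftN ζ (i + 1) = ζ i + 1 := rfl

theorem liftF_comp {n m k : ℕ} (ξ : Fin n → Fin m) (ξ' : Fin m → Fin k) :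
    liftF ξ' ∘ liftF ξ = liftF (ξ' ∘ ξ) := by
  funext i; cases i using Fin.cases <;> rfl

theorem liftN_comp (ζ ζ' : ℕ → ℕ) : liftN ζ' ∘ liftN ζ = liftN (ζ' ∘ ζ) := by
  funext i; cases i <;> rfl

theorem liftN_injective {ζ : ℕ → ℕ} (h : Function.Injective ζ) :
    Function.Injective (liftN ζ) := by
  intro i j hij
  cases i <;> cases j <;> simp at hij ⊢
  exact h hij

end Lifting

namespace Ty

variable {S : TySig.{u}}

@[simp] theorem up_succ {n m : ℕ} (θ : Fin n → Ty S m) (i : Fin n) :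
    up θ i.succ = (θ i).wk := rfl

@[simp] theorem single_zero {n : ℕ} (τ : Ty S n) : single τ 0 = τ := rfl

@[simp] theorem single_succ {n : ℕ} (τ : Ty S n) (i : Fin n) : single τ i.succ = var i := rfl

theorem rename_rename {n m k : ℕ} (σ : Ty S n) (ξ : Fin n → Fin m) (ξ' : Fin m → Fin k) :
    (σ.rename ξ).rename ξ' = σ.rename (ξ' ∘ ξ) := by
  induction σ generalizing m k with
  | con c args ih => simp only [rename]; congr; funext j; exact ih j _ _
  | pi σ ih => simp only [rename, ih, liftF_comp]
  | _ => simp_all [rename]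

theorem subst_rename {n m k : ℕ} (σ : Ty S n) (ξ : Fin n → Fin m) (θ : Fin m → Ty S k) :
    (σ.rename ξ).subst θ = σ.subst (θ ∘ ξ) := by
  induction σ generalizing m k with
  | con c args ih => simp only [rename, subst]; congr; funext j; exact ih j _ _
  | pi σ ih =>
    simp only [rename, subst, ih]; congr 2; funext i; cases i using Fin.cases <;> rfl
  | _ => simp_all [rename, subst]

theorem rename_subst {n m k : ℕ} (σ : Ty S n) (θ : Fin n → Ty S m) (ξ : Fin m → Fin k) :
    (σ.subst θ).rename ξ = σ.subst (fun i => (θ i).rename ξ) := by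
  induction σ generalizing m k with
  | con c args ih => simp only [rename, subst]; congr; funext j; exact ih j _ _
  | pi σ ih =>
    simp only [rename, subst, ih]; congr 2; funext i; cases i using Fin.cases
    · rfl
    · simp only [up_succ, wk, rename_rename]; rfl
  | _ => simp_all [rename, subst]

theorem subst_subst {n m k : ℕ} (σ : Ty S n) (θ : Fin n → Ty S m) (θ' : Fin m → Ty S k) :
    (σ.subst θ).subst θ' = σ.subst (fun i => (θ i).subst θ') := by
  induction σ generalizing m k with
  | con c args ih => simp only [subst]; congr; funext j; exact ih j _ _
  | pi σ ih =>
    simp only [subst, ih]; congr 2; funext i; cases i using Fin.cases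
    · rfl
    · simp only [up_succ, wk, rename_subst, subst_rename]; rfl
  | _ => simp_all [subst]

@[simp] theorem up_var {n : ℕ} : up (var : Fin n → Ty S n) = var := by
  funext i; cases i using Fin.cases <;> rfl

@[simp] theorem subst_var {n : ℕ} (σ : Ty S n) : σ.subst var = σ := by
  induction σ <;> simp_all [subst]

theorem subst_var_comp {n m : ℕ} (σ : Ty S n) (ξ : Fin n → Fin m) :
    σ.subst (fun i => var (ξ i)) = σ.rename ξ := by
  have := subst_rename σ ξ var
  rw [subst_var] at this
  exact this.symm

@[simp] theorem rename_id {n : ℕ} (σ : Ty S n) : σ.rename id = σ := by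
  rw [← subst_var_comp]; exact subst_var σ

@[simp] theorem wk_inst {n : ℕ} (σ τ : Ty S n) : σ.wk.inst τ = σ := by
  rw [wk, inst, subst_rename]; exact subst_var σ

@[simp] theorem wk_subst_single {n : ℕ} (σ τ : Ty S n) : σ.wk.subst (single τ) = σ :=
  wk_inst σ τ

@[simp] theorem wk_subst_up {n m : ℕ} (σ : Ty S n) (θ : Fin n → Ty S m) :
    σ.wk.subst (up θ) = (σ.subst θ).wk := by
  rw [wk, wk, subst_rename, rename_subst]; rfl

@[simp] theorem wk_rename_liftF {n m : ℕ} (σ : Ty S n) (ξ : Fin n → Fin m) :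
    σ.wk.rename (liftF ξ) = (σ.rename ξ).wk := by
  rw [wk, wk, rename_rename, rename_rename]; rfl

theorem up_comp_liftF {n m k : ℕ} (θ : Fin m → Ty S k) (ξ : Fin n → Fin m) :
    (fun i => up θ (liftF ξ i)) = up (fun i => θ (ξ i)) := by
  funext i; cases i using Fin.cases <;> rfl

theorem rename_up {n m k : ℕ} (θ : Fin n → Ty S m) (ξ : Fin m → Fin k) :
    (fun i => (up θ i).rename (liftF ξ)) = up (fun i => (θ i).rename ξ) := by
  funext i; cases i using Fin.cases
  · rfl
  · exact wk_rename_liftF _ _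

theorem subst_up {n m k : ℕ} (θ : Fin n → Ty S m) (θ' : Fin m → Ty S k) :
    (fun i => (up θ i).subst (up θ')) = up (fun i => (θ i).subst θ') := by
  funext i; cases i using Fin.cases
  · rfl
  · exact wk_subst_up _ _

theorem rename_inst {n m : ℕ} (σ : Ty S (n + 1)) (τ : Ty S n) (ξ : Fin n → Fin m) :
    (σ.inst τ).rename ξ = (σ.rename (liftF ξ)).inst (τ.rename ξ) := by
  rw [inst, inst, rename_subst, subst_rename]
  congr; funext i; cases i using Fin.cases <;> rfl

theorem subst_inst {n m : ℕ} (σ : Ty S (n + 1)) (τ : Ty S n) (θ : Fin n → Ty S m) :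
    (σ.inst τ).subst θ = (σ.subst (up θ)).inst (τ.subst θ) := by
  rw [inst, inst, subst_subst, subst_subst]
  congr; funext i; cases i using Fin.cases
  · rfl
  · simp [subst]

theorem at1_subst {n m : ℕ} (σ : Ty S 1) (τ : Ty S n) (θ : Fin n → Ty S m) :
    (σ.at1 τ).subst θ = σ.at1 (τ.subst θ) := subst_subst _ _ _

theorem at1_rename {n m : ℕ} (σ : Ty S 1) (τ : Ty S n) (ξ : Fin n → Fin m) :
    (σ.at1 τ).rename ξ = σ.at1 (τ.rename ξ) := rename_subst _ _ _

@[simp] theorem mu_subst {n m : ℕ} (σ : Ty S 1) (θ : Fin n → Ty S m) :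
    (σ.mu : Ty S n).subst θ = σ.mu := by
  simp only [mu, arrow, subst, at1_subst]; rfl

@[simp] theorem mu_rename {n m : ℕ} (σ : Ty S 1) (ξ : Fin n → Fin m) :
    (σ.mu : Ty S n).rename ξ = σ.mu := by
  simp only [mu, arrow, rename, at1_rename]; rfl

@[simp] theorem mu_wk {n : ℕ} (σ : Ty S 1) : (σ.mu : Ty S n).wk = σ.mu := mu_rename σ _

end Ty

namespace Tm

variable {S : Sig.{u}}

@[simp] theorem up_zero {n : ℕ} (v : ℕ → Tm S n) : up v 0 = var 0 := rfl

@[simp] theorem up_succ {n : ℕ} (v : ℕ → Tm S n) (i : ℕ) : up v (i + 1) = (v i).wk := rfl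

@[simp] theorem single_zero {n : ℕ} (t : Tm S n) : single t 0 = t := rfl

@[simp] theorem single_succ {n : ℕ} (t : Tm S n) (i : ℕ) : single t (i + 1) = var i := rfl

@[simp] theorem pair_zero {n : ℕ} (t s : Tm S n) : pair t s 0 = s := rfl

@[simp] theorem pair_one {n : ℕ} (t s : Tm S n) : pair t s 1 = t := rfl

theorem rename_rename {n m k : ℕ} (t : Tm S n) (ξ : Fin n → Fin m) (ζ : ℕ → ℕ)
    (ξ' : Fin m → Fin k) (ζ' : ℕ → ℕ) :
    (t.rename ξ ζ).rename ξ' ζ' = t.rename (ξ' ∘ ξ) (ζ' ∘ ζ) := by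
  induction t generalizing m k ζ ζ' <;>
    simp only [rename, Ty.rename_rename, liftF_comp, liftN_comp, Function.comp_apply, *]

theorem up_comp_liftN {k : ℕ} (v : ℕ → Tm S k) (ζ : ℕ → ℕ) :
    (fun i => up v (liftN ζ i)) = up (fun i => v (ζ i)) := by
  funext i; cases i <;> rfl

theorem subst_rename {n m k : ℕ} (t : Tm S n) (ξ : Fin n → Fin m) (ζ : ℕ → ℕ)
    (θ : Fin m → Ty S.toTySig k) (v : ℕ → Tm S k) :
    (t.rename ξ ζ).subst θ v = t.subst (fun i => θ (ξ i)) (fun i => v (ζ i)) := by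
  induction t generalizing m k ζ v <;>
    simp only [rename, subst, Ty.subst_rename, Function.comp_def, up_comp_liftN,
      Ty.up_comp_liftF, *]

theorem wk_rename_liftN {n m : ℕ} (t : Tm S n) (ξ : Fin n → Fin m) (ζ : ℕ → ℕ) :
    t.wk.rename ξ (liftN ζ) = (t.rename ξ ζ).wk := by
  rw [wk, wk, rename_rename, rename_rename]; rfl

theorem wkTy_rename_liftF {n m : ℕ} (t : Tm S n) (ξ : Fin n → Fin m) (ζ : ℕ → ℕ) :
    t.wkTy.rename (liftF ξ) ζ = (t.rename ξ ζ).wkTy := by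
  rw [wkTy, wkTy, rename_rename, rename_rename]; rfl

theorem rename_up {m k : ℕ} (v : ℕ → Tm S m) (ξ : Fin m → Fin k) (ζ : ℕ → ℕ) :
    (fun i => (up v i).rename ξ (liftN ζ)) = up (fun i => (v i).rename ξ ζ) := by
  funext i; cases i
  · rfl
  · exact wk_rename_liftN _ _ _

theorem rename_subst {n m k : ℕ} (t : Tm S n) (θ : Fin n → Ty S.toTySig m) (v : ℕ → Tm S m)
    (ξ : Fin m → Fin k) (ζ : ℕ → ℕ) :
    (t.subst θ v).rename ξ ζ = t.subst (fun i => (θ i).rename ξ) (fun i => (v i).rename ξ ζ) := by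
  induction t generalizing m k ζ v <;>
    simp only [rename, subst, Ty.rename_subst, wkTy_rename_liftF, rename_up, Ty.rename_up, *]

theorem wk_subst_up {n m : ℕ} (t : Tm S n) (θ : Fin n → Ty S.toTySig m) (v : ℕ → Tm S m) :
    t.wk.subst θ (up v) = (t.subst θ v).wk := by
  rw [wk, wk, subst_rename, rename_subst]; congr; funext i; simp

theorem wkTy_subst_up {n m : ℕ} (t : Tm S n) (θ : Fin n → Ty S.toTySig m) (v : ℕ → Tm S m) :
    t.wkTy.subst (Ty.up θ) (fun i => (v i).wkTy) = (t.subst θ v).wkTy := by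
  rw [wkTy, wkTy, subst_rename, rename_subst]; rfl

theorem subst_up {m k : ℕ} (v : ℕ → Tm S m) (θ' : Fin m → Ty S.toTySig k) (v' : ℕ → Tm S k) :
    (fun i => (up v i).subst θ' (up v')) = up (fun i => (v i).subst θ' v') := by
  funext i; cases i
  · rfl
  · exact wk_subst_up _ _ _

theorem subst_subst {n m k : ℕ} (t : Tm S n) (θ : Fin n → Ty S.toTySig m) (v : ℕ → Tm S m)
    (θ' : Fin m → Ty S.toTySig k) (v' : ℕ → Tm S k) :
    (t.subst θ v).subst θ' v' =
      t.subst (fun i => (θ i).subst θ') (fun i => (v i).subst θ' v') := by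
  induction t generalizing m k <;>
    simp only [subst, Ty.subst_subst, wkTy_subst_up, subst_up, Ty.subst_up, *]

@[simp] theorem up_var {n : ℕ} : up (var : ℕ → Tm S n) = var := by
  funext i; cases i <;> rfl

@[simp] theorem wkTy_var {n : ℕ} (i : ℕ) : (var i : Tm S n).wkTy = var i := rfl

@[simp] theorem subst_var {n : ℕ} (t : Tm S n) : t.subst Ty.var var = t := by
  induction t <;> simp_all [subst]

theorem subst_var_comp {n m : ℕ} (t : Tm S n) (ξ : Fin n → Fin m) (ζ : ℕ → ℕ) :
    t.subst (fun i => Ty.var (ξ i)) (fun i => var (ζ i)) = t.rename ξ ζ := by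
  have := subst_rename t ξ ζ Ty.var var
  rw [subst_var] at this
  exact this.symm

@[simp] theorem rename_id {n : ℕ} (t : Tm S n) : t.rename id id = t := by
  rw [← subst_var_comp]; exact subst_var t

@[simp] theorem wk_inst {n : ℕ} (t s : Tm S n) : t.wk.inst s = t := by
  rw [wk, inst, subst_rename]; exact subst_var t

@[simp] theorem wkTy_instTy {n : ℕ} (t : Tm S n) (σ : Ty S.toTySig n) : t.wkTy.instTy σ = t := by
  rw [wkTy, instTy, subst_rename]; exact subst_var t

end Tm

namespace Ex

variable {S : Sig.{u}}

@[simp] theorem single_zero {n : ℕ} (ρ : DRel S n) : single ρ 0 = ρ := rfl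

theorem rename_rename {s : Srt} {n m k : ℕ} (e : Ex S s n) (ξ : Fin n → Fin m) (ζ η : ℕ → ℕ)
    (ξ' : Fin m → Fin k) (ζ' η' : ℕ → ℕ) :
    (e.rename ξ ζ η).rename ξ' ζ' η' = e.rename (ξ' ∘ ξ) (ζ' ∘ ζ) (η' ∘ η) := by
  induction e generalizing m k ζ ζ' η η' <;>
    simp only [rename, Ty.rename_rename, Tm.rename_rename, liftF_comp, liftN_comp,
      Function.comp_apply, *]

theorem up_comp_liftN {k : ℕ} (r : ℕ → DRel S k) (η : ℕ → ℕ) :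
    (fun i => up r (liftN η i)) = up (fun i => r (η i)) := by
  funext i; cases i <;> rfl

theorem subst_rename {s : Srt} {n m k : ℕ} (e : Ex S s n) (ξ : Fin n → Fin m) (ζ η : ℕ → ℕ)
    (θ : Fin m → Ty S.toTySig k) (v : ℕ → Tm S k) (r : ℕ → DRel S k) :
    (e.rename ξ ζ η).subst θ v r =
      e.subst (fun i => θ (ξ i)) (fun i => v (ζ i)) (fun i => r (η i)) := by
  induction e generalizing m k ζ v η r <;>
    simp only [rename, subst, Ty.subst_rename, Tm.subst_rename, Function.comp_def,
      up_comp_liftN, Tm.up_comp_liftN, Ty.up_comp_liftF, *]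

theorem wkTm_rename {s : Srt} {n m : ℕ} (e : Ex S s n) (ξ : Fin n → Fin m) (ζ η : ℕ → ℕ) :
    (e.wkTm 1).rename ξ (liftN ζ) η = (e.rename ξ ζ η).wkTm 1 := by
  rw [wkTm, wkTm, rename_rename, rename_rename]; rfl

theorem wkTm_two_rename {s : Srt} {n m : ℕ} (e : Ex S s n) (ξ : Fin n → Fin m) (ζ η : ℕ → ℕ) :
    (e.wkTm 2).rename ξ (liftN (liftN ζ)) η = (e.rename ξ ζ η).wkTm 2 := by
  rw [wkTm, wkTm, rename_rename, rename_rename]; rfl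

theorem wkTy_rename {s : Srt} {n m : ℕ} (e : Ex S s n) (ξ : Fin n → Fin m) (ζ η : ℕ → ℕ) :
    e.wkTy.rename (liftF ξ) ζ η = (e.rename ξ ζ η).wkTy := by
  rw [wkTy, wkTy, rename_rename, rename_rename]; rfl

theorem wkRel_rename {s : Srt} {n m : ℕ} (e : Ex S s n) (ξ : Fin n → Fin m) (ζ η : ℕ → ℕ) :
    e.wkRel.rename ξ ζ (liftN η) = (e.rename ξ ζ η).wkRel := by
  rw [wkRel, wkRel, rename_rename, rename_rename]; rfl

theorem rename_up {m k : ℕ} (r : ℕ → DRel S m) (ξ : Fin m → Fin k) (ζ η : ℕ → ℕ) :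
    (fun i => (up r i).rename ξ ζ (liftN η)) = up (fun i => (r i).rename ξ ζ η) := by
  funext i; cases i
  · rfl
  · exact wkRel_rename _ _ _ _

theorem rename_subst {s : Srt} {n m k : ℕ} (e : Ex S s n) (θ : Fin n → Ty S.toTySig m)
    (v : ℕ → Tm S m) (r : ℕ → DRel S m) (ξ : Fin m → Fin k) (ζ η : ℕ → ℕ) :
    (e.subst θ v r).rename ξ ζ η = e.subst (fun i => (θ i).rename ξ)
      (fun i => (v i).rename ξ ζ) (fun i => (r i).rename ξ ζ η) := by
  induction e generalizing m k ζ v r η <;>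
    simp only [rename, subst, Ty.rename_subst, Tm.rename_subst, Tm.wkTy_rename_liftF,
      wkTm_rename, wkTm_two_rename, wkTy_rename, rename_up, Tm.rename_up, Ty.rename_up, *]

theorem wkTm_subst {s : Srt} {n m : ℕ} (e : Ex S s n) (θ : Fin n → Ty S.toTySig m)
    (v : ℕ → Tm S m) (r : ℕ → DRel S m) :
    (e.wkTm 1).subst θ (Tm.up v) (fun i => (r i).wkTm 1) = (e.subst θ v r).wkTm 1 := by
  rw [wkTm, wkTm, subst_rename, rename_subst]; congr; funext i; simp

theorem wkTm_two_subst {s : Srt} {n m : ℕ} (e : Ex S s n) (θ : Fin n → Ty S.toTySig m)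
    (v : ℕ → Tm S m) (r : ℕ → DRel S m) :
    (e.wkTm 2).subst θ (Tm.up (Tm.up v)) (fun i => (r i).wkTm 2) = (e.subst θ v r).wkTm 2 := by
  rw [wkTm, wkTm, subst_rename, rename_subst]; congr
  · funext i; simp
  · funext i; simp only [Tm.up_succ, Tm.wk, Tm.rename_rename]; rfl

theorem wkTy_subst {s : Srt} {n m : ℕ} (e : Ex S s n) (θ : Fin n → Ty S.toTySig m)
    (v : ℕ → Tm S m) (r : ℕ → DRel S m) :
    e.wkTy.subst (Ty.up θ) (fun i => (v i).wkTy) (fun i => (r i).wkTy) = (e.subst θ v r).wkTy := by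
  rw [wkTy, wkTy, subst_rename, rename_subst]; rfl

theorem wkRel_subst {s : Srt} {n m : ℕ} (e : Ex S s n) (θ : Fin n → Ty S.toTySig m)
    (v : ℕ → Tm S m) (r : ℕ → DRel S m) :
    e.wkRel.subst θ v (up r) = (e.subst θ v r).wkRel := by
  rw [wkRel, wkRel, subst_rename, rename_subst]; congr <;> funext i <;> simp

theorem subst_up {m k : ℕ} (r : ℕ → DRel S m) (θ' : Fin m → Ty S.toTySig k) (v' : ℕ → Tm S k)
    (r' : ℕ → DRel S k) :
    (fun i => (up r i).subst θ' v' (up r')) = up (fun i => (r i).subst θ' v' r') := by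
  funext i; cases i
  · rfl
  · exact wkRel_subst _ _ _ _

theorem subst_subst {s : Srt} {n m k : ℕ} (e : Ex S s n) (θ : Fin n → Ty S.toTySig m)
    (v : ℕ → Tm S m) (r : ℕ → DRel S m) (θ' : Fin m → Ty S.toTySig k) (v' : ℕ → Tm S k)
    (r' : ℕ → DRel S k) :
    (e.subst θ v r).subst θ' v' r' = e.subst (fun i => (θ i).subst θ')
      (fun i => (v i).subst θ' v') (fun i => (r i).subst θ' v' r') := by
  induction e generalizing m k <;>
    simp only [subst, Ty.subst_subst, Tm.subst_subst, Tm.wkTy_subst_up, wkTm_subst,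
      wkTm_two_subst, wkTy_subst, subst_up, Tm.subst_up, Ty.subst_up, *]

@[simp] theorem up_rvar {n : ℕ} : up (rvar : ℕ → DRel S n) = rvar := by
  funext i; cases i <;> rfl

@[simp] theorem wkTm_rvar {n : ℕ} (k i : ℕ) : (rvar i : DRel S n).wkTm k = rvar i := rfl

@[simp] theorem wkTy_rvar {n : ℕ} (i : ℕ) : (rvar i : DRel S n).wkTy = rvar i := rfl

@[simp] theorem subst_var {s : Srt} {n : ℕ} (e : Ex S s n) : e.subst Ty.var Tm.var rvar = e := by
  induction e <;> simp_all [subst]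

theorem subst_var_comp {s : Srt} {n m : ℕ} (e : Ex S s n) (ξ : Fin n → Fin m) (ζ η : ℕ → ℕ) :
    e.subst (fun i => Ty.var (ξ i)) (fun i => Tm.var (ζ i)) (fun i => rvar (η i)) =
      e.rename ξ ζ η := by
  have := subst_rename e ξ ζ η Ty.var Tm.var rvar
  rw [subst_var] at this
  exact this.symm

@[simp] theorem rename_id {s : Srt} {n : ℕ} (e : Ex S s n) : e.rename id id id = e := by
  rw [← subst_var_comp]; exact subst_var e

end Ex

end LAPL

namespace LAPL

universe u

variable {S : Sig.{u}}

/-! ### Typing -/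

theorem HasTy.rename {n m : ℕ} {G : List (TmDecl S.toTySig n)} {L : Finset ℕ} {t : Tm S n}
    {τ : Ty S.toTySig n} (h : HasTy G L t τ) {G' : List (TmDecl S.toTySig m)}
    {ξ : Fin n → Fin m} {ζ : ℕ → ℕ} (hζ : Function.Injective ζ)
    (hG : ∀ i d, G[i]? = some d → G'[ζ i]? = some ⟨d.lin, d.ty.rename ξ⟩) :
    HasTy G' (L.image ζ) (t.rename ξ ζ) (τ.rename ξ) := by
  have lift : ∀ {n m : ℕ} {G : List (TmDecl S.toTySig n)} {G' : List (TmDecl S.toTySig m)}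
      {ξ : Fin n → Fin m} {ζ : ℕ → ℕ} (d₀ : TmDecl S.toTySig n),
      (∀ i d, G[i]? = some d → G'[ζ i]? = some ⟨d.lin, d.ty.rename ξ⟩) →
      ∀ i d, (d₀ :: G)[i]? = some d →
        ((⟨d₀.lin, d₀.ty.rename ξ⟩ : TmDecl S.toTySig m) :: G')[liftN ζ i]? =
          some ⟨d.lin, d.ty.rename ξ⟩ := by
    intro n m G G' ξ ζ d₀ hG i d hi
    cases i with
    | zero => simp at hi ⊢; subst hi; exact ⟨rfl, rfl⟩
    | succ i => simp at hi ⊢; exact hG i d hi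
  induction h generalizing m ζ with
  | star => simpa [Tm.rename, Ty.rename] using HasTy.star
  | fixY => exact HasTy.fixY
  | con c =>
    rw [Ty.rename_rename, Subsingleton.elim (ξ ∘ Fin.elim0) Fin.elim0]; exact HasTy.con c
  | ivar hi => exact HasTy.ivar (hG _ _ hi)
  | lvar hi => rw [Finset.image_singleton]; exact HasTy.lvar (hG _ _ hi)
  | app _ _ hd ih₁ ih₂ =>
    rw [Finset.image_union]
    exact HasTy.app (ih₁ hζ hG) (ih₂ hζ hG) ((Finset.disjoint_image hζ).2 hd)
  | @lam n G L t σ τ _ ih =>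
    refine HasTy.lam ?_
    convert ih (liftN_injective hζ) (lift ⟨true, σ⟩ hG) using 1
    simp [Finset.image_insert, Finset.image_image, Function.comp_def]
  | tensor _ _ hd ih₁ ih₂ =>
    rw [Finset.image_union]
    exact HasTy.tensor (ih₁ hζ hG) (ih₂ hζ hG) ((Finset.disjoint_image hζ).2 hd)
  | bang _ ih => exact HasTy.bang (by simpa using ih hζ hG)
  | tlam _ ih =>
    refine HasTy.tlam (ih hζ ?_)
    intro i d hi
    simp only [List.getElem?_map, Option.map_eq_some_iff] at hi ⊢
    obtain ⟨d, hd, rfl⟩ := hi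
    exact ⟨_, hG i d hd, by simp [TmDecl.wk]⟩
  | tapp τ _ ih => rw [Ty.rename_inst]; exact HasTy.tapp _ (ih hζ hG)
  | @letT n G L L' s t σ σ' τ _ _ hd ih₁ ih₂ =>
    rw [Finset.image_union]
    refine HasTy.letT (ih₁ hζ hG) ?_ ((Finset.disjoint_image hζ).2 hd)
    convert ih₂ (liftN_injective (liftN_injective hζ)) (lift ⟨true, σ'⟩ (lift ⟨true, σ⟩ hG)) using 1
    simp [Finset.image_insert, Finset.image_image, Function.comp_def, liftN]
  | @letB n G L L' s t σ τ _ _ hd ih₁ ih₂ =>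
    rw [Finset.image_union]
    refine HasTy.letB (ih₁ hζ hG) ?_ ((Finset.disjoint_image hζ).2 hd)
    convert ih₂ (liftN_injective hζ) (lift ⟨false, σ⟩ hG) using 1
    simp [Finset.image_image, Function.comp_def]
  | letU _ _ hd ih₁ ih₂ =>
    rw [Finset.image_union]
    exact HasTy.letU (ih₁ hζ hG) (ih₂ hζ hG) ((Finset.disjoint_image hζ).2 hd)

theorem HasTy.wk {n : ℕ} {G : List (TmDecl S.toTySig n)} {L : Finset ℕ} {t : Tm S n}
    {τ : Ty S.toTySig n} (h : HasTy G L t τ) (d : TmDecl S.toTySig n) :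
    HasTy (d :: G) (L.image Nat.succ) t.wk τ := by
  simpa [Tm.wk] using h.rename (G' := d :: G) (ξ := id) Nat.succ_injective
    (fun i d hi => by simpa using hi)

theorem HasTy.wk₀ {n : ℕ} {G : List (TmDecl S.toTySig n)} {t : Tm S n}
    {τ : Ty S.toTySig n} (h : HasTy G ∅ t τ) (d : TmDecl S.toTySig n) :
    HasTy (d :: G) ∅ t.wk τ := by
  simpa using h.wk d

theorem HasTy.wkTy {n : ℕ} {G : List (TmDecl S.toTySig n)} {L : Finset ℕ} {t : Tm S n}
    {τ : Ty S.toTySig n} (h : HasTy G L t τ) :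
    HasTy (G.map TmDecl.wk) L t.wkTy τ.wk := by
  have := h.rename (G' := G.map TmDecl.wk) (ξ := Fin.succ) (ζ := id) Function.injective_id
    (fun i d hi => by simpa using ⟨d, hi, rfl⟩)
  simpa [Tm.wkTy, Ty.wk] using this

/-- The linear variables needed by a lifted substitution. -/
def liftL (Lv : ℕ → Finset ℕ) : ℕ → Finset ℕ
  | 0 => {0}
  | i + 1 => (Lv i).image Nat.succ

theorem biUnion_image_succ_liftL (L : Finset ℕ) (Lv : ℕ → Finset ℕ) :
    (L.image Nat.succ).biUnion (liftL Lv) = (L.biUnion Lv).image Nat.succ := by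
  rw [Finset.image_biUnion, Finset.biUnion_image]; rfl

theorem insert_biUnion_liftL (L : Finset ℕ) (Lv : ℕ → Finset ℕ) :
    (insert 0 (L.image Nat.succ)).biUnion (liftL Lv) =
      insert 0 ((L.biUnion Lv).image Nat.succ) := by
  rw [Finset.biUnion_insert, biUnion_image_succ_liftL]; rfl

/-- A substitution of types and terms for the variables of `G` which is well typed in `G'`, where
the linear variables in `L` are used. -/
structure TySubst {n m : ℕ} (G : List (TmDecl S.toTySig n)) (L : Finset ℕ)
    (G' : List (TmDecl S.toTySig m)) (θ : Fin n → Ty S.toTySig m) (v : ℕ → Tm S m)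
    (Lv : ℕ → Finset ℕ) : Prop where
  int : ∀ i σ, G[i]? = some ⟨false, σ⟩ → HasTy G' ∅ (v i) (σ.subst θ)
  lin : ∀ i ∈ L, ∀ σ, G[i]? = some ⟨true, σ⟩ → HasTy G' (Lv i) (v i) (σ.subst θ)
  disj : ∀ i ∈ L, ∀ j ∈ L, i ≠ j → Disjoint (Lv i) (Lv j)

namespace TySubst

variable {n m : ℕ} {G : List (TmDecl S.toTySig n)} {L L' : Finset ℕ}
  {G' : List (TmDecl S.toTySig m)} {θ : Fin n → Ty S.toTySig m} {v : ℕ → Tm S m}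
  {Lv : ℕ → Finset ℕ}

theorem mono (h : TySubst G L G' θ v Lv) (hL : L' ⊆ L) : TySubst G L' G' θ v Lv :=
  ⟨h.int, fun i hi => h.lin i (hL hi), fun i hi j hj => h.disj i (hL hi) j (hL hj)⟩

theorem lift (h : TySubst G L G' θ v Lv) (d : TmDecl S.toTySig n) :
    TySubst (d :: G) (insert 0 (L.image Nat.succ)) (⟨d.lin, d.ty.subst θ⟩ :: G') θ (Tm.up v)
      (liftL Lv) where
  int i σ hi := by
    cases i with
    | zero => simp at hi; subst hi; exact HasTy.ivar rfl
    | succ i => exact (h.int i σ (by simpa using hi)).wk₀ _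
  lin i hL σ hi := by
    cases i with
    | zero => simp at hi; subst hi; exact HasTy.lvar rfl
    | succ i => exact (h.lin i (by simpa using hL) σ (by simpa using hi)).wk _
  disj i hi j hj hij := by
    cases i <;> cases j <;> simp [liftL] at hi hj hij ⊢
    exact (Finset.disjoint_image Nat.succ_injective).2 (h.disj _ hi _ hj hij)

theorem wkTy (h : TySubst G L G' θ v Lv) :
    TySubst (G.map TmDecl.wk) L (G'.map TmDecl.wk) (Ty.up θ) (fun i => (v i).wkTy) Lv where
  int i σ hi := by
    simp only [List.getElem?_map, Option.map_eq_some_iff] at hi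
    obtain ⟨⟨l, τ⟩, hd, he⟩ := hi
    simp only [TmDecl.wk, TmDecl.mk.injEq] at he
    obtain ⟨rfl, rfl⟩ := he
    rw [Ty.wk_subst_up]
    exact (h.int i τ hd).wkTy
  lin i hL σ hi := by
    simp only [List.getElem?_map, Option.map_eq_some_iff] at hi
    obtain ⟨⟨l, τ⟩, hd, he⟩ := hi
    simp only [TmDecl.wk, TmDecl.mk.injEq] at he
    obtain ⟨rfl, rfl⟩ := he
    rw [Ty.wk_subst_up]
    exact (h.lin i hL τ hd).wkTy
  disj := h.disj

theorem disjoint_biUnion (h : TySubst G (L ∪ L') G' θ v Lv) (hd : Disjoint L L') :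
    Disjoint (L.biUnion Lv) (L'.biUnion Lv) := by
  rw [Finset.disjoint_biUnion_left]
  intro i hi
  rw [Finset.disjoint_biUnion_right]
  intro j hj
  exact h.disj i (Finset.mem_union_left _ hi) j (Finset.mem_union_right _ hj)
    (fun e => Finset.disjoint_left.1 hd hi (e ▸ hj))

end TySubst

theorem HasTy.subst {n m : ℕ} {G : List (TmDecl S.toTySig n)} {L : Finset ℕ} {t : Tm S n}
    {τ : Ty S.toTySig n} (h : HasTy G L t τ) {G' : List (TmDecl S.toTySig m)}
    {θ : Fin n → Ty S.toTySig m} {v : ℕ → Tm S m} {Lv : ℕ → Finset ℕ}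
    (hs : TySubst G L G' θ v Lv) :
    HasTy G' (L.biUnion Lv) (t.subst θ v) (τ.subst θ) := by
  induction h generalizing m v Lv with
  | star => exact HasTy.star
  | fixY => exact HasTy.fixY
  | con c =>
    rw [Ty.subst_rename]
    have := HasTy.con (G := G') c
    rwa [← Ty.subst_var_comp, Subsingleton.elim (fun i => Ty.var (Fin.elim0 i)) (θ ∘ Fin.elim0)]
      at this
  | ivar hi => exact hs.int _ _ hi
  | lvar hi => rw [Finset.singleton_biUnion]; exact hs.lin _ (by simp) _ hi
  | app _ _ hd ih₁ ih₂ =>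
    rw [Finset.union_biUnion]
    exact HasTy.app (ih₁ (hs.mono Finset.subset_union_left))
      (ih₂ (hs.mono Finset.subset_union_right)) (hs.disjoint_biUnion hd)
  | @lam n G L t σ τ _ ih =>
    refine HasTy.lam ?_
    rw [← insert_biUnion_liftL]
    exact ih (hs.lift ⟨true, σ⟩)
  | tensor _ _ hd ih₁ ih₂ =>
    rw [Finset.union_biUnion]
    exact HasTy.tensor (ih₁ (hs.mono Finset.subset_union_left))
      (ih₂ (hs.mono Finset.subset_union_right)) (hs.disjoint_biUnion hd)
  | bang _ ih => exact HasTy.bang (ih hs)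
  | tlam _ ih => exact HasTy.tlam (ih hs.wkTy)
  | tapp τ _ ih => rw [Ty.subst_inst]; exact HasTy.tapp _ (ih hs)
  | @letT n G L L' s t σ σ' τ _ _ hd ih₁ ih₂ =>
    rw [Finset.union_biUnion]
    refine HasTy.letT (ih₁ (hs.mono Finset.subset_union_left)) ?_ (hs.disjoint_biUnion hd)
    have e : ∀ L : Finset ℕ, (insert 0 (insert 1 (L.image (· + 2)))) =
        insert 0 ((insert 0 (L.image Nat.succ)).image Nat.succ) := by
      intro L; simp [Finset.image_image, Function.comp_def]
    rw [e] at ih₂ ⊢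
    rw [← insert_biUnion_liftL, ← insert_biUnion_liftL]
    exact ih₂ (((hs.mono Finset.subset_union_right).lift ⟨true, σ⟩).lift ⟨true, σ'⟩)
  | @letB n G L L' s t σ τ _ _ hd ih₁ ih₂ =>
    rw [Finset.union_biUnion]
    refine HasTy.letB (ih₁ (hs.mono Finset.subset_union_left)) ?_ (hs.disjoint_biUnion hd)
    rw [← biUnion_image_succ_liftL]
    exact ih₂ (((hs.mono Finset.subset_union_right).lift ⟨false, σ⟩).mono
      (Finset.subset_insert _ _))
  | letU _ _ hd ih₁ ih₂ =>
    rw [Finset.union_biUnion]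
    exact HasTy.letU (ih₁ (hs.mono Finset.subset_union_left))
      (ih₂ (hs.mono Finset.subset_union_right)) (hs.disjoint_biUnion hd)

theorem HasTy.inst_lin {n : ℕ} {G : List (TmDecl S.toTySig n)} {L L' : Finset ℕ} {t s : Tm S n}
    {σ τ : Ty S.toTySig n} (ht : HasTy (⟨true, σ⟩ :: G) (insert 0 (L.image Nat.succ)) t τ)
    (hs : HasTy G L' s σ) (hd : Disjoint L L') : HasTy G (L ∪ L') (t.inst s) τ := by
  have := ht.subst (G' := G) (θ := Ty.var) (v := Tm.single s)
    (Lv := fun i => Nat.casesOn i L' (fun i => {i})) ?_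
  · rw [Ty.subst_var] at this
    convert this using 1
    · ext i; simp [or_comm]
    · rfl
  · refine ⟨?_, ?_, ?_⟩
    · intro i σ hi
      cases i with
      | zero => simp at hi
      | succ i => simpa using HasTy.ivar (by simpa using hi)
    · intro i _ σ hi
      cases i with
      | zero => simp at hi; subst hi; simpa using hs
      | succ i => simpa using HasTy.lvar (by simpa using hi)
    · intro i hi j hj hij
      rw [Finset.disjoint_left] at hd
      cases i <;> cases j <;> simp at hi hj hij ⊢
      · exact hd hj
      · exact hd hi
      · exact hij

theorem HasTy.inst_int {n : ℕ} {G : List (TmDecl S.toTySig n)} {L : Finset ℕ} {t s : Tm S n}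
    {σ τ : Ty S.toTySig n} (ht : HasTy (⟨false, σ⟩ :: G) (L.image Nat.succ) t τ)
    (hs : HasTy G ∅ s σ) : HasTy G L (t.inst s) τ := by
  have := ht.subst (G' := G) (θ := Ty.var) (v := Tm.single s)
    (Lv := fun i => Nat.casesOn i ∅ (fun i => {i})) ?_
  · rw [Ty.subst_var] at this
    convert this using 1
    · ext i; simp
    · rfl
  · refine ⟨?_, ?_, ?_⟩
    · intro i σ hi
      cases i with
      | zero => simp at hi; subst hi; simpa using hs
      | succ i => simpa using HasTy.ivar (by simpa using hi)
    · intro i _ σ hi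
      cases i with
      | zero => simp at hi
      | succ i => simpa using HasTy.lvar (by simpa using hi)
    · intro i hi j hj hij
      cases i <;> cases j <;> simp at hi hj hij ⊢
      exact hij

theorem TySubst.of_wk {n m : ℕ} {G : List (TmDecl S.toTySig n)} {θ : Fin n → Ty S.toTySig m}
    {G' : List (TmDecl S.toTySig m)} (L : Finset ℕ)
    (h : ∀ (i : ℕ) (d : TmDecl S.toTySig n), G[i]? = some d →
      G'[i]? = some (⟨d.lin, d.ty.subst θ⟩ : TmDecl S.toTySig m)) :
    TySubst G L G' θ Tm.var (fun i => {i}) :=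
  ⟨fun i _ hi => HasTy.ivar (h i _ hi), fun i _ _ hi => HasTy.lvar (h i _ hi),
    fun i _ j _ hij => by simpa using hij⟩

theorem TySubst.single {n : ℕ} (G : List (TmDecl S.toTySig n)) (L : Finset ℕ)
    (σ : Ty S.toTySig n) :
    TySubst (G.map TmDecl.wk) L G (Ty.single σ) Tm.var (fun i => {i}) := by
  refine TySubst.of_wk L (fun i d hi => ?_)
  simp only [List.getElem?_map, Option.map_eq_some_iff] at hi
  obtain ⟨d, hd, rfl⟩ := hi
  simpa [TmDecl.wk] using hd

theorem HasTy.instTy {n : ℕ} {G : List (TmDecl S.toTySig n)} {L : Finset ℕ} {t : Tm S (n + 1)}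
    {τ : Ty S.toTySig (n + 1)} (ht : HasTy (G.map TmDecl.wk) L t τ) (σ : Ty S.toTySig n) :
    HasTy G L (t.instTy σ) (τ.inst σ) := by
  have := ht.subst (TySubst.single G L σ)
  rwa [Finset.biUnion_singleton_eq_self] at this

theorem HasTy.of_eq {n : ℕ} {G : List (TmDecl S.toTySig n)} {L L' : Finset ℕ} {t : Tm S n}
    {σ : Ty S.toTySig n} (h : HasTy G L t σ) (e : L = L') : HasTy G L' t σ := e ▸ h

theorem HasTy.tapp_var_zero {n : ℕ} {G : List (TmDecl S.toTySig (n + 1))} {L : Finset ℕ}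
    {t : Tm S (n + 1)} {σ : Ty S.toTySig (n + 1)} (h : HasTy G L t (Ty.pi σ).wk) :
    HasTy G L (Tm.tapp t (Ty.var 0)) σ := by
  have := HasTy.tapp (Ty.var 0) h
  rw [Ty.inst, Ty.subst_rename] at this
  convert this
  conv_lhs => rw [← Ty.subst_var σ]
  congr
  funext i; cases i using Fin.cases <;> rfl

theorem HasTy.app₀ {n : ℕ} {G : List (TmDecl S.toTySig n)} {L : Finset ℕ} {t s : Tm S n}
    {σ τ : Ty S.toTySig n} (ht : HasTy G ∅ t (Ty.lolli σ τ)) (hs : HasTy G L s σ) :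
    HasTy G L (Tm.app t s) τ := by
  simpa using HasTy.app ht hs (by simp)

theorem HasTy.app_bang {n : ℕ} {G : List (TmDecl S.toTySig n)} {L : Finset ℕ} {t s : Tm S n}
    {σ τ : Ty S.toTySig n} (ht : HasTy G L t (Ty.arrow σ τ)) (hs : HasTy G ∅ s σ) :
    HasTy G L (Tm.app t (Tm.bang s)) τ := by
  simpa using HasTy.app ht hs.bang (by simp)

theorem HasTy.lam₀ {n : ℕ} {G : List (TmDecl S.toTySig n)} {t : Tm S n}
    {σ τ : Ty S.toTySig n} (ht : HasTy (⟨true, σ⟩ :: G) {0} t τ) :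
    HasTy G ∅ (Tm.lam σ t) (Ty.lolli σ τ) :=
  HasTy.lam (by simpa using ht)

theorem HasTy.idm {n : ℕ} {G : List (TmDecl S.toTySig n)} (σ : Ty S.toTySig n) :
    HasTy G ∅ (Tm.idm σ) (Ty.lolli σ σ) :=
  HasTy.lam₀ (HasTy.lvar rfl)

theorem HasTy.under_bang_binder {n : ℕ} {G : List (TmDecl S.toTySig n)} {L : Finset ℕ} {t : Tm S n}
    {σ τ : Ty S.toTySig n} (ht : HasTy (⟨false, σ⟩ :: G) (L.image Nat.succ) t τ)
    (d : TmDecl S.toTySig n) :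
    HasTy (⟨false, σ⟩ :: d :: G) ((L.image Nat.succ).image Nat.succ)
      (t.rename id (liftN Nat.succ)) τ := by
  have := ht.rename (G' := ⟨false, σ⟩ :: d :: G) (ξ := id) (liftN_injective Nat.succ_injective) ?_
  · convert this using 1
    · simp [Finset.image_image, Function.comp_def]
    · simp
  · intro i d hi
    cases i with
    | zero => simp at hi; subst hi; simp
    | succ i => simpa using hi

theorem HasTy.ilam {n : ℕ} {G : List (TmDecl S.toTySig n)} {L : Finset ℕ} {t : Tm S n}
    {σ τ : Ty S.toTySig n} (ht : HasTy (⟨false, σ⟩ :: G) (L.image Nat.succ) t τ) :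
    HasTy G L (Tm.ilam σ t) (Ty.arrow σ τ) := by
  refine HasTy.lam ?_
  exact HasTy.letB (L := {0}) (L' := L.image Nat.succ) (HasTy.lvar rfl)
    (ht.under_bang_binder _) (by simp)

/-! ### Typed conversion -/

/-- External equality of two well-typed terms. -/
structure Conv {n : ℕ} (G : List (TmDecl S.toTySig n)) (L : Finset ℕ) (t s : Tm S n)
    (τ : Ty S.toTySig n) : Prop where
  left : HasTy G L t τ
  right : HasTy G L s τ
  ext : ExtEq G L t s τ

theorem Conv.of_eq {n : ℕ} {G : List (TmDecl S.toTySig n)} {L L' : Finset ℕ} {t s : Tm S n}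
    {σ : Ty S.toTySig n} (h : Conv G L t s σ) (e : L = L') : Conv G L' t s σ := e ▸ h

namespace Conv

variable {n : ℕ} {G : List (TmDecl S.toTySig n)} {L L' : Finset ℕ} {t t' s s' v : Tm S n}
  {σ σ' τ : Ty S.toTySig n}

theorem refl (h : HasTy G L t τ) : Conv G L t t τ := ⟨h, h, ExtEq.refl h⟩

theorem symm (h : Conv G L t s τ) : Conv G L s t τ := ⟨h.right, h.left, h.ext.symm⟩

theorem trans (h : Conv G L t s τ) (h' : Conv G L s v τ) : Conv G L t v τ :=
  ⟨h.left, h'.right, h.ext.trans h'.ext⟩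

theorem plug {m : ℕ} {G' : List (TmDecl S.toTySig m)} {τ' : Ty S.toTySig m} (C : Cx S m n)
    (h : Conv G L t s τ) (hC : ∀ u, HasTy G L u τ → HasTy G' L' (C.plug u) τ') :
    Conv G' L' (C.plug t) (C.plug s) τ' :=
  ⟨hC _ h.left, hC _ h.right, ExtEq.congr C h.ext hC⟩

theorem app (ht : Conv G L t t' (Ty.lolli σ τ)) (hs : Conv G L' s s' σ) (hd : Disjoint L L') :
    Conv G (L ∪ L') (Tm.app t s) (Tm.app t' s') τ :=
  (ht.plug (Cx.app₁ Cx.hole s) (fun _ h => HasTy.app h hs.left hd)).trans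
    (hs.plug (Cx.app₂ t' Cx.hole) (fun _ h => HasTy.app ht.right h hd))

theorem app₀ (ht : Conv G ∅ t t' (Ty.lolli σ τ)) (hs : Conv G L s s' σ) :
    Conv G L (Tm.app t s) (Tm.app t' s') τ := by
  simpa using app ht hs (by simp)

theorem app_bang (ht : Conv G L t t' (Ty.arrow σ τ)) (hs : HasTy G ∅ s σ) :
    Conv G L (Tm.app t (Tm.bang s)) (Tm.app t' (Tm.bang s)) τ := by
  simpa using app ht (refl hs.bang) (by simp)

theorem tensor (ht : Conv G L t t' σ) (hs : Conv G L' s s' τ) (hd : Disjoint L L') :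
    Conv G (L ∪ L') (Tm.tensor t s) (Tm.tensor t' s') (Ty.tensor σ τ) :=
  (ht.plug (Cx.tensor₁ Cx.hole s) (fun _ h => HasTy.tensor h hs.left hd)).trans
    (hs.plug (Cx.tensor₂ t' Cx.hole) (fun _ h => HasTy.tensor ht.right h hd))

theorem bang (h : Conv G ∅ t s τ) : Conv G ∅ (Tm.bang t) (Tm.bang s) (Ty.bang τ) :=
  h.plug (Cx.bang Cx.hole) (fun _ h => h.bang)

theorem lam₀ (h : Conv (⟨true, σ⟩ :: G) {0} t s τ) :
    Conv G ∅ (Tm.lam σ t) (Tm.lam σ s) (Ty.lolli σ τ) :=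
  h.plug (Cx.lam σ Cx.hole) (fun _ h => h.lam₀)

theorem lam (h : Conv (⟨true, σ⟩ :: G) (insert 0 (L.image Nat.succ)) t s τ) :
    Conv G L (Tm.lam σ t) (Tm.lam σ s) (Ty.lolli σ τ) :=
  h.plug (Cx.lam σ Cx.hole) (fun _ h => h.lam)

theorem tlam {t s : Tm S (n + 1)} {τ : Ty S.toTySig (n + 1)}
    (h : Conv (G.map TmDecl.wk) L t s τ) :
    Conv G L (Tm.tlam t) (Tm.tlam s) (Ty.pi τ) :=
  h.plug (Cx.tlam Cx.hole) (fun _ h => h.tlam)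

theorem tapp {τ : Ty S.toTySig (n + 1)} (h : Conv G L t s (Ty.pi τ)) (σ : Ty S.toTySig n) :
    Conv G L (Tm.tapp t σ) (Tm.tapp s σ) (τ.inst σ) :=
  h.plug (Cx.tapp Cx.hole σ) (fun _ h => h.tapp σ)

theorem letT (hs : HasTy G L s (Ty.tensor σ σ'))
    (ht : Conv (⟨true, σ'⟩ :: ⟨true, σ⟩ :: G) (insert 0 (insert 1 (L'.image (· + 2)))) t t' τ)
    (hd : Disjoint L L') : Conv G (L ∪ L') (Tm.letT σ σ' s t) (Tm.letT σ σ' s t') τ :=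
  ht.plug (Cx.letT₂ σ σ' s Cx.hole) (fun _ h => HasTy.letT hs h hd)

theorem letB (hs : HasTy G L s (Ty.bang σ))
    (ht : Conv (⟨false, σ⟩ :: G) (L'.image Nat.succ) t t' τ)
    (hd : Disjoint L L') : Conv G (L ∪ L') (Tm.letB σ s t) (Tm.letB σ s t') τ :=
  ht.plug (Cx.letB₂ σ s Cx.hole) (fun _ h => HasTy.letB hs h hd)

theorem beta (ht : HasTy (⟨true, σ⟩ :: G) (insert 0 (L.image Nat.succ)) t τ)
    (hs : HasTy G L' s σ) (hd : Disjoint L L') :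
    Conv G (L ∪ L') (Tm.app (Tm.lam σ t) s) (t.inst s) τ :=
  ⟨ht.lam.app hs hd, ht.inst_lin hs hd, ExtEq.betaTm (ht.lam.app hs hd)⟩

theorem beta₀ (ht : HasTy (⟨true, σ⟩ :: G) {0} t τ) (hs : HasTy G L s σ) :
    Conv G L (Tm.app (Tm.lam σ t) s) (t.inst s) τ := by
  simpa using beta (L := ∅) (by simpa using ht) hs (by simp)

theorem betaTy {t : Tm S (n + 1)} {τ : Ty S.toTySig (n + 1)}
    (ht : HasTy (G.map TmDecl.wk) L t τ) (σ : Ty S.toTySig n) :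
    Conv G L (Tm.tapp (Tm.tlam t) σ) (t.instTy σ) (τ.inst σ) :=
  ⟨ht.tlam.tapp σ, ht.instTy σ, ExtEq.betaTy (ht.tlam.tapp σ)⟩

theorem betaBang (ht : HasTy (⟨false, σ⟩ :: G) (L.image Nat.succ) t τ) (hs : HasTy G ∅ s σ) :
    Conv G L (Tm.letB σ (Tm.bang s) t) (t.inst s) τ := by
  have h : HasTy G L (Tm.letB σ (Tm.bang s) t) τ := by
    simpa using HasTy.letB hs.bang ht (by simp)
  exact ⟨h, ht.inst_int hs, ExtEq.betaB h⟩

theorem eta (h : HasTy G L t (Ty.lolli σ τ)) :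
    Conv G L (Tm.lam σ (Tm.app t.wk (Tm.var 0))) t (Ty.lolli σ τ) := by
  refine ⟨HasTy.lam ?_, h, ExtEq.etaTm h⟩
  have := (h.wk ⟨true, σ⟩).app (L' := {0}) (HasTy.lvar (i := 0) rfl) (by simp)
  rwa [Finset.union_comm, ← Finset.insert_eq] at this

theorem eta_ty {τ : Ty S.toTySig (n + 1)} (h : HasTy G L t (Ty.pi τ)) :
    Conv G L (Tm.tlam (Tm.tapp t.wkTy (Ty.var 0))) t (Ty.pi τ) :=
  ⟨h.wkTy.tapp_var_zero.tlam, h, ExtEq.etaTy h⟩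

theorem eta_tensor (h : HasTy G L t (Ty.tensor σ σ')) :
    Conv G L (Tm.letT σ σ' t (Tm.tensor (Tm.var 1) (Tm.var 0))) t (Ty.tensor σ σ') := by
  refine ⟨?_, h, ExtEq.etaT h⟩
  have : HasTy (⟨true, σ'⟩ :: ⟨true, σ⟩ :: G) ({1} ∪ {0})
      (Tm.tensor (Tm.var 1) (Tm.var 0)) (Ty.tensor σ σ') :=
    HasTy.tensor (HasTy.lvar rfl) (HasTy.lvar rfl) (by simp)
  simpa using HasTy.letT (L' := ∅) h (this.of_eq (by ext; simp [or_comm])) (by simp)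

theorem eta_bang (h : HasTy G L t (Ty.bang σ)) :
    Conv G L (Tm.letB σ t (Tm.bang (Tm.var 0))) t (Ty.bang σ) := by
  refine ⟨?_, h, ExtEq.etaB h⟩
  simpa using HasTy.letB (L' := ∅) h (HasTy.ivar (i := 0) rfl).bang (by simp)

theorem idm (h : HasTy G L t τ) : Conv G L (Tm.app (Tm.idm τ) t) t τ :=
  beta₀ (HasTy.lvar rfl) h

theorem ilam (ht : HasTy (⟨false, σ⟩ :: G) (L.image Nat.succ) t τ) (hs : HasTy G ∅ s σ) :
    Conv G L (Tm.app (Tm.ilam σ t) (Tm.bang s)) (t.inst s) τ := by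
  have h₁ := beta (L := L) (s := Tm.bang s) (t := Tm.letB σ (Tm.var 0)
    (t.rename id (liftN Nat.succ))) (τ := τ) (σ := Ty.bang σ)
    (HasTy.letB (L := {0}) (L' := L.image Nat.succ) (HasTy.lvar rfl)
      (ht.under_bang_binder _) (by simp)) hs.bang (by simp)
  have e : (t.rename id (liftN Nat.succ)).subst Ty.var (Tm.up (Tm.single (Tm.bang s))) = t := by
    rw [Tm.subst_rename]
    conv_rhs => rw [← Tm.subst_var t]
    congr
    funext i; cases i <;> rfl
  have h₂ : (Tm.letB σ (Tm.var 0) (t.rename id (liftN Nat.succ))).inst (Tm.bang s) =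
      Tm.letB σ (Tm.bang s) t := by
    simp only [Tm.inst, Tm.subst, e, Ty.subst_var, Tm.single_zero]
  rw [h₂] at h₁
  simpa [Tm.ilam] using h₁.trans (by simpa using betaBang ht hs)

end Conv

end LAPL

namespace LAPL

universe u

variable {S : Sig.{u}}

/-! ### The functorial action -/

theorem Tm.ilam_subst {n m : ℕ} (σ : Ty S.toTySig n) (t : Tm S n) (θ : Fin n → Ty S.toTySig m)
    (v : ℕ → Tm S m) : (Tm.ilam σ t).subst θ v = Tm.ilam (σ.subst θ) (t.subst θ (Tm.up v)) := by
  simp only [ilam, subst, Ty.subst, subst_rename, rename_subst, id, Tm.up_zero, Ty.rename_id]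
  congr
  funext i; cases i
  · rfl
  · simp only [liftN_succ, up_succ, wk, rename_rename]; rfl

namespace Role

/-- The substitution `θ` takes the role `r` to the role `r'`. -/
def SubstTo {S : TySig.{u}} {n m : ℕ} (θ : Fin n → Ty S m) : Role n → Role m → Prop
  | hole, hole => True
  | par i, par j => θ i = Ty.var j
  | _, _ => False

variable {T : TySig.{u}}

theorem SubstTo.toTy {n m : ℕ} {θ : Fin n → Ty T m} {r : Role n} {r' : Role m}
    (h : SubstTo θ r r') (A : Ty T n) : (r.toTy A).subst θ = r'.toTy (A.subst θ) := by
  cases r <;> cases r' <;> first | rfl | exact h | exact h.elim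

theorem SubstTo.up {n m : ℕ} {θ : Fin n → Ty T m} {r : Role n} {r' : Role m}
    (h : SubstTo θ r r') : SubstTo (Ty.up θ) (r.shift 1) (r'.shift 1) := by
  cases r <;> cases r' <;> simp only [SubstTo, shift] at h ⊢
  rename_i i j
  have : i.addNat 1 = i.succ := rfl
  rw [this, Ty.up_succ, h]; rfl

theorem shift_shift_one {n : ℕ} (r : Role n) (k : ℕ) : (r.shift k).shift 1 = r.shift (k + 1) := by
  cases r <;> rfl

theorem SubstTo.up_two {n m : ℕ} {θ : Fin n → Ty T m} {r : Role n} {r' : Role m}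
    (h : SubstTo θ r r') :
    SubstTo (Ty.up (Ty.up θ)) (r.shift 2) (r'.shift 2) := by
  have := h.up.up
  rwa [shift_shift_one, shift_shift_one] at this

theorem SubstTo.up_three {n m : ℕ} {θ : Fin n → Ty T m} {r : Role n} {r' : Role m}
    (h : SubstTo θ r r') :
    SubstTo (Ty.up (Ty.up (Ty.up θ))) (r.shift 3) (r'.shift 3) := by
  have := h.up_two.up
  rwa [shift_shift_one, shift_shift_one] at this

theorem SubstTo.cons {n m k : ℕ} {θ : Fin n → Ty T m} {r : Fin k → Role (n + 1)}
    {r' : Fin k → Role (m + 1)} (h : ∀ i, SubstTo (Ty.up θ) (r i) (r' i)) (i : Fin (k + 1)) :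
    SubstTo (Ty.up θ) (Role.cons r i) (Role.cons r' i) := by
  cases i using Fin.cases with
  | zero => rfl
  | succ i => exact h i

theorem toTy_up {n k : ℕ} (r : Fin k → Role n) (A : Ty T n) :
    Ty.up (fun i => (r i).toTy A) = fun i => (cons (fun i => (r i).shift 1) i).toTy A.wk := by
  funext i
  cases i using Fin.cases with
  | zero => rfl
  | succ i => simp only [Ty.up_succ, cons, Fin.cases_succ]; cases r i <;> rfl

end Role

/-- `σ(A)`, where `A` is substituted for the variables of `σ` with the role of a hole. -/
def Ty.fill {T : TySig.{u}} {n k : ℕ} (σ : Ty T k) (r : Fin k → Role n) (A : Ty T n) : Ty T n :=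
  σ.subst (fun i => (r i).toTy A)

theorem Ty.fill_pi {T : TySig.{u}} {n k : ℕ} (σ : Ty T (k + 1)) (r : Fin k → Role n)
    (A : Ty T n) :
    (Ty.pi σ).fill r A = Ty.pi (σ.fill (Role.cons (fun i => (r i).shift 1)) A.wk) := by
  simp only [fill, subst, Role.toTy_up]

theorem Ty.fill_subst {T : TySig.{u}} {n m k : ℕ} (σ : Ty T k) {r : Fin k → Role n}
    {r' : Fin k → Role m} {θ : Fin n → Ty T m} (h : ∀ i, Role.SubstTo θ (r i) (r' i))
    (A : Ty T n) : (σ.fill r A).subst θ = σ.fill r' (A.subst θ) := by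
  simp only [fill, subst_subst, (h _).toTy]

theorem actWrap_subst {n m k : ℕ} (σ : Ty S.toTySig k) (p : Bool) {r : Fin k → Role n}
    {r' : Fin k → Role m} (t : Tm S (n + 2)) {θ : Fin n → Ty S.toTySig m} (v : ℕ → Tm S m)
    (h : ∀ i, Role.SubstTo θ (r i) (r' i)) :
    (actWrap σ p r t).subst θ v = actWrap σ p r' (t.subst (Ty.up (Ty.up θ))
      (Tm.up (Tm.up (fun i => (v i).wkTy.wkTy)))) := by
  have e : ∀ b : Bool, (Ty.var (if b then 1 else 0) : Ty S.toTySig (n + 2)).subst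
      (Ty.up (Ty.up θ)) = Ty.var (if b then 1 else 0) := by
    intro b; cases b <;> rfl
  have := fun b : Bool => Ty.fill_subst σ (fun i => (h i).up_two) (Ty.var (if b then 1 else 0))
  simp only [e, Ty.fill] at this
  simp only [actWrap, Tm.subst, Tm.ilam_subst, this]
  rfl

theorem act_subst {k : ℕ} (σ : Ty S.toTySig k) {n m : ℕ} (p : Bool) {r : Fin k → Role n}
    {r' : Fin k → Role m} {θ : Fin n → Ty S.toTySig m} (v : ℕ → Tm S m)
    (h : ∀ i, Role.SubstTo θ (r i) (r' i)) :
    (act σ p r).subst θ v = act σ p r' := by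
  have e₁ : ∀ {n m : ℕ} (θ : Fin n → Ty S.toTySig m) (b : Bool),
      (Ty.var (if b then 1 else 0) : Ty S.toTySig (n + 2)).subst
      (Ty.up (Ty.up θ)) = Ty.var (if b then 1 else 0) := by
    intro n m θ b; cases b <;> rfl
  have e₂ : ∀ {n m : ℕ} (θ : Fin n → Ty S.toTySig m) (b : Bool),
      (Ty.var (if b then 0 else 1) : Ty S.toTySig (n + 2)).subst
      (Ty.up (Ty.up θ)) = Ty.var (if b then 0 else 1) := by
    intro n m θ b; cases b <;> rfl
  have fs : ∀ {k n m : ℕ} (σ : Ty S.toTySig k) {r : Fin k → Role n} {r' : Fin k → Role m}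
      {θ : Fin n → Ty S.toTySig m} (h : ∀ i, Role.SubstTo θ (r i) (r' i)) (A),
      (σ.subst (fun i => ((r i).shift 2).toTy A)).subst (Ty.up (Ty.up θ)) =
        σ.subst (fun i => ((r' i).shift 2).toTy (A.subst (Ty.up (Ty.up θ)))) :=
    fun σ _ _ _ h A => Ty.fill_subst σ (fun i => (h i).up_two) A
  induction σ generalizing n m p with
  | var i =>
    have hi := h i
    rw [act, act]
    generalize r i = a, r' i = b at hi
    cases a <;> cases b <;> first | exact hi.elim | skip
    · simp only [Tm.subst, Tm.ilam_subst]; rfl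
    · exact actWrap_subst _ _ _ _ h
  | con c args ih => exact actWrap_subst _ _ _ _ h
  | unit => exact actWrap_subst _ _ _ _ h
  | tensor σ τ ihσ ihτ =>
    rw [act, act, actWrap_subst _ _ _ _ h]
    simp only [Tm.subst, fs _ h, e₁, ihσ _ _ (fun i => (h i).up_two),
      ihτ _ _ (fun i => (h i).up_two)]
    rfl
  | lolli σ τ ihσ ihτ =>
    rw [act, act, actWrap_subst _ _ _ _ h]
    simp only [Tm.subst, fs _ h, e₂, ihσ _ _ (fun i => (h i).up_two),
      ihτ _ _ (fun i => (h i).up_two)]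
    rfl
  | bang σ ih =>
    rw [act, act, actWrap_subst _ _ _ _ h]
    simp only [Tm.subst, fs _ h, e₁, ih _ _ (fun i => (h i).up_two)]
    rfl
  | pi σ ih =>
    rw [act, act, actWrap_subst _ _ _ _ h]
    simp only [Tm.subst, ih p _ (Role.SubstTo.cons (fun i => (h i).up_three))]
    rfl

/-- The term `M A B !f`. -/
def Tm.app₃ {n : ℕ} (M : Tm S n) (A B : Ty S.toTySig n) (f : Tm S n) : Tm S n :=
  Tm.app (Tm.tapp (Tm.tapp M A) B) (Tm.bang f)

/-- The simultaneous substitution of `A` and `B` for the last two type variables. -/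
def Ty.pair {T : TySig.{u}} {n : ℕ} (A B : Ty T n) : Fin (n + 2) → Ty T n :=
  Fin.cases B (Fin.cases A Ty.var)

theorem Ty.up_single_subst_single {T : TySig.{u}} {n : ℕ} (A B : Ty T n) :
    (fun i => (Ty.up (Ty.single A) i).subst (Ty.single B)) = Ty.pair A B := by
  funext i
  cases i using Fin.cases with
  | zero => rfl
  | succ i =>
    cases i using Fin.cases with
    | zero => exact Ty.wk_subst_single A B
    | succ i => rfl

theorem Ty.subst_up_single_inst {T : TySig.{u}} {n : ℕ} (σ : Ty T (n + 2)) (A B : Ty T n) :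
    (σ.subst (Ty.up (Ty.single A))).inst B = σ.subst (Ty.pair A B) := by
  rw [Ty.inst, Ty.subst_subst, Ty.up_single_subst_single]

theorem Role.SubstTo.pair {T : TySig.{u}} {n : ℕ} (A B : Ty T n) (r : Role n) :
    SubstTo (Ty.pair A B) (r.shift 2) r := by
  cases r <;> simp only [shift, SubstTo]; rfl

/-- The type of the functorial action. -/
def actTy {T : TySig.{u}} {n k : ℕ} (σ : Ty T k) (p : Bool) (r : Fin k → Role n) : Ty T n :=
  Ty.pi (Ty.pi (Ty.arrow (Ty.lolli (Ty.var 1) (Ty.var 0))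
    (Ty.lolli (σ.fill (fun i => (r i).shift 2) (Ty.var (if p then 1 else 0)))
      (σ.fill (fun i => (r i).shift 2) (Ty.var (if p then 0 else 1))))))

theorem TySubst.pair {n : ℕ} (G : List (TmDecl S.toTySig n)) (L : Finset ℕ)
    (A B : Ty S.toTySig n) :
    TySubst ((G.map TmDecl.wk).map TmDecl.wk) L G (Ty.pair A B) Tm.var (fun i => {i}) := by
  refine TySubst.of_wk L (fun i d hi => ?_)
  simp only [List.getElem?_map, Option.map_eq_some_iff] at hi
  obtain ⟨_, ⟨d, hd, rfl⟩, rfl⟩ := hi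
  rw [hd]
  simp only [TmDecl.wk, ← Ty.subst_up_single_inst, Ty.wk_subst_up, Ty.wk_subst_single, Ty.wk_inst]

theorem Conv.betaTy₂ {n : ℕ} {G : List (TmDecl S.toTySig n)} {L : Finset ℕ} {t : Tm S (n + 2)}
    {τ : Ty S.toTySig (n + 2)} (ht : HasTy ((G.map TmDecl.wk).map TmDecl.wk) L t τ)
    (A B : Ty S.toTySig n) :
    Conv G L (Tm.tapp (Tm.tapp (Tm.tlam (Tm.tlam t)) A) B) (t.subst (Ty.pair A B) Tm.var)
      (τ.subst (Ty.pair A B)) := by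
  have h := ht.subst (TySubst.single G L A).wkTy
  rw [Finset.biUnion_singleton_eq_self] at h
  have h₁ := (Conv.betaTy ht.tlam A).tapp B
  have h₂ := Conv.betaTy h B
  rw [Ty.subst_up_single_inst] at h₂
  have e : (t.subst (Ty.up (Ty.single A)) (fun i => (Tm.var i).wkTy)).instTy B =
      t.subst (Ty.pair A B) Tm.var := by
    rw [Tm.instTy, Tm.subst_subst, Ty.up_single_subst_single]; rfl
  rw [e] at h₂
  refine Conv.trans ?_ h₂
  rw [← Ty.subst_up_single_inst]
  exact h₁

theorem HasTy.tapp₂ {n : ℕ} {G : List (TmDecl S.toTySig n)} {L : Finset ℕ} {M : Tm S n}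
    {σ : Ty S.toTySig (n + 2)} (hM : HasTy G L M (Ty.pi (Ty.pi σ))) (A B : Ty S.toTySig n) :
    HasTy G L (Tm.tapp (Tm.tapp M A) B) (σ.subst (Ty.pair A B)) := by
  rw [← Ty.subst_up_single_inst]
  exact HasTy.tapp B (HasTy.tapp A hM)

theorem actTy_body_subst {T : TySig.{u}} {n k : ℕ} (σ : Ty T k) (p : Bool) (r : Fin k → Role n)
    (A B : Ty T n) :
    (σ.fill (fun i => (r i).shift 2) (Ty.var (if p then 1 else 0))).subst (Ty.pair A B) =
      σ.fill r (if p then A else B) := by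
  rw [Ty.fill_subst σ (fun i => Role.SubstTo.pair A B (r i))]
  cases p <;> rfl

theorem actTy_body_subst' {T : TySig.{u}} {n k : ℕ} (σ : Ty T k) (p : Bool) (r : Fin k → Role n)
    (A B : Ty T n) :
    (σ.fill (fun i => (r i).shift 2) (Ty.var (if p then 0 else 1))).subst (Ty.pair A B) =
      σ.fill r (if p then B else A) := by
  rw [Ty.fill_subst σ (fun i => Role.SubstTo.pair A B (r i))]
  cases p <;> rfl

theorem HasTy.act_app {n k : ℕ} {G : List (TmDecl S.toTySig n)} {M f : Tm S n}
    {σ : Ty S.toTySig k} {p : Bool} {r : Fin k → Role n} {A B : Ty S.toTySig n}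
    (hM : HasTy G ∅ M (actTy σ p r)) (hf : HasTy G ∅ f (Ty.lolli A B)) :
    HasTy G ∅ (Tm.app₃ M A B f)
      (Ty.lolli (σ.fill r (if p then A else B)) (σ.fill r (if p then B else A))) := by
  refine HasTy.app_bang ?_ hf
  have := hM.tapp₂ A B
  simp only [Ty.arrow, Ty.subst, actTy_body_subst, actTy_body_subst'] at this
  exact this

theorem HasTy.actWrap {n k : ℕ} {G : List (TmDecl S.toTySig n)} {t : Tm S (n + 2)}
    {σ : Ty S.toTySig k} {p : Bool} {r : Fin k → Role n}
    (ht : HasTy (⟨true, σ.fill (fun i => (r i).shift 2) (Ty.var (if p then 1 else 0))⟩ ::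
      ⟨false, Ty.lolli (Ty.var 1) (Ty.var 0)⟩ :: (G.map TmDecl.wk).map TmDecl.wk) {0} t
      (σ.fill (fun i => (r i).shift 2) (Ty.var (if p then 0 else 1)))) :
    HasTy G ∅ (actWrap σ p r t) (actTy σ p r) :=
  HasTy.tlam (HasTy.tlam (HasTy.ilam (HasTy.lam₀ ht)))

theorem Conv.actWrap {n k : ℕ} {G : List (TmDecl S.toTySig n)} {t : Tm S (n + 2)} {f : Tm S n}
    {σ : Ty S.toTySig k} {p : Bool} {r : Fin k → Role n} {A B : Ty S.toTySig n}
    (ht : HasTy (⟨true, σ.fill (fun i => (r i).shift 2) (Ty.var (if p then 1 else 0))⟩ ::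
      ⟨false, Ty.lolli (Ty.var 1) (Ty.var 0)⟩ :: (G.map TmDecl.wk).map TmDecl.wk) {0} t
      (σ.fill (fun i => (r i).shift 2) (Ty.var (if p then 0 else 1))))
    (hf : HasTy G ∅ f (Ty.lolli A B)) :
    Conv G ∅ (Tm.app₃ (LAPL.actWrap σ p r t) A B f)
      (Tm.lam (σ.fill r (if p then A else B))
        (t.subst (Ty.pair A B) (Tm.up (Tm.single f))))
      (Ty.lolli (σ.fill r (if p then A else B)) (σ.fill r (if p then B else A))) := by
  have h₁ := Conv.betaTy₂ (HasTy.ilam (L := ∅) (HasTy.lam₀ ht)) A B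
  have h₂ := (HasTy.lam₀ ht).subst ((TySubst.pair G ∅ A B).lift ⟨false, _⟩ |>.mono
    (Finset.subset_insert _ _))
  simp only [Tm.ilam_subst, Tm.subst, Tm.up_var, Ty.subst, Ty.arrow, actTy_body_subst,
    actTy_body_subst'] at h₁ h₂
  have h₃ := Conv.ilam (L := ∅) (s := f) h₂ hf
  have e : (Tm.lam (σ.fill r (if p then A else B)) (t.subst (Ty.pair A B) Tm.var)).inst f =
      Tm.lam (σ.fill r (if p then A else B)) (t.subst (Ty.pair A B) (Tm.up (Tm.single f))) := by
    simp only [Tm.inst, Tm.subst, Tm.subst_subst, Ty.subst_var]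
  rw [e] at h₃
  exact (h₁.app_bang hf).trans h₃

/-- The variables of `σ` with the role of a hole occur only with polarity `p`. -/
def Ty.HolesOnly {T : TySig.{u}} {n k : ℕ} (σ : Ty T k) (p : Bool) (r : Fin k → Role n) : Prop :=
  ∀ i, r i = Role.hole → ¬ σ.Occurs (!p) i

theorem Ty.subst_congr {T : TySig.{u}} {n k : ℕ} (σ : Ty T k) {θ θ' : Fin k → Ty T n}
    (h : ∀ i, σ.Occurs true i ∨ σ.Occurs false i → θ i = θ' i) : σ.subst θ = σ.subst θ' := by
  induction σ generalizing n with
  | var i => exact h i (Or.inl ⟨rfl, rfl⟩)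
  | con c args ih =>
    simp only [subst]; congr; funext j
    exact ih j (fun i hi => h i (Or.inl ⟨j, hi⟩))
  | unit => rfl
  | tensor σ τ ihσ ihτ =>
    simp only [subst]
    rw [ihσ (fun i hi => h i (by simp only [Occurs]; tauto)),
      ihτ (fun i hi => h i (by simp only [Occurs]; tauto))]
  | lolli σ τ ihσ ihτ =>
    simp only [subst]
    rw [ihσ (fun i hi => h i (by simp only [Occurs]; simp; tauto)),
      ihτ (fun i hi => h i (by simp only [Occurs]; tauto))]
  | bang σ ih => simp only [subst]; rw [ih (fun i hi => h i hi)]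
  | pi σ ih =>
    simp only [subst]; rw [ih]
    intro i hi
    cases i using Fin.cases with
    | zero => rfl
    | succ i => simp only [up_succ]; rw [h i hi]

end LAPL

namespace LAPL

universe u

variable {S : Sig.{u}}

theorem Ty.fill_congr {T : TySig.{u}} {n k : ℕ} (σ : Ty T k) {r : Fin k → Role n}
    (h : ∀ i, r i = Role.hole → ¬ σ.Occurs true i ∧ ¬ σ.Occurs false i) (A B : Ty T n) :
    σ.fill r A = σ.fill r B := by
  refine Ty.subst_congr σ (fun i hi => ?_)
  cases e : r i with
  | hole => have := h i e; tauto
  | par j => rfl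

theorem Ty.HolesOnly.shift {T : TySig.{u}} {n k : ℕ} {σ : Ty T k} {p : Bool} {r : Fin k → Role n}
    (h : σ.HolesOnly p r) (m : ℕ) : σ.HolesOnly p (fun i => (r i).shift m) := by
  intro i hi
  refine h i ?_
  cases e : r i with
  | hole => rfl
  | par j => simp only [e, Role.shift] at hi; cases hi

theorem Ty.HolesOnly.cons {T : TySig.{u}} {n k : ℕ} {σ : Ty T (k + 1)} {p : Bool}
    {r : Fin k → Role (n + 1)} (h : ∀ i, r i = Role.hole → ¬ σ.Occurs (!p) i.succ) :
    σ.HolesOnly p (Role.cons r) := by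
  intro i hi
  cases i using Fin.cases with
  | zero => cases hi
  | succ i => exact h i hi

theorem HasTy.act_app_var {n k : ℕ} {G : List (TmDecl S.toTySig n)} {M : Tm S n}
    {σ : Ty S.toTySig k} {p : Bool} {r : Fin k → Role n} {a b : Fin n} {j : ℕ}
    (hM : HasTy G ∅ M (actTy σ p r))
    (hj : G[j]? = some ⟨false, Ty.lolli (Ty.var a) (Ty.var b)⟩) :
    HasTy G ∅ (Tm.app₃ M (Ty.var a) (Ty.var b) (Tm.var j))
      (Ty.lolli (σ.fill r (Ty.var (if p then a else b)))
        (σ.fill r (Ty.var (if p then b else a)))) := by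
  have := hM.act_app (HasTy.ivar hj)
  cases p <;> exact this

/-- `M_σ` has the expected type, and `M_σ A A !id` is the identity. -/
def ActSpec {k n : ℕ} (σ : Ty S.toTySig k) (p : Bool) (r : Fin k → Role n) (M : Tm S n) : Prop :=
  (∀ G, HasTy G ∅ M (actTy σ p r)) ∧
    ∀ G A, Conv G ∅ (Tm.app₃ M A A (Tm.idm A)) (Tm.idm (σ.fill r A))
      (Ty.lolli (σ.fill r A) (σ.fill r A))

theorem actWrap_spec {k n : ℕ} {σ : Ty S.toTySig k} {p : Bool} {r : Fin k → Role n}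
    {t : Tm S (n + 2)}
    (ht : ∀ G : List (TmDecl S.toTySig (n + 2)),
      HasTy (⟨true, σ.fill (fun i => (r i).shift 2) (Ty.var (if p then 1 else 0))⟩ ::
        ⟨false, Ty.lolli (Ty.var 1) (Ty.var 0)⟩ :: G) {0} t
        (σ.fill (fun i => (r i).shift 2) (Ty.var (if p then 0 else 1))))
    (hc : ∀ G A, Conv (⟨true, σ.fill r A⟩ :: G) {0}
      (t.subst (Ty.pair A A) (Tm.up (Tm.single (Tm.idm A)))) (Tm.var 0) (σ.fill r A)) :
    ActSpec σ p r (actWrap σ p r t) := by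
  refine ⟨fun G => HasTy.actWrap (ht _), fun G A => ?_⟩
  have h := Conv.actWrap (ht ((G.map TmDecl.wk).map TmDecl.wk)) (HasTy.idm A)
  simp only [ite_self] at h
  exact h.trans (hc G A).lam₀

theorem actWrap_spec_var {k n : ℕ} {σ : Ty S.toTySig k} {p : Bool} {r : Fin k → Role n}
    (h : ∀ i, r i = Role.hole → ¬ σ.Occurs true i ∧ ¬ σ.Occurs false i) :
    ActSpec (S := S) σ p r (actWrap σ p r (Tm.var 0)) := by
  refine actWrap_spec (fun G => ?_) (fun G A => Conv.refl (HasTy.lvar rfl))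
  refine HasTy.lvar ?_
  rw [Ty.fill_congr σ (A := Ty.var (if p then 1 else 0)) (B := Ty.var (if p then 0 else 1))]
  · rfl
  · intro i hi
    refine h i ?_
    cases e : r i with
    | hole => rfl
    | par j => simp only [e, Role.shift] at hi; cases hi

theorem Conv.of_left {n : ℕ} {G : List (TmDecl S.toTySig n)} {L L' : Finset ℕ} {t t' s : Tm S n}
    {σ : Ty S.toTySig n} (h : Conv G L t s σ) (e : t' = t) (eL : L = L') : Conv G L' t' s σ :=
  e ▸ eL ▸ h

theorem ActSpec.conv {k n : ℕ} {σ : Ty S.toTySig k} {p : Bool} {r : Fin k → Role n} {M s s' : Tm S n}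
    {G : List (TmDecl S.toTySig n)} {L : Finset ℕ} {A : Ty S.toTySig n}
    (h : ActSpec σ p r M) (hs : Conv G L s s' (σ.fill r A)) :
    Conv G L (Tm.app (Tm.app₃ M A A (Tm.idm A)) s) s' (σ.fill r A) :=
  (((h.2 G A).app₀ hs)).trans (Conv.idm hs.right)

theorem Tm.idm_wk {n : ℕ} (A : Ty S.toTySig n) : (Tm.idm A).wk = Tm.idm A := by
  simp only [idm, wk, rename, Ty.rename_id, liftN_zero]

theorem act_spec {k : ℕ} (σ : Ty S.toTySig k) {n : ℕ} (p : Bool) (r : Fin k → Role n)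
    (h : σ.HolesOnly p r) : ActSpec σ p r (act σ p r) := by
  induction σ generalizing n p with
  | var i =>
    rw [act]
    have hi := h i
    cases e : r i with
    | par j => exact actWrap_spec_var (fun i' hi' => by
        by_cases hii : i' = i
        · subst hii; rw [e] at hi'; cases hi'
        · simp [Ty.Occurs, hii])
    | hole =>
      have hp : p = true := by
        have := hi e
        simp only [Ty.Occurs] at this
        cases p <;> simp at this ⊢
      subst hp
      have e₁ : ∀ A, (Ty.var i : Ty S.toTySig _).fill (fun i => (r i).shift 2) A = A := by
        intro A; simp only [Ty.fill, Ty.subst, e]; rfl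
      have e₂ : ∀ A, (Ty.var i : Ty S.toTySig _).fill r A = A := by
        intro A; simp only [Ty.fill, Ty.subst, e]; rfl
      have ht : ∀ G : List (TmDecl S.toTySig (n + 2)),
          HasTy G ∅ (Tm.ilam (Ty.lolli (Ty.var 1) (Ty.var 0)) (Tm.var 0))
            (Ty.arrow (Ty.lolli (Ty.var 1) (Ty.var 0)) (Ty.lolli (Ty.var 1) (Ty.var 0))) :=
        fun G => HasTy.ilam (HasTy.ivar rfl)
      constructor
      · intro G
        simp only [actTy, e₁]
        exact HasTy.tlam (HasTy.tlam (ht _))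
      · intro G A
        rw [e₂]
        have h₁ := (Conv.betaTy₂ (ht ((G.map TmDecl.wk).map TmDecl.wk)) A A).app_bang (HasTy.idm A)
        exact h₁.trans (Conv.ilam (L := ∅) (t := Tm.var 0) (HasTy.ivar rfl) (HasTy.idm A))
  | con c args ih =>
    refine actWrap_spec_var (fun i hi => ?_)
    have := h i hi
    simp only [Ty.Occurs] at this ⊢
    exact ⟨this, this⟩
  | unit => exact actWrap_spec_var (fun i hi => ⟨id, id⟩)
  | tensor σ τ ihσ ihτ =>
    have hσ : σ.HolesOnly p r := fun i hi ho => h i hi (Or.inl ho)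
    have hτ : τ.HolesOnly p r := fun i hi ho => h i hi (Or.inr ho)
    refine actWrap_spec (fun G => ?_) (fun G A => ?_)
    · exact HasTy.letT (L := {0}) (L' := ∅) (HasTy.lvar rfl) ((HasTy.tensor
          (((ihσ p _ (hσ.shift 2)).1 _).act_app_var (j := 3) rfl |>.app₀ (HasTy.lvar (i := 1) rfl))
          (((ihτ p _ (hτ.shift 2)).1 _).act_app_var (j := 3) rfl |>.app₀ (HasTy.lvar (i := 0) rfl))
          (by simp)).of_eq (by ext; simp [or_comm])) (by simp)
    · have hc := Conv.letT (G := ⟨true, (Ty.tensor σ τ).fill r A⟩ :: G) (L := {0}) (L' := ∅)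
        (HasTy.lvar rfl) ((Conv.tensor
          ((ihσ p r hσ).conv (A := A) (Conv.refl (HasTy.lvar (i := 1) rfl)))
          ((ihτ p r hτ).conv (A := A) (Conv.refl (HasTy.lvar (i := 0) rfl)))
          (by simp)).of_eq (by ext; simp [or_comm])) (by simp)
      have he := Conv.eta_tensor (G := ⟨true, (Ty.tensor σ τ).fill r A⟩ :: G) (L := {0})
        (t := Tm.var 0) (σ := σ.fill r A) (σ' := τ.fill r A) (HasTy.lvar rfl)
      refine Conv.of_left (hc.trans he) ?_ (by simp)
      have e₁ := fun p => act_subst σ p (Tm.up (Tm.up (Tm.up (Tm.single (Tm.idm A)))))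
        (fun i => Role.SubstTo.pair A A (r i))
      have e₂ := fun p => act_subst τ p (Tm.up (Tm.up (Tm.up (Tm.single (Tm.idm A)))))
        (fun i => Role.SubstTo.pair A A (r i))
      have e₃ := fun σ => actTy_body_subst (T := S.toTySig) σ p r A A
      simp only [Ty.fill, ite_self] at e₃
      simp only [Tm.subst, e₁, e₂, e₃]
      simp only [Tm.up, Tm.single, Tm.idm_wk]
      rfl
  | lolli σ τ ihσ ihτ =>
    have hσ : σ.HolesOnly (!p) r := fun i hi ho => h i hi (Or.inl ho)
    have hτ : τ.HolesOnly p r := fun i hi ho => h i hi (Or.inr ho)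
    refine actWrap_spec (fun G => ?_) (fun G A => ?_)
    · refine HasTy.lam (L := {0}) ?_
      have hs : ∀ G : List (TmDecl S.toTySig (n + 2)), HasTy
          (⟨true, σ.fill (fun i => (r i).shift 2) (Ty.var (if p then 0 else 1))⟩ :: G) {0}
          (Tm.var 0) (σ.fill (fun i => (r i).shift 2) (Ty.var (if !p then 1 else 0))) := by
        intro G; cases p <;> exact HasTy.lvar rfl
      have h₁ := ((ihσ (!p) _ (hσ.shift 2)).1 _).act_app_var
        (G := ⟨true, σ.fill (fun i => (r i).shift 2) (Ty.var (if p then 0 else 1))⟩ ::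
          ⟨true, (Ty.lolli σ τ).fill (fun i => (r i).shift 2) (Ty.var (if p then 1 else 0))⟩ ::
          ⟨false, Ty.lolli (Ty.var 1) (Ty.var 0)⟩ :: G) (j := 2) rfl |>.app₀ (hs _)
      have h₂ : (if (!p) = true then 0 else 1 : Fin (n + 2)) = if p then 1 else 0 := by
        cases p <;> rfl
      rw [h₂] at h₁
      exact (((ihτ p _ (hτ.shift 2)).1 _).act_app_var (j := 2) rfl |>.app₀
        (HasTy.app (L := {1}) (HasTy.lvar rfl) h₁ (by simp))).of_eq (by ext; simp [or_comm])
    · have hc := Conv.lam (L := {0}) (G := ⟨true, (Ty.lolli σ τ).fill r A⟩ :: G)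
        (((ihτ p r hτ).conv (A := A) (Conv.app (L := {1}) (Conv.refl (HasTy.lvar rfl))
          ((ihσ (!p) r hσ).conv (A := A) (Conv.refl (HasTy.lvar (i := 0) rfl)))
          (by simp))).of_eq (by ext; simp [or_comm]))
      have he := Conv.eta (G := ⟨true, (Ty.lolli σ τ).fill r A⟩ :: G) (L := {0})
        (t := Tm.var 0) (σ := σ.fill r A) (τ := τ.fill r A) (HasTy.lvar rfl)
      refine Conv.of_left (hc.trans he) ?_ (by simp)
      have e₁ := fun p => act_subst σ p (Tm.up (Tm.up (Tm.single (Tm.idm A))))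
        (fun i => Role.SubstTo.pair A A (r i))
      have e₂ := fun p => act_subst τ p (Tm.up (Tm.up (Tm.single (Tm.idm A))))
        (fun i => Role.SubstTo.pair A A (r i))
      have e₃ := fun σ => actTy_body_subst' (T := S.toTySig) σ p r A A
      simp only [Ty.fill, ite_self] at e₃
      simp only [Tm.subst, e₁, e₂, e₃]
      simp only [Tm.up, Tm.single, Tm.idm_wk]
      rfl
  | bang σ ih =>
    have hσ : σ.HolesOnly p r := h
    refine actWrap_spec (fun G => ?_) (fun G A => ?_)
    · exact HasTy.letB (L := {0}) (L' := ∅) (HasTy.lvar rfl)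
        (((ih p _ (hσ.shift 2)).1 _).act_app_var (j := 2) rfl |>.app₀
          (HasTy.ivar (i := 0) rfl)).bang (by simp)
    · have hc := Conv.letB (G := ⟨true, (Ty.bang σ).fill r A⟩ :: G) (L := {0}) (L' := ∅)
        (HasTy.lvar rfl)
        ((ih p r hσ).conv (A := A) (Conv.refl (HasTy.ivar (i := 0) rfl))).bang (by simp)
      have he := Conv.eta_bang (G := ⟨true, (Ty.bang σ).fill r A⟩ :: G) (L := {0})
        (t := Tm.var 0) (σ := σ.fill r A) (HasTy.lvar rfl)
      refine Conv.of_left (hc.trans he) ?_ (by simp)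
      have e₁ := fun p => act_subst σ p (Tm.up (Tm.up (Tm.single (Tm.idm A))))
        (fun i => Role.SubstTo.pair A A (r i))
      have e₃ := fun σ => actTy_body_subst (T := S.toTySig) σ p r A A
      simp only [Ty.fill, ite_self] at e₃
      simp only [Tm.subst, e₁, e₃]
      simp only [Tm.up, Tm.single, Tm.idm_wk]
      rfl
  | pi σ ih =>
    have hσ : ∀ m, σ.HolesOnly p (Role.cons (fun i => (r i).shift (m + 1))) := by
      intro m
      refine Ty.HolesOnly.cons (fun i hi => h i ?_)
      cases e : r i with
      | hole => rfl
      | par j => simp only [e, Role.shift] at hi; cases hi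
    refine actWrap_spec (fun G => ?_) (fun G A => ?_)
    · have e : ∀ a : Fin (n + 2), (Ty.pi σ).fill (fun i => (r i).shift 2) (Ty.var a) =
          Ty.pi (σ.fill (Role.cons (fun i => (r i).shift 3)) (Ty.var a.succ)) := by
        intro a
        rw [Ty.fill_pi]
        simp only [Role.shift_shift_one]
        rfl
      have e₁ : (if p then (1 : Fin (n + 2)) else 0).succ = if p then 2 else 1 := by
        cases p <;> rfl
      have e₂ : (if p then (0 : Fin (n + 2)) else 1).succ = if p then 1 else 2 := by
        cases p <;> rfl
      rw [e, e, e₁, e₂]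
      exact HasTy.tlam (((ih p _ (hσ 2)).1 _).act_app_var (j := 1) rfl |>.app₀
        (HasTy.lvar (i := 0) rfl).tapp_var_zero)
    · rw [Ty.fill_pi]
      have hc := Conv.tlam (G := ⟨true, Ty.pi (σ.fill (Role.cons (fun i => (r i).shift 1)) A.wk)⟩ :: G)
        ((ih p _ (hσ 0)).conv (A := A.wk) (Conv.refl (HasTy.lvar (i := 0) rfl).tapp_var_zero))
      have he := Conv.eta_ty
        (G := ⟨true, Ty.pi (σ.fill (Role.cons (fun i => (r i).shift 1)) A.wk)⟩ :: G) (L := {0})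
        (t := Tm.var 0) (HasTy.lvar rfl)
      refine Conv.of_left (hc.trans he) ?_ (by simp)
      have e₁ := fun p => act_subst σ p (θ := Ty.up (Ty.pair A A))
        (fun i => (Tm.up (Tm.single (Tm.idm A)) i).wkTy)
        (Role.SubstTo.cons (fun i => by
          simpa only [Role.shift_shift_one] using (Role.SubstTo.pair A A (r i)).up))
      simp only [Tm.subst, e₁]
      simp only [Tm.up, Tm.single, Tm.idm_wk]
      rfl

end LAPL

namespace LAPL

universe u

variable {S : Sig.{u}}

/-! ### The combinators `fold` and `in` -/

theorem holesOnly_of_onlyPositive {T : TySig.{u}} {n : ℕ} {σ : Ty T 1} (h : σ.OnlyPositive 0) :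
    σ.HolesOnly true (fun _ => (Role.hole : Role n)) := by
  intro i _
  rw [Subsingleton.elim i 0]
  exact h

/-- The closed type of the functorial action of `α ⊢ σ(α)`. -/
def mapTy {T : TySig.{u}} {n : ℕ} (σ : Ty T 1) : Ty T n :=
  Ty.pi (Ty.pi (Ty.arrow (Ty.lolli (Ty.var 1) (Ty.var 0))
    (Ty.lolli (σ.at1 (Ty.var 1)) (σ.at1 (Ty.var 0)))))

theorem HasTy.act {n : ℕ} {G : List (TmDecl S.toTySig n)} {σ : Ty S.toTySig 1}
    (h : σ.OnlyPositive 0) :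
    HasTy G ∅ (act σ true (fun _ => Role.hole)) (mapTy σ) :=
  (act_spec σ true _ (holesOnly_of_onlyPositive h)).1 G

theorem HasTy.fmap {n : ℕ} {G : List (TmDecl S.toTySig n)} {σ : Ty S.toTySig 1}
    (h : σ.OnlyPositive 0) {A B : Ty S.toTySig n} {f : Tm S n}
    (hf : HasTy G ∅ f (Ty.lolli A B)) :
    HasTy G ∅ (fmap σ A B f) (Ty.lolli (σ.at1 A) (σ.at1 B)) :=
  ((act_spec σ true _ (holesOnly_of_onlyPositive h)).1 G).act_app hf

theorem Conv.fmap_idm {n : ℕ} {G : List (TmDecl S.toTySig n)} {σ : Ty S.toTySig 1}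
    (h : σ.OnlyPositive 0) (A : Ty S.toTySig n) :
    Conv G ∅ (fmap σ A A (Tm.idm A)) (Tm.idm (σ.at1 A)) (Ty.lolli (σ.at1 A) (σ.at1 A)) :=
  (act_spec σ true _ (holesOnly_of_onlyPositive h)).2 G A

theorem act_hole_subst {n m : ℕ} (σ : Ty S.toTySig 1) (θ : Fin n → Ty S.toTySig m)
    (v : ℕ → Tm S m) :
    (act σ true (fun _ => (Role.hole : Role n))).subst θ v = act σ true (fun _ => Role.hole) :=
  act_subst σ true v (fun _ => trivial)

theorem fmap_subst {n m : ℕ} (σ : Ty S.toTySig 1) (A B : Ty S.toTySig n) (f : Tm S n)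
    (θ : Fin n → Ty S.toTySig m) (v : ℕ → Tm S m) :
    (fmap σ A B f).subst θ v = fmap σ (A.subst θ) (B.subst θ) (f.subst θ v) := by
  simp only [fmap, Tm.subst, act_hole_subst]

@[simp] theorem fold_subst {n m : ℕ} (σ : Ty S.toTySig 1) (θ : Fin n → Ty S.toTySig m)
    (v : ℕ → Tm S m) : (fold σ : Tm S n).subst θ v = fold σ := by
  simp only [fold, Tm.subst, Tm.ilam_subst, Ty.subst, Ty.at1_subst, Ty.mu_subst]
  rfl

@[simp] theorem inMap_subst {n m : ℕ} (σ : Ty S.toTySig 1) (θ : Fin n → Ty S.toTySig m)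
    (v : ℕ → Tm S m) : (inMap σ : Tm S n).subst θ v = inMap σ := by
  simp only [inMap, Tm.subst, Tm.ilam_subst, Ty.subst, Ty.at1_subst, Ty.mu_subst, fmap_subst,
    fold_subst]
  rfl

@[simp] theorem inMap_rename {n m : ℕ} (σ : Ty S.toTySig 1) (ξ : Fin n → Fin m) (ζ : ℕ → ℕ) :
    (inMap σ : Tm S n).rename ξ ζ = inMap σ := by
  rw [← Tm.subst_var_comp, inMap_subst]

theorem HasTy.mu_tapp {n : ℕ} {G : List (TmDecl S.toTySig n)} {L : Finset ℕ} {t : Tm S n}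
    {σ : Ty S.toTySig 1} (ht : HasTy G L t σ.mu) (A : Ty S.toTySig n) :
    HasTy G L (Tm.tapp t A) (Ty.arrow (Ty.lolli (σ.at1 A) A) A) := by
  have := ht.tapp A
  simp only [Ty.inst, Ty.arrow, Ty.subst, Ty.at1_subst] at this
  exact this

/-- `fold A !f : μα.σ(α) ⊸ A`. -/
def foldAt {n : ℕ} (σ : Ty S.toTySig 1) (A : Ty S.toTySig n) (f : Tm S n) : Tm S n :=
  Tm.app (Tm.tapp (fold σ) A) (Tm.bang f)

theorem foldAt_subst {n m : ℕ} (σ : Ty S.toTySig 1) (A : Ty S.toTySig n) (f : Tm S n)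
    (θ : Fin n → Ty S.toTySig m) (v : ℕ → Tm S m) :
    (foldAt σ A f).subst θ v = foldAt σ (A.subst θ) (f.subst θ v) := by
  simp only [foldAt, Tm.subst, fold_subst]

theorem HasTy.fold_body {n : ℕ} {G : List (TmDecl S.toTySig n)} (σ : Ty S.toTySig 1)
    (A : Ty S.toTySig n) :
    HasTy (⟨false, Ty.lolli (σ.at1 A) A⟩ :: G) ∅
      (Tm.lam σ.mu (Tm.app (Tm.tapp (Tm.var 0) A) (Tm.bang (Tm.var 1))))
      (Ty.lolli σ.mu A) :=
  HasTy.lam₀ (HasTy.app_bang ((HasTy.lvar (i := 0) rfl).mu_tapp A) (HasTy.ivar rfl))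

theorem Conv.fold_tapp {n : ℕ} {G : List (TmDecl S.toTySig n)} {σ : Ty S.toTySig 1}
    {A : Ty S.toTySig n} {f : Tm S n} (hf : HasTy G ∅ f (Ty.lolli (σ.at1 A) A)) :
    Conv G ∅ (foldAt σ A f) (Tm.lam σ.mu (Tm.app (Tm.tapp (Tm.var 0) A) (Tm.bang f.wk)))
      (Ty.lolli σ.mu A) := by
  have h₁ := Conv.betaTy (G := G) (HasTy.ilam (L := ∅) (HasTy.fold_body σ (Ty.var 0))) A
  simp only [Tm.instTy, Ty.inst, Tm.ilam_subst, Tm.subst, Ty.subst, Ty.arrow, Ty.at1_subst,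
    Ty.mu_subst] at h₁
  have h₂ := Conv.ilam (L := ∅) (HasTy.fold_body (G := G) σ A) hf
  simp only [Tm.inst, Tm.subst, Ty.subst_var] at h₂
  exact (h₁.app_bang hf).trans h₂

theorem HasTy.foldAt {n : ℕ} {G : List (TmDecl S.toTySig n)} {σ : Ty S.toTySig 1}
    {A : Ty S.toTySig n} {f : Tm S n} (hf : HasTy G ∅ f (Ty.lolli (σ.at1 A) A)) :
    HasTy G ∅ (foldAt σ A f) (Ty.lolli σ.mu A) :=
  (Conv.fold_tapp hf).left

theorem Conv.foldAt_app {n : ℕ} {G : List (TmDecl S.toTySig n)} {L : Finset ℕ}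
    {σ : Ty S.toTySig 1} {A : Ty S.toTySig n} {f t : Tm S n}
    (hf : HasTy G ∅ f (Ty.lolli (σ.at1 A) A)) (ht : HasTy G L t σ.mu) :
    Conv G L (Tm.app (foldAt σ A f) t) (Tm.app (Tm.tapp t A) (Tm.bang f)) A := by
  refine ((Conv.fold_tapp hf).app₀ (Conv.refl ht)).trans ?_
  have := Conv.beta₀ (t := Tm.app (Tm.tapp (Tm.var 0) A) (Tm.bang f.wk))
    (HasTy.app_bang ((HasTy.lvar (i := 0) rfl).mu_tapp A) (hf.wk₀ ⟨true, σ.mu⟩)) ht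
  have e : f.wk.subst Ty.var (Tm.single t) = f := Tm.wk_inst f t
  simpa only [Tm.inst, Tm.subst, Ty.subst_var, e, Tm.single_zero] using this

theorem HasTy.in_body {n : ℕ} {G : List (TmDecl S.toTySig n)} {L : Finset ℕ}
    {σ : Ty S.toTySig 1} (h : σ.OnlyPositive 0) {A : Ty S.toTySig n} {f z : Tm S n}
    (hf : HasTy G ∅ f (Ty.lolli (σ.at1 A) A)) (hz : HasTy G L z (σ.at1 σ.mu)) :
    HasTy G L (Tm.app f (Tm.app (LAPL.fmap σ σ.mu A (LAPL.foldAt σ A f)) z)) A :=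
  hf.app₀ ((HasTy.fmap h hf.foldAt).app₀ hz)

theorem HasTy.inMap {n : ℕ} {G : List (TmDecl S.toTySig n)} {σ : Ty S.toTySig 1}
    (h : σ.OnlyPositive 0) :
    HasTy G ∅ (inMap σ) (Ty.lolli (σ.at1 σ.mu) σ.mu) := by
  refine HasTy.lam₀ (HasTy.tlam (HasTy.ilam ?_))
  refine HasTy.in_body h (HasTy.ivar rfl) (HasTy.lvar (i := 1) ?_)
  simp [TmDecl.wk, Ty.wk, Ty.at1_rename]

theorem Conv.in_app {n : ℕ} {G : List (TmDecl S.toTySig n)} {σ : Ty S.toTySig 1}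
    (h : σ.OnlyPositive 0) {A : Ty S.toTySig n} {f z : Tm S n}
    (hf : HasTy G ∅ f (Ty.lolli (σ.at1 A) A)) (hz : HasTy G ∅ z (σ.at1 σ.mu)) :
    Conv G ∅ (Tm.app (Tm.tapp (Tm.app (inMap σ) z) A) (Tm.bang f))
      (Tm.app f (Tm.app (fmap σ σ.mu A (foldAt σ A f)) z)) A := by
  have hz' : HasTy (G.map TmDecl.wk) ∅ z.wkTy (σ.at1 σ.mu) := by
    simpa [Ty.wk, Ty.at1_rename] using hz.wkTy
  have h₁ := Conv.beta₀ (G := G) (σ := σ.at1 σ.mu) (τ := σ.mu) (t := Tm.tlam (Tm.ilam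
    (Ty.lolli (σ.at1 (Ty.var 0)) (Ty.var 0)) (Tm.app (Tm.var 0) (Tm.app
      (fmap σ σ.mu (Ty.var 0) (foldAt σ (Ty.var 0) (Tm.var 0))) (Tm.var 1))))) ?_ hz
  · simp only [Tm.inst, Tm.subst, Tm.ilam_subst, Ty.subst, Ty.at1_subst, Ty.mu_subst, fmap_subst,
      foldAt_subst] at h₁
    have h₂ := Conv.betaTy (G := G) (HasTy.ilam (L := ∅) (HasTy.in_body h
      (A := Ty.var 0) (f := Tm.var 0) (HasTy.ivar rfl)
      (hz'.wk₀ ⟨false, Ty.lolli (σ.at1 (Ty.var 0)) (Ty.var 0)⟩))) A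
    have e : z.wkTy.wk.subst (Ty.single A) (Tm.up Tm.var) = z.wk := by
      rw [Tm.wk_subst_up]; exact congrArg Tm.wk (Tm.wkTy_instTy z A)
    simp only [Tm.instTy, Ty.inst, Tm.subst, Tm.ilam_subst, Ty.subst, Ty.at1_subst, Ty.arrow,
      Ty.mu_subst, fmap_subst, foldAt_subst, e] at h₂
    have h₃ := Conv.ilam (L := ∅) (HasTy.in_body h (A := A) (f := Tm.var 0) (HasTy.ivar rfl)
      (hz.wk₀ ⟨false, Ty.lolli (σ.at1 A) A⟩)) hf
    have e' : z.wk.subst Ty.var (Tm.single f) = z := Tm.wk_inst z f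
    simp only [Tm.inst, Tm.subst, Ty.subst_var, fmap_subst, foldAt_subst, e'] at h₃
    have h₄ := h₁.tapp A
    simp only [Ty.inst, Ty.subst, Ty.at1_subst, Ty.arrow] at h₄
    exact ((h₄.trans h₂).app_bang hf).trans h₃
  · refine HasTy.tlam (HasTy.ilam ?_)
    refine HasTy.in_body h (HasTy.ivar rfl) (HasTy.lvar (i := 1) ?_)
    simp [TmDecl.wk, Ty.wk, Ty.at1_rename]

end LAPL

namespace LAPL

universe u

variable {S : Sig.{u}} {Ax : Axioms S}

/-! ### Weakening in the logic -/

theorem intCtx_wk {T : TySig.{u}} {n : ℕ} (Γ : List (Ty T n)) :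
    intCtx (Γ.map Ty.wk) = (intCtx Γ).map TmDecl.wk := by
  simp [intCtx, TmDecl.wk]

theorem Prov.wkTm_nil {n : ℕ} {Γ : List (Ty S.toTySig n)} {Θ : List (RelDecl S.toTySig n)}
    {φ : Fml S n} (h : Prov Ax Γ Θ [] φ) (ω : Ty S.toTySig n) :
    Prov Ax (ω :: Γ) Θ [] (φ.wkTm 1) := by
  have h₁ : Prov Ax Γ Θ [Ex.qTm Quant.ex ω Ex.top] φ :=
    Prov.weaken (by simpa using IsProp.qTm _ IsProp.top) (by simp) h
  exact (Prov.exTmI h₁).impI.impE Prov.topI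

theorem Prov.wkTy_nil {n : ℕ} {Γ : List (Ty S.toTySig n)} {Θ : List (RelDecl S.toTySig n)}
    {φ : Fml S n} (h : Prov Ax Γ Θ [] φ) :
    Prov Ax (Γ.map Ty.wk) (Θ.map RelDecl.wk) [] φ.wkTy := by
  have h₁ : Prov Ax Γ Θ [Ex.qTy Quant.ex Ex.top] φ :=
    Prov.weaken (by simpa using IsProp.qTy _ IsProp.top) (by simp) h
  exact (Prov.exTyI h₁).impI.impE Prov.topI

theorem Prov.wkRel_nil {n : ℕ} {Γ : List (Ty S.toTySig n)} {Θ : List (RelDecl S.toTySig n)}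
    {φ : Fml S n} (h : Prov Ax Γ Θ [] φ) (d : RelDecl S.toTySig n) :
    Prov Ax Γ (d :: Θ) [] φ.wkRel := by
  have h₁ : Prov Ax Γ Θ [Ex.qRel Quant.ex d.kind d.dom d.cod Ex.top] φ :=
    Prov.weaken (by simpa using IsProp.qRel _ IsProp.top) (by simp) h
  exact (Prov.exRelI h₁).impI.impE Prov.topI

namespace RelDecl

variable {T : TySig.{u}}

def rename {n m : ℕ} (d : RelDecl T n) (ξ : Fin n → Fin m) : RelDecl T m :=
  ⟨d.kind, d.dom.rename ξ, d.cod.rename ξ⟩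

end RelDecl

/-- Renamings which insert a single variable somewhere in a context. -/
inductive Wk {T : TySig.{u}} : {n m : ℕ} → List (Ty T n) → List (RelDecl T n) → List (Ty T m) →
    List (RelDecl T m) → (Fin n → Fin m) → (ℕ → ℕ) → (ℕ → ℕ) → Prop
  | tm {n : ℕ} (Γ : List (Ty T n)) (Θ : List (RelDecl T n)) (ω : Ty T n) :
      Wk Γ Θ (ω :: Γ) Θ id Nat.succ id
  | ty {n : ℕ} (Γ : List (Ty T n)) (Θ : List (RelDecl T n)) :
      Wk Γ Θ (Γ.map Ty.wk) (Θ.map RelDecl.wk) Fin.succ id id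
  | rel {n : ℕ} (Γ : List (Ty T n)) (Θ : List (RelDecl T n)) (d : RelDecl T n) :
      Wk Γ Θ Γ (d :: Θ) id id Nat.succ
  | liftTm {n m : ℕ} {Γ : List (Ty T n)} {Θ : List (RelDecl T n)} {Γ' : List (Ty T m)}
      {Θ' : List (RelDecl T m)} {ξ : Fin n → Fin m} {ζ η : ℕ → ℕ} (ω : Ty T n) :
      Wk Γ Θ Γ' Θ' ξ ζ η → Wk (ω :: Γ) Θ (ω.rename ξ :: Γ') Θ' ξ (liftN ζ) η
  | liftTy {n m : ℕ} {Γ : List (Ty T n)} {Θ : List (RelDecl T n)} {Γ' : List (Ty T m)}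
      {Θ' : List (RelDecl T m)} {ξ : Fin n → Fin m} {ζ η : ℕ → ℕ} :
      Wk Γ Θ Γ' Θ' ξ ζ η → Wk (Γ.map Ty.wk) (Θ.map RelDecl.wk) (Γ'.map Ty.wk)
        (Θ'.map RelDecl.wk) (liftF ξ) ζ η
  | liftRel {n m : ℕ} {Γ : List (Ty T n)} {Θ : List (RelDecl T n)} {Γ' : List (Ty T m)}
      {Θ' : List (RelDecl T m)} {ξ : Fin n → Fin m} {ζ η : ℕ → ℕ} (d : RelDecl T n) :
      Wk Γ Θ Γ' Θ' ξ ζ η → Wk Γ (d :: Θ) Γ' (d.rename ξ :: Θ') ξ ζ (liftN η)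

namespace Wk

section

variable {T : TySig.{u}} {n m : ℕ} {Γ : List (Ty T n)} {Θ : List (RelDecl T n)}
  {Γ' : List (Ty T m)} {Θ' : List (RelDecl T m)} {ξ : Fin n → Fin m} {ζ η : ℕ → ℕ}

theorem injective (h : Wk Γ Θ Γ' Θ' ξ ζ η) : Function.Injective ζ := by
  induction h with
  | tm => exact Nat.succ_injective
  | ty => exact Function.injective_id
  | rel => exact Function.injective_id
  | liftTm _ _ ih => exact liftN_injective ih
  | liftTy _ ih => exact ih
  | liftRel _ _ ih => exact ih

theorem tm_lookup (h : Wk Γ Θ Γ' Θ' ξ ζ η) (i : ℕ) (σ : Ty T n) (hi : Γ[i]? = some σ) :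
    Γ'[ζ i]? = some (σ.rename ξ) := by
  induction h generalizing i with
  | tm => simpa using hi
  | ty => simp [hi, Ty.wk]
  | rel => simpa using hi
  | liftTm _ _ ih =>
    cases i with
    | zero => simp at hi ⊢; rw [hi]
    | succ i => exact ih i σ (by simpa using hi)
  | liftTy _ ih =>
    simp only [List.getElem?_map, Option.map_eq_some_iff] at hi ⊢
    obtain ⟨τ, hτ, rfl⟩ := hi
    exact ⟨_, ih i τ hτ, (Ty.wk_rename_liftF _ _).symm⟩
  | liftRel _ _ ih => exact ih i σ hi

theorem rel_lookup (h : Wk Γ Θ Γ' Θ' ξ ζ η) (i : ℕ) (d : RelDecl T n) (hi : Θ[i]? = some d) :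
    Θ'[η i]? = some (d.rename ξ) := by
  induction h generalizing i with
  | tm => simpa [RelDecl.rename] using hi
  | ty => simp [hi, RelDecl.wk, RelDecl.rename, Ty.wk]
  | rel => simpa [RelDecl.rename] using hi
  | liftTm _ _ ih => exact ih i d hi
  | liftTy _ ih =>
    simp only [List.getElem?_map, Option.map_eq_some_iff] at hi ⊢
    obtain ⟨τ, hτ, rfl⟩ := hi
    exact ⟨_, ih i τ hτ, by simp [RelDecl.wk, RelDecl.rename]⟩
  | liftRel _ _ ih =>
    cases i with
    | zero => simp at hi ⊢; rw [hi]
    | succ i => exact ih i d (by simpa using hi)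

end

variable {n m : ℕ} {Γ : List (Ty S.toTySig n)} {Θ : List (RelDecl S.toTySig n)}
  {Γ' : List (Ty S.toTySig m)} {Θ' : List (RelDecl S.toTySig m)} {ξ : Fin n → Fin m}
  {ζ η : ℕ → ℕ}

theorem hasTy (h : Wk Γ Θ Γ' Θ' ξ ζ η) {t : Tm S n} {σ : Ty S.toTySig n}
    (ht : HasTy (intCtx Γ) ∅ t σ) : HasTy (intCtx Γ') ∅ (t.rename ξ ζ) (σ.rename ξ) := by
  have := ht.rename (G' := intCtx Γ') (ξ := ξ) h.injective ?_
  · simpa using this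
  · intro i d hi
    simp only [intCtx, List.getElem?_map, Option.map_eq_some_iff] at hi ⊢
    obtain ⟨τ, hτ, rfl⟩ := hi
    exact ⟨_, h.tm_lookup i τ hτ, rfl⟩

theorem prov (h : Wk Γ Θ Γ' Θ' ξ ζ η) {φ : Fml S n} (hφ : Prov Ax Γ Θ [] φ) :
    Prov Ax Γ' Θ' [] (φ.rename ξ ζ η) := by
  induction h with
  | tm => exact hφ.wkTm_nil _
  | ty => exact hφ.wkTy_nil
  | rel => exact hφ.wkRel_nil _
  | liftTm _ _ ih => exact Prov.allTmE (Φ := []) (ih (Prov.allTmI (Φ := []) hφ))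
  | liftTy _ ih => exact Prov.allTyE (Φ := []) (ih (Prov.allTyI (Φ := []) hφ))
  | liftRel _ _ ih => exact Prov.allRelE (Φ := []) (ih (Prov.allRelI (Φ := []) hφ))

end Wk

theorem Tm.app_wk_wk_rename {n m : ℕ} (t : Tm S n) (ξ : Fin n → Fin m) (ζ : ℕ → ℕ) :
    t.wk.wk.rename ξ (liftN (liftN ζ)) = (t.rename ξ ζ).wk.wk := by
  rw [wk_rename_liftN, wk_rename_liftN]

theorem Ex.reindex_rename {n m : ℕ} (σ' τ' : Ty S.toTySig n) (f g : Tm S n) (ρ : DRel S n)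
    (ξ : Fin n → Fin m) (ζ η : ℕ → ℕ) :
    (reindex σ' τ' f g ρ).rename ξ ζ η = reindex (σ'.rename ξ) (τ'.rename ξ) (f.rename ξ ζ)
      (g.rename ξ ζ) (ρ.rename ξ ζ η) := by
  simp only [reindex, rename, Tm.rename, wkTm_two_rename, Tm.app_wk_wk_rename]
  rfl

theorem Ex.eqRel_rename {n m : ℕ} (σ : Ty S.toTySig n) (ξ : Fin n → Fin m) (ζ η : ℕ → ℕ) :
    (eqRel σ).rename ξ ζ η = eqRel (σ.rename ξ) := by
  simp only [eqRel, graph, rename, Tm.rename, Tm.app_wk_wk_rename]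
  rfl

theorem Ex.equiv_rename {n m : ℕ} (σ τ : Ty S.toTySig n) (ρ ρ' : DRel S n) (ξ : Fin n → Fin m)
    (ζ η : ℕ → ℕ) :
    (equiv σ τ ρ ρ').rename ξ ζ η =
      equiv (σ.rename ξ) (τ.rename ξ) (ρ.rename ξ ζ η) (ρ'.rename ξ ζ η) := by
  simp only [equiv, allTm, iff, rename, Tm.rename, wkTm_two_rename]
  rfl

mutual

theorem IsProp.weakening {n : ℕ} {Γ : List (Ty S.toTySig n)} {Θ : List (RelDecl S.toTySig n)}
    {φ : Fml S n} (h : IsProp Ax Γ Θ φ) {m : ℕ} {Γ' : List (Ty S.toTySig m)}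
    {Θ' : List (RelDecl S.toTySig m)} {ξ : Fin n → Fin m} {ζ η : ℕ → ℕ}
    (w : Wk Γ Θ Γ' Θ' ξ ζ η) : IsProp Ax Γ' Θ' (φ.rename ξ ζ η) :=
  match h with
  | .eq ht hs => .eq (w.hasTy ht) (w.hasTy hs)
  | .rapp hρ ht hs => .rapp (hρ.weakening w) (w.hasTy ht) (w.hasTy hs)
  | .imp h₁ h₂ => .imp (h₁.weakening w) (h₂.weakening w)
  | .bot => .bot
  | .top => .top
  | .and h₁ h₂ => .and (h₁.weakening w) (h₂.weakening w)
  | .or h₁ h₂ => .or (h₁.weakening w) (h₂.weakening w)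
  | .qTy q h₁ => .qTy q (h₁.weakening w.liftTy)
  | .qTm q h₁ => .qTm q (h₁.weakening (w.liftTm _))
  | .qRel q h₁ => .qRel q (h₁.weakening (w.liftRel _))

theorem IsRel.weakening {n : ℕ} {Γ : List (Ty S.toTySig n)} {Θ : List (RelDecl S.toTySig n)}
    {ρ : DRel S n} {σ τ : Ty S.toTySig n} (h : IsRel Ax Γ Θ ρ σ τ) {m : ℕ}
    {Γ' : List (Ty S.toTySig m)} {Θ' : List (RelDecl S.toTySig m)} {ξ : Fin n → Fin m}
    {ζ η : ℕ → ℕ} (w : Wk Γ Θ Γ' Θ' ξ ζ η) :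
    IsRel Ax Γ' Θ' (ρ.rename ξ ζ η) (σ.rename ξ) (τ.rename ξ) :=
  match h with
  | .rvar hi => .rvar (w.rel_lookup _ _ hi)
  | .abs h₁ => .abs (h₁.weakening ((w.liftTm _).liftTm _))
  | .ofAdm h₁ => .ofAdm (h₁.weakening w)

theorem IsAdm.weakening {n : ℕ} {Γ : List (Ty S.toTySig n)} {Θ : List (RelDecl S.toTySig n)}
    {ρ : DRel S n} {σ τ : Ty S.toTySig n} (h : IsAdm Ax Γ Θ ρ σ τ) {m : ℕ}
    {Γ' : List (Ty S.toTySig m)} {Θ' : List (RelDecl S.toTySig m)} {ξ : Fin n → Fin m}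
    {ζ η : ℕ → ℕ} (w : Wk Γ Θ Γ' Θ' ξ ζ η) :
    IsAdm Ax Γ' Θ' (ρ.rename ξ ζ η) (σ.rename ξ) (τ.rename ξ) :=
  match h with
  | .rvar hi => .rvar (w.rel_lookup _ _ hi)
  | .eqRel σ => by rw [Ex.eqRel_rename]; exact .eqRel _
  | .reindex h₁ ht hu => by
    rw [Ex.reindex_rename]; exact .reindex (h₁.weakening w) (w.hasTy ht) (w.hasTy hu)
  | .and h₁ h₂ => by
    simp only [Ex.rename, Ex.wkTm_two_rename]; exact .and (h₁.weakening w) (h₂.weakening w)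
  | .op h₁ => by
    simp only [Ex.rename, Ex.wkTm_two_rename]; exact .op (h₁.weakening w)
  | .top σ τ => .top _ _
  | .imp h₁ h₂ => by
    simp only [Ex.rename, Ex.wkTm_two_rename]; exact .imp (h₁.weakening w) (h₂.weakening w)
  | .allTy (σ := σ) (τ := τ) h₁ => by
    have := h₁.weakening w.liftTy
    rw [Ty.wk_rename_liftF, Ty.wk_rename_liftF] at this
    simp only [Ex.rename, Ex.allTy, Ex.wkTm_two_rename]
    exact .allTy this
  | .allTm (ρ := ρ) h₁ => by
    have := h₁.weakening (w.liftTm _)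
    have e : (ρ.rename id (liftN (· + 2)) id).rename ξ (liftN (liftN (liftN ζ))) η =
        (ρ.rename ξ (liftN ζ) η).rename id (liftN (· + 2)) id := by
      rw [Ex.rename_rename, Ex.rename_rename, liftN_comp, liftN_comp]; rfl
    simp only [Ex.rename, Ex.allTm, e]
    exact .allTm this
  | .allRel k h₁ => by
    have := h₁.weakening (w.liftRel _)
    simp only [Ex.rename, Ex.wkTm_two_rename]
    exact .allRel k this
  | .equiv h₁ h₂ h₃ => by
    have := w.prov h₃
    rw [Ex.equiv_rename] at this
    exact .equiv (h₁.weakening w) (h₂.weakening w) this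
  | .interp σ h₁ => by
    rw [Ty.rename_subst, Ty.rename_subst]
    exact .interp σ (fun i => (h₁ i).weakening w)

end

end LAPL

namespace LAPL

universe u

variable {S : Sig.{u}} {Ax : Axioms S}

/-! ### Computing substitutions -/

theorem Tm.wk_subst_single {n : ℕ} (t s : Tm S n) : t.wk.subst Ty.var (single s) = t := wk_inst t s

theorem Tm.wk_subst_pair {n : ℕ} (t s v : Tm S n) : t.wk.wk.subst Ty.var (pair s v) = t := by
  rw [wk, wk, rename_rename, subst_rename]; exact subst_var t

namespace Ex

@[simp] theorem wkTm_zero {s : Srt} {n : ℕ} (e : Ex S s n) : e.wkTm 0 = e := rename_id e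

theorem wkTm_wkTm {s : Srt} {n : ℕ} (e : Ex S s n) (j k : ℕ) :
    (e.wkTm j).wkTm k = e.wkTm (j + k) := by
  rw [wkTm, wkTm, wkTm, rename_rename]
  congr 1
  funext i; exact Nat.add_assoc i j k

theorem wkTm_subst_var {s : Srt} {n : ℕ} (e : Ex S s n) (j k : ℕ) (v : ℕ → Tm S n)
    (hv : ∀ i, v (i + k) = Tm.var (i + j)) : (e.wkTm k).subst Ty.var v rvar = e.wkTm j := by
  rw [wkTm, subst_rename, funext hv]
  exact subst_var_comp e id (· + j) id

theorem wkTm_instTm {n : ℕ} (φ : Fml S n) (t : Tm S n) : (φ.wkTm 1).instTm t = φ :=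
  (wkTm_subst_var φ 0 1 _ (fun _ => rfl)).trans (wkTm_zero φ)

theorem wkTy_instTy {n : ℕ} (φ : Fml S n) (A : Ty S.toTySig n) : φ.wkTy.instTy A = φ := by
  rw [wkTy, instTy, subst_rename]; exact subst_var φ

theorem wkRel_instRel {n : ℕ} (φ : Fml S n) (ρ : DRel S n) : φ.wkRel.instRel ρ = φ := by
  rw [wkRel, instRel, subst_rename]; exact subst_var φ

theorem wkPi_subst {n : ℕ} (ρ T : DRel S n) (A B : Ty S.toTySig n) :
    (wkPi ρ).subst (Ty.pair A B) Tm.var (single T) = ρ := by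
  rw [wkPi, wkRel, wkTy, wkTy, subst_rename, subst_rename, subst_rename]; exact subst_var ρ

theorem wkTm_four_rename {s : Srt} {n m : ℕ} (e : Ex S s n) (ξ : Fin n → Fin m) (ζ η : ℕ → ℕ) :
    (e.wkTm 4).rename ξ (liftN (liftN (liftN (liftN ζ)))) η = (e.rename ξ ζ η).wkTm 4 := by
  rw [wkTm, wkTm, rename_rename, rename_rename]; rfl

theorem wkTm_four_subst {s : Srt} {n m : ℕ} (e : Ex S s n) (θ : Fin n → Ty S.toTySig m)
    (v : ℕ → Tm S m) (r : ℕ → DRel S m) :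
    (e.wkTm 4).subst θ (Tm.up (Tm.up (Tm.up (Tm.up v))))
      (fun i => (((r i).wkTm 2).wkTm 1).wkTm 1) = (e.subst θ v r).wkTm 4 := by
  simp only [wkTm_wkTm]
  rw [wkTm, wkTm, subst_rename, rename_subst]; congr
  · funext i; simp
  · funext i; simp only [Tm.up_succ, Tm.wk, Tm.rename_rename]; rfl

theorem lolliR_rename {n m : ℕ} (σ τ σ' τ' : Ty S.toTySig n) (ρ ρ' : DRel S n) (ξ : Fin n → Fin m)
    (ζ η : ℕ → ℕ) :
    (lolliR σ τ σ' τ' ρ ρ').rename ξ ζ η = lolliR (σ.rename ξ) (τ.rename ξ) (σ'.rename ξ)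
      (τ'.rename ξ) (ρ.rename ξ ζ η) (ρ'.rename ξ ζ η) := by
  simp only [lolliR, allTm, rename, Tm.rename, wkTm_four_rename]; rfl

theorem lolliR_subst {n m : ℕ} (σ τ σ' τ' : Ty S.toTySig n) (ρ ρ' : DRel S n)
    (θ : Fin n → Ty S.toTySig m) (v : ℕ → Tm S m) (r : ℕ → DRel S m) :
    (lolliR σ τ σ' τ' ρ ρ').subst θ v r = lolliR (σ.subst θ) (τ.subst θ) (σ'.subst θ)
      (τ'.subst θ) (ρ.subst θ v r) (ρ'.subst θ v r) := by
  simp only [lolliR, allTm, subst, Tm.subst, wkTm_four_subst]; rfl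

theorem arrowR_rename {n m : ℕ} (σ τ σ' τ' : Ty S.toTySig n) (ρ ρ' : DRel S n) (ξ : Fin n → Fin m)
    (ζ η : ℕ → ℕ) :
    (arrowR σ τ σ' τ' ρ ρ').rename ξ ζ η = arrowR (σ.rename ξ) (τ.rename ξ) (σ'.rename ξ)
      (τ'.rename ξ) (ρ.rename ξ ζ η) (ρ'.rename ξ ζ η) := by
  simp only [arrowR, allTm, rename, Tm.rename, wkTm_four_rename]; rfl

theorem arrowR_subst {n m : ℕ} (σ τ σ' τ' : Ty S.toTySig n) (ρ ρ' : DRel S n)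
    (θ : Fin n → Ty S.toTySig m) (v : ℕ → Tm S m) (r : ℕ → DRel S m) :
    (arrowR σ τ σ' τ' ρ ρ').subst θ v r = arrowR (σ.subst θ) (τ.subst θ) (σ'.subst θ)
      (τ'.subst θ) (ρ.subst θ v r) (ρ'.subst θ v r) := by
  simp only [arrowR, allTm, subst, Tm.subst, wkTm_four_subst]; rfl

end Ex

/-! ### Derived rules -/

variable {n : ℕ} {Γ : List (Ty S.toTySig n)} {Θ : List (RelDecl S.toTySig n)} {Φ : List (Fml S n)}
  {φ ψ : Fml S n} {ρ ρ' T : DRel S n} {σ τ σ' τ' A B : Ty S.toTySig n} {t t' s s' f g : Tm S n}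

theorem HasTy.wkTm (h : HasTy (intCtx Γ) ∅ t σ) (ω : Ty S.toTySig n) :
    HasTy (intCtx (ω :: Γ)) ∅ t.wk σ := HasTy.wk₀ h _

theorem HasTy.wkTy_int (h : HasTy (intCtx Γ) ∅ t σ) :
    HasTy (intCtx (Γ.map Ty.wk)) ∅ t.wkTy σ.wk := by
  rw [intCtx_wk]; exact h.wkTy

theorem IsProp.wkTm (h : IsProp Ax Γ Θ φ) (ω : Ty S.toTySig n) :
    IsProp Ax (ω :: Γ) Θ (φ.wkTm 1) := h.weakening (Wk.tm Γ Θ ω)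

theorem IsRel.wkTm (h : IsRel Ax Γ Θ ρ σ τ) (ω : Ty S.toTySig n) :
    IsRel Ax (ω :: Γ) Θ (ρ.wkTm 1) σ τ := by
  have := h.weakening (Wk.tm Γ Θ ω)
  rwa [Ty.rename_id, Ty.rename_id] at this

theorem IsAdm.wkTm (h : IsAdm Ax Γ Θ ρ σ τ) (ω : Ty S.toTySig n) :
    IsAdm Ax (ω :: Γ) Θ (ρ.wkTm 1) σ τ := by
  have := h.weakening (Wk.tm Γ Θ ω)
  rwa [Ty.rename_id, Ty.rename_id] at this

theorem IsRel.wkTm_two (h : IsRel Ax Γ Θ ρ σ τ) (ω ω' : Ty S.toTySig n) :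
    IsRel Ax (ω :: ω' :: Γ) Θ (ρ.wkTm 2) σ τ := by
  simpa only [Ex.wkTm_wkTm] using (h.wkTm ω').wkTm ω

theorem IsAdm.wkTm_two (h : IsAdm Ax Γ Θ ρ σ τ) (ω ω' : Ty S.toTySig n) :
    IsAdm Ax (ω :: ω' :: Γ) Θ (ρ.wkTm 2) σ τ := by
  simpa only [Ex.wkTm_wkTm] using (h.wkTm ω').wkTm ω

theorem IsRel.wkTm_four (h : IsRel Ax Γ Θ ρ σ τ) (a b c d : Ty S.toTySig n) :
    IsRel Ax (a :: b :: c :: d :: Γ) Θ (ρ.wkTm 4) σ τ := by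
  simpa only [Ex.wkTm_wkTm] using (h.wkTm_two c d).wkTm_two a b

theorem IsRel.wkPi (h : IsRel Ax Γ Θ ρ σ τ) (d : RelDecl S.toTySig (n + 2)) :
    IsRel Ax ((Γ.map Ty.wk).map Ty.wk) (d :: (Θ.map RelDecl.wk).map RelDecl.wk) (Ex.wkPi ρ)
      σ.wk.wk τ.wk.wk := by
  have := ((h.weakening (Wk.ty _ _)).weakening (Wk.ty _ _)).weakening (Wk.rel _ _ d)
  rwa [Ty.rename_id, Ty.rename_id] at this

theorem IsAdm.wkPi (h : IsAdm Ax Γ Θ ρ σ τ) (d : RelDecl S.toTySig (n + 2)) :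
    IsAdm Ax ((Γ.map Ty.wk).map Ty.wk) (d :: (Θ.map RelDecl.wk).map RelDecl.wk) (Ex.wkPi ρ)
      σ.wk.wk τ.wk.wk := by
  have := ((h.weakening (Wk.ty _ _)).weakening (Wk.ty _ _)).weakening (Wk.rel _ _ d)
  rwa [Ty.rename_id, Ty.rename_id] at this

/-- All members of a list of hypotheses are propositions in context. -/
def AllProp (Ax : Axioms S) (Γ : List (Ty S.toTySig n)) (Θ : List (RelDecl S.toTySig n))
    (Φ : List (Fml S n)) : Prop := ∀ ψ ∈ Φ, IsProp Ax Γ Θ ψ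

namespace AllProp

theorem nil : AllProp Ax Γ Θ [] := fun _ h => by cases h

theorem cons (hφ : IsProp Ax Γ Θ φ) (h : AllProp Ax Γ Θ Φ) : AllProp Ax Γ Θ (φ :: Φ) := by
  intro ψ hψ
  rcases List.mem_cons.1 hψ with rfl | hψ
  · exact hφ
  · exact h ψ hψ

theorem wkTm (h : AllProp Ax Γ Θ Φ) (ω : Ty S.toTySig n) :
    AllProp Ax (ω :: Γ) Θ (Φ.map (Ex.wkTm 1)) := by
  intro ψ hψ
  obtain ⟨χ, hχ, rfl⟩ := List.mem_map.1 hψ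
  exact (h χ hχ).wkTm ω

theorem wkTy (h : AllProp Ax Γ Θ Φ) :
    AllProp Ax (Γ.map Ty.wk) (Θ.map RelDecl.wk) (Φ.map Ex.wkTy) := by
  intro ψ hψ
  obtain ⟨χ, hχ, rfl⟩ := List.mem_map.1 hψ
  exact (h χ hχ).weakening (Wk.ty _ _)

theorem wkRel (h : AllProp Ax Γ Θ Φ) (d : RelDecl S.toTySig n) :
    AllProp Ax Γ (d :: Θ) (Φ.map Ex.wkRel) := by
  intro ψ hψ
  obtain ⟨χ, hχ, rfl⟩ := List.mem_map.1 hψ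
  exact (h χ hχ).weakening (Wk.rel _ _ d)

end AllProp

/-- `φ` under the hypotheses `Φ`, as an iterated implication. -/
def Ex.imps : List (Fml S n) → Fml S n → Fml S n
  | [], φ => φ
  | ψ :: Φ, φ => Ex.imps Φ (Ex.imp ψ φ)

theorem Ex.imps_subst {m : ℕ} (Φ : List (Fml S n)) (φ : Fml S n) (θ : Fin n → Ty S.toTySig m)
    (v : ℕ → Tm S m) (r : ℕ → DRel S m) :
    (Ex.imps Φ φ).subst θ v r = Ex.imps (Φ.map (fun ψ => ψ.subst θ v r)) (φ.subst θ v r) := by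
  induction Φ generalizing φ with
  | nil => rfl
  | cons ψ Φ ih => simp only [imps, ih, subst, List.map]

namespace Prov

theorem of_nil (hΦ : AllProp Ax Γ Θ Φ) (h : Prov Ax Γ Θ [] φ) : Prov Ax Γ Θ Φ φ :=
  weaken hΦ (List.nil_subset _) h

theorem imps (h : Prov Ax Γ Θ Φ φ) : Prov Ax Γ Θ [] (Ex.imps Φ φ) := by
  induction Φ generalizing φ with
  | nil => exact h
  | cons ψ Φ ih => exact ih h.impI

theorem of_imps (hΦ : AllProp Ax Γ Θ Φ) (h : Prov Ax Γ Θ [] (Ex.imps Φ φ)) : Prov Ax Γ Θ Φ φ := by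
  induction Φ generalizing φ with
  | nil => exact h
  | cons ψ Φ ih =>
    have h₁ := ih (fun χ hχ => hΦ χ (List.mem_cons_of_mem _ hχ)) h
    exact (weaken hΦ (List.subset_cons_self _ _) h₁).impE (hyp hΦ List.mem_cons_self)

theorem mp (hΦ : AllProp Ax Γ Θ Φ) (h : Prov Ax Γ Θ [] (Ex.imp φ ψ)) (h' : Prov Ax Γ Θ Φ φ) :
    Prov Ax Γ Θ Φ ψ := (of_nil hΦ h).impE h'

theorem iff_mp (hΦ : AllProp Ax Γ Θ Φ) (h : Prov Ax Γ Θ [] (Ex.iff φ ψ))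
    (h' : Prov Ax Γ Θ Φ φ) : Prov Ax Γ Θ Φ ψ := mp hΦ h.andE₁ h'

theorem iff_mpr (hΦ : AllProp Ax Γ Θ Φ) (h : Prov Ax Γ Θ [] (Ex.iff φ ψ))
    (h' : Prov Ax Γ Θ Φ ψ) : Prov Ax Γ Θ Φ φ := mp hΦ h.andE₂ h'

theorem allTm_elim (hΦ : AllProp Ax Γ Θ Φ) (h : Prov Ax Γ Θ Φ (Ex.allTm σ ψ))
    (ht : HasTy (intCtx Γ) ∅ t σ) : Prov Ax Γ Θ Φ (ψ.instTm t) := by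
  have h₁ := substTm (imps (allTmE h)) ht
  rw [Ex.instTm, Ex.imps_subst, List.map_map] at h₁
  have e : (fun χ : Fml S n => χ.subst Ty.var (Tm.single t) Ex.rvar) ∘ Ex.wkTm 1 = id :=
    funext (fun χ => Ex.wkTm_instTm χ t)
  rw [e, List.map_id] at h₁
  exact of_imps hΦ h₁

theorem allAdm_elim (hΦ : AllProp Ax Γ Θ Φ)
    (h : Prov Ax Γ Θ Φ (Ex.allAdm σ τ ψ)) (hT : IsAdm Ax Γ Θ T σ τ) :
    Prov Ax Γ Θ Φ (ψ.instRel T) := by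
  have h₁ := substAdm (imps (allRelE h)) hT
  rw [Ex.instRel, Ex.imps_subst, List.map_map] at h₁
  have e : (fun χ : Fml S n => χ.subst Ty.var Tm.var (Ex.single T)) ∘ Ex.wkRel = id :=
    funext (fun χ => Ex.wkRel_instRel χ T)
  rw [e, List.map_id] at h₁
  exact of_imps hΦ h₁

theorem allTy_elim {ψ : Fml S (n + 1)} (hΦ : AllProp Ax Γ Θ Φ)
    (h : Prov Ax Γ Θ Φ (Ex.allTy ψ)) (A : Ty S.toTySig n) :
    Prov Ax Γ Θ Φ (ψ.instTy A) := by
  have h₁ := substTy A (imps (allTyE h))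
  rw [Ex.instTy, Ex.imps_subst, List.map_map, List.map_map, List.map_map] at h₁
  have e : (fun χ : Fml S (n + 1) => χ.subst (Ty.single A) Tm.var Ex.rvar) ∘ Ex.wkTy = id :=
    funext (fun χ => Ex.wkTy_instTy χ A)
  have e₁ : (fun τ : Ty S.toTySig (n + 1) => τ.inst A) ∘ Ty.wk = id :=
    funext (fun τ => Ty.wk_inst τ A)
  have e₂ : (fun d : RelDecl S.toTySig (n + 1) => d.subst (Ty.single A)) ∘ RelDecl.wk = id := by
    funext d; simp [RelDecl.subst, RelDecl.wk]
  rw [e, e₁, e₂, List.map_id, List.map_id, List.map_id] at h₁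
  exact of_imps hΦ h₁

theorem eq_refl (hΦ : AllProp Ax Γ Θ Φ) (ht : HasTy (intCtx Γ) ∅ t σ) :
    Prov Ax Γ Θ Φ (Ex.eq σ t t) := of_nil hΦ (extEq (ExtEq.refl ht))

theorem of_conv (hΦ : AllProp Ax Γ Θ Φ) (h : Conv (intCtx Γ) ∅ t s σ) :
    Prov Ax Γ Θ Φ (Ex.eq σ t s) := of_nil hΦ (extEq h.ext)

theorem rapp_eq (hΦ : AllProp Ax Γ Θ Φ) (hρ : IsRel Ax Γ Θ ρ σ τ)
    (ht : HasTy (intCtx Γ) ∅ t σ) (ht' : HasTy (intCtx Γ) ∅ t' σ)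
    (hs : HasTy (intCtx Γ) ∅ s τ) (hs' : HasTy (intCtx Γ) ∅ s' τ)
    (h : Prov Ax Γ Θ Φ (Ex.rapp ρ t s)) (h₁ : Prov Ax Γ Θ Φ (Ex.eq σ t t'))
    (h₂ : Prov Ax Γ Θ Φ (Ex.eq τ s s')) : Prov Ax Γ Θ Φ (Ex.rapp ρ t' s') :=
  mp hΦ (eqSubst hρ ht ht' hs hs') (h.andI (h₁.andI h₂))

theorem rapp_conv (hΦ : AllProp Ax Γ Θ Φ) (hρ : IsRel Ax Γ Θ ρ σ τ)
    (h : Prov Ax Γ Θ Φ (Ex.rapp ρ t s)) (h₁ : Conv (intCtx Γ) ∅ t t' σ)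
    (h₂ : Conv (intCtx Γ) ∅ s s' τ) : Prov Ax Γ Θ Φ (Ex.rapp ρ t' s') :=
  rapp_eq hΦ hρ h₁.left h₁.right h₂.left h₂.right h (of_conv hΦ h₁) (of_conv hΦ h₂)

theorem equiv_iff (h : Prov Ax Γ Θ [] (Ex.equiv σ τ ρ ρ'))
    (ht : HasTy (intCtx Γ) ∅ t σ) (hs : HasTy (intCtx Γ) ∅ s τ) :
    Prov Ax Γ Θ [] (Ex.iff (Ex.rapp ρ t s) (Ex.rapp ρ' t s)) := by
  have h₁ := allTm_elim AllProp.nil h ht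
  rw [Ex.instTm] at h₁
  have h₂ := allTm_elim (Ax := Ax) (Θ := Θ) (σ := τ) (ψ := Ex.iff (Ex.rapp (ρ.wkTm 1) t.wk (Tm.var 0))
    (Ex.rapp (ρ'.wkTm 1) t.wk (Tm.var 0))) AllProp.nil ?_ hs
  · have e := fun ρ : DRel S n => Ex.wkTm_subst_var ρ 0 1 (Tm.single s) (fun _ => rfl)
    simp only [Ex.instTm, Ex.iff, Ex.subst, Tm.subst, e, Ex.wkTm_zero, Tm.wk_subst_single] at h₂
    exact h₂
  · have e := fun ρ : DRel S n => Ex.wkTm_subst_var ρ 1 2 (Tm.up (Tm.single t)) (fun _ => rfl)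
    simp only [Ex.allTm, Ex.iff, Ex.subst, Tm.subst, e, Ty.subst_var, Ex.wkTm_rvar] at h₁
    exact h₁

theorem equiv_mp (hΦ : AllProp Ax Γ Θ Φ) (h : Prov Ax Γ Θ [] (Ex.equiv σ τ ρ ρ'))
    (ht : HasTy (intCtx Γ) ∅ t σ) (hs : HasTy (intCtx Γ) ∅ s τ)
    (h' : Prov Ax Γ Θ Φ (Ex.rapp ρ t s)) : Prov Ax Γ Θ Φ (Ex.rapp ρ' t s) :=
  iff_mp hΦ (equiv_iff h ht hs) h'

theorem equiv_mpr (hΦ : AllProp Ax Γ Θ Φ) (h : Prov Ax Γ Θ [] (Ex.equiv σ τ ρ ρ'))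
    (ht : HasTy (intCtx Γ) ∅ t σ) (hs : HasTy (intCtx Γ) ∅ s τ)
    (h' : Prov Ax Γ Θ Φ (Ex.rapp ρ' t s)) : Prov Ax Γ Θ Φ (Ex.rapp ρ t s) :=
  iff_mpr hΦ (equiv_iff h ht hs) h'

end Prov

/-! ### Equality and reindexing -/

theorem reindex_iff (hρ : IsRel Ax Γ Θ ρ σ τ) (hf : HasTy (intCtx Γ) ∅ f (Ty.lolli σ' σ))
    (hg : HasTy (intCtx Γ) ∅ g (Ty.lolli τ' τ)) (ht : HasTy (intCtx Γ) ∅ t σ')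
    (hs : HasTy (intCtx Γ) ∅ s τ') :
    Prov Ax Γ Θ [] (Ex.iff (Ex.rapp (Ex.reindex σ' τ' f g ρ) t s)
      (Ex.rapp ρ (Tm.app f t) (Tm.app g s))) := by
  have hP : IsProp Ax (τ' :: σ' :: Γ) Θ (Ex.rapp (ρ.wkTm 2) (Tm.app f.wk.wk (Tm.var 1))
      (Tm.app g.wk.wk (Tm.var 0))) :=
    IsProp.rapp (hρ.wkTm_two _ _) (((hf.wkTm _).wkTm _).app₀ (HasTy.ivar rfl))
      (((hg.wkTm _).wkTm _).app₀ (HasTy.ivar rfl))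
  have := Prov.defRel hP ht hs
  have e := Ex.wkTm_subst_var ρ 0 2 (Tm.pair t s) (fun _ => rfl)
  simp only [Ex.instTm₂, Ex.subst, Tm.subst, e, Ex.wkTm_zero, Tm.wk_subst_pair, Tm.pair_zero,
    Tm.pair_one] at this
  exact this

theorem eqRel_iff (ht : HasTy (intCtx Γ) ∅ t σ) (hs : HasTy (intCtx Γ) ∅ s σ) :
    Prov Ax Γ Θ [] (Ex.iff (Ex.rapp (Ex.eqRel σ) t s) (Ex.eq σ (Tm.app (Tm.idm σ) t) s)) := by
  have hP : IsProp Ax (σ :: σ :: Γ) Θ (Ex.eq σ (Tm.app (Tm.idm σ).wk.wk (Tm.var 1))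
      (Tm.var 0)) :=
    IsProp.eq ((((HasTy.idm σ).wkTm _).wkTm _).app₀ (HasTy.ivar rfl)) (HasTy.ivar rfl)
  have := Prov.defRel (Θ := Θ) hP ht hs
  simp only [Ex.instTm₂, Ex.subst, Tm.subst, Tm.wk_subst_pair, Tm.pair_zero,
    Tm.pair_one, Ty.subst_var] at this
  exact this

theorem eqRel_intro (hΦ : AllProp Ax Γ Θ Φ) (ht : HasTy (intCtx Γ) ∅ t σ)
    (hs : HasTy (intCtx Γ) ∅ s σ) (h : Prov Ax Γ Θ Φ (Ex.eq σ t s)) :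
    Prov Ax Γ Θ Φ (Ex.rapp (Ex.eqRel σ) t s) :=
  Prov.iff_mpr hΦ (eqRel_iff ht hs) ((Prov.of_conv hΦ (Conv.idm ht)).eqTrans h)

theorem eqRel_elim (hΦ : AllProp Ax Γ Θ Φ) (ht : HasTy (intCtx Γ) ∅ t σ)
    (hs : HasTy (intCtx Γ) ∅ s σ) (h : Prov Ax Γ Θ Φ (Ex.rapp (Ex.eqRel σ) t s)) :
    Prov Ax Γ Θ Φ (Ex.eq σ t s) :=
  (Prov.of_conv hΦ (Conv.idm ht).symm).eqTrans (Prov.iff_mp hΦ (eqRel_iff ht hs) h)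

/-- Application preserves internal equality. -/
theorem eq_app (hΦ : AllProp Ax Γ Θ Φ) (hf : HasTy (intCtx Γ) ∅ f (Ty.lolli σ τ))
    (ht : HasTy (intCtx Γ) ∅ t σ) (hs : HasTy (intCtx Γ) ∅ s σ)
    (h : Prov Ax Γ Θ Φ (Ex.eq σ t s)) :
    Prov Ax Γ Θ Φ (Ex.eq τ (Tm.app f t) (Tm.app f s)) := by
  have hr : IsAdm Ax Γ Θ (Ex.reindex σ σ f f (Ex.eqRel τ)) σ σ := .reindex (.eqRel τ) hf hf
  have hi := fun {s : Tm S n} (hs : HasTy (intCtx Γ) ∅ s σ) =>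
    reindex_iff (.ofAdm (.eqRel (Ax := Ax) (Θ := Θ) τ)) hf hf ht hs
  have h₁ := Prov.iff_mpr hΦ (hi ht)
    (eqRel_intro hΦ (hf.app₀ ht) (hf.app₀ ht) (Prov.eq_refl hΦ (hf.app₀ ht)))
  have h₂ := Prov.rapp_eq hΦ (.ofAdm hr) ht ht ht hs h₁ (Prov.eq_refl hΦ ht) h
  exact eqRel_elim hΦ (hf.app₀ ht) (hf.app₀ hs) (Prov.iff_mp hΦ (hi hs) h₂)

end LAPL

namespace LAPL

universe u

variable {S : Sig.{u}} {Ax : Axioms S}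

variable {n : ℕ} {Γ : List (Ty S.toTySig n)} {Θ : List (RelDecl S.toTySig n)} {Φ : List (Fml S n)}
  {φ ψ : Fml S n} {ρ ρ' T : DRel S n} {σ τ σ' τ' A B : Ty S.toTySig n} {a b t t' s s' f g : Tm S n}

/-! ### Rules for the constructions on relations -/

theorem Prov.of_eq (h : Prov Ax Γ Θ Φ φ) (e : φ = ψ) : Prov Ax Γ Θ Φ ψ := e ▸ h

theorem isProp_lolli_body (hρ : IsRel Ax Γ Θ ρ σ τ) (hρ' : IsRel Ax Γ Θ ρ' σ' τ') :
    IsProp Ax (Ty.lolli τ τ' :: Ty.lolli σ σ' :: Γ) Θ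
      (Ex.allTm σ (Ex.allTm τ (Ex.imp (Ex.rapp (ρ.wkTm 4) (Tm.var 1) (Tm.var 0))
        (Ex.rapp (ρ'.wkTm 4) (Tm.app (Tm.var 3) (Tm.var 1)) (Tm.app (Tm.var 2) (Tm.var 0)))))) :=
  .qTm _ (.qTm _ (.imp (.rapp (hρ.wkTm_four _ _ _ _) (.ivar rfl) (.ivar rfl))
    (.rapp (hρ'.wkTm_four _ _ _ _)
      (HasTy.app₀ (HasTy.ivar (i := 3) rfl) (.ivar (i := 1) rfl))
      (HasTy.app₀ (HasTy.ivar (i := 2) rfl) (.ivar (i := 0) rfl)))))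

theorem isProp_arrow_body (hρ : IsRel Ax Γ Θ ρ σ τ) (hρ' : IsRel Ax Γ Θ ρ' σ' τ') :
    IsProp Ax (Ty.arrow τ τ' :: Ty.arrow σ σ' :: Γ) Θ
      (Ex.allTm σ (Ex.allTm τ (Ex.imp (Ex.rapp (ρ.wkTm 4) (Tm.var 1) (Tm.var 0))
        (Ex.rapp (ρ'.wkTm 4) (Tm.app (Tm.var 3) (Tm.bang (Tm.var 1)))
          (Tm.app (Tm.var 2) (Tm.bang (Tm.var 0))))))) :=
  .qTm _ (.qTm _ (.imp (.rapp (hρ.wkTm_four _ _ _ _) (.ivar rfl) (.ivar rfl))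
    (.rapp (hρ'.wkTm_four _ _ _ _)
      (HasTy.app_bang (HasTy.ivar (i := 3) rfl) (.ivar (i := 1) rfl))
      (HasTy.app_bang (HasTy.ivar (i := 2) rfl) (.ivar (i := 0) rfl)))))

theorem isRel_lolliR (hρ : IsRel Ax Γ Θ ρ σ τ) (hρ' : IsRel Ax Γ Θ ρ' σ' τ') :
    IsRel Ax Γ Θ (Ex.lolliR σ τ σ' τ' ρ ρ') (Ty.lolli σ σ') (Ty.lolli τ τ') :=
  .abs (isProp_lolli_body hρ hρ')

theorem isRel_arrowR (hρ : IsRel Ax Γ Θ ρ σ τ) (hρ' : IsRel Ax Γ Θ ρ' σ' τ') :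
    IsRel Ax Γ Θ (Ex.arrowR σ τ σ' τ' ρ ρ') (Ty.arrow σ σ') (Ty.arrow τ τ') :=
  .abs (isProp_arrow_body hρ hρ')

theorem lolliR_iff (hρ : IsRel Ax Γ Θ ρ σ τ) (hρ' : IsRel Ax Γ Θ ρ' σ' τ')
    (hf : HasTy (intCtx Γ) ∅ f (Ty.lolli σ σ')) (hg : HasTy (intCtx Γ) ∅ g (Ty.lolli τ τ')) :
    Prov Ax Γ Θ [] (Ex.iff (Ex.rapp (Ex.lolliR σ τ σ' τ' ρ ρ') f g)
      (Ex.allTm σ (Ex.allTm τ (Ex.imp (Ex.rapp (ρ.wkTm 2) (Tm.var 1) (Tm.var 0))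
        (Ex.rapp (ρ'.wkTm 2) (Tm.app f.wk.wk (Tm.var 1)) (Tm.app g.wk.wk (Tm.var 0))))))) := by
  have := Prov.defRel (isProp_lolli_body hρ hρ') hf hg
  have e := fun ρ : DRel S n =>
    Ex.wkTm_subst_var ρ 2 4 (Tm.up (Tm.up (Tm.pair f g))) (fun _ => rfl)
  simp only [Ex.instTm₂, Ex.allTm, Ex.subst, Tm.subst, e, Ty.subst_var, Ex.wkTm_rvar] at this
  exact this

theorem arrowR_iff (hρ : IsRel Ax Γ Θ ρ σ τ) (hρ' : IsRel Ax Γ Θ ρ' σ' τ')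
    (hf : HasTy (intCtx Γ) ∅ f (Ty.arrow σ σ')) (hg : HasTy (intCtx Γ) ∅ g (Ty.arrow τ τ')) :
    Prov Ax Γ Θ [] (Ex.iff (Ex.rapp (Ex.arrowR σ τ σ' τ' ρ ρ') f g)
      (Ex.allTm σ (Ex.allTm τ (Ex.imp (Ex.rapp (ρ.wkTm 2) (Tm.var 1) (Tm.var 0))
        (Ex.rapp (ρ'.wkTm 2) (Tm.app f.wk.wk (Tm.bang (Tm.var 1)))
          (Tm.app g.wk.wk (Tm.bang (Tm.var 0)))))))) := by
  have := Prov.defRel (isProp_arrow_body hρ hρ') hf hg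
  have e := fun ρ : DRel S n =>
    Ex.wkTm_subst_var ρ 2 4 (Tm.up (Tm.up (Tm.pair f g))) (fun _ => rfl)
  simp only [Ex.instTm₂, Ex.allTm, Ex.subst, Tm.subst, e, Ty.subst_var, Ex.wkTm_rvar] at this
  exact this

theorem Prov.allTm_elim₂ {φ : Fml S n} (hΦ : AllProp Ax Γ Θ Φ)
    (h : Prov Ax Γ Θ Φ (Ex.allTm σ (Ex.allTm τ φ)))
    (ha : HasTy (intCtx Γ) ∅ a σ) (hb : HasTy (intCtx Γ) ∅ b τ) :
    Prov Ax Γ Θ Φ (φ.instTm₂ a b) := by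
  have h₁ := Prov.allTm_elim hΦ h ha
  rw [Ex.instTm, Ex.allTm, Ex.subst, Ty.subst_var] at h₁
  have h₂ := Prov.allTm_elim hΦ h₁ hb
  rw [Ex.instTm, Ex.subst_subst] at h₂
  have e : (fun i => (Tm.up (Tm.single a) i).subst Ty.var (Tm.single b)) = Tm.pair a b := by
    funext i
    match i with
    | 0 => rfl
    | 1 => exact Tm.wk_subst_single a b
    | i + 2 => rfl
  rw [e] at h₂
  exact h₂

theorem lolliR_elim (hΦ : AllProp Ax Γ Θ Φ) (hρ : IsRel Ax Γ Θ ρ σ τ)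
    (hρ' : IsRel Ax Γ Θ ρ' σ' τ') (hf : HasTy (intCtx Γ) ∅ f (Ty.lolli σ σ'))
    (hg : HasTy (intCtx Γ) ∅ g (Ty.lolli τ τ'))
    (h : Prov Ax Γ Θ Φ (Ex.rapp (Ex.lolliR σ τ σ' τ' ρ ρ') f g))
    (ha : HasTy (intCtx Γ) ∅ a σ) (hb : HasTy (intCtx Γ) ∅ b τ)
    (hab : Prov Ax Γ Θ Φ (Ex.rapp ρ a b)) :
    Prov Ax Γ Θ Φ (Ex.rapp ρ' (Tm.app f a) (Tm.app g b)) := by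
  have := Prov.allTm_elim₂ hΦ (Prov.iff_mp hΦ (lolliR_iff hρ hρ' hf hg) h) ha hb
  have e := fun ρ : DRel S n => Ex.wkTm_subst_var ρ 0 2 (Tm.pair a b) (fun _ => rfl)
  simp only [Ex.instTm₂, Ex.subst, Tm.subst, e, Ex.wkTm_zero, Tm.wk_subst_pair, Tm.pair_zero,
    Tm.pair_one] at this
  exact this.impE hab

theorem arrowR_elim (hΦ : AllProp Ax Γ Θ Φ) (hρ : IsRel Ax Γ Θ ρ σ τ)
    (hρ' : IsRel Ax Γ Θ ρ' σ' τ') (hf : HasTy (intCtx Γ) ∅ f (Ty.arrow σ σ'))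
    (hg : HasTy (intCtx Γ) ∅ g (Ty.arrow τ τ'))
    (h : Prov Ax Γ Θ Φ (Ex.rapp (Ex.arrowR σ τ σ' τ' ρ ρ') f g))
    (ha : HasTy (intCtx Γ) ∅ a σ) (hb : HasTy (intCtx Γ) ∅ b τ)
    (hab : Prov Ax Γ Θ Φ (Ex.rapp ρ a b)) :
    Prov Ax Γ Θ Φ (Ex.rapp ρ' (Tm.app f (Tm.bang a)) (Tm.app g (Tm.bang b))) := by
  have := Prov.allTm_elim₂ hΦ (Prov.iff_mp hΦ (arrowR_iff hρ hρ' hf hg) h) ha hb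
  have e := fun ρ : DRel S n => Ex.wkTm_subst_var ρ 0 2 (Tm.pair a b) (fun _ => rfl)
  simp only [Ex.instTm₂, Ex.subst, Tm.subst, e, Ex.wkTm_zero, Tm.wk_subst_pair, Tm.pair_zero,
    Tm.pair_one] at this
  exact this.impE hab

theorem Prov.allTm_intro₂ {φ : Fml S n}
    (h : Prov Ax (τ :: σ :: Γ) Θ (Φ.map (Ex.wkTm 2)) φ) :
    Prov Ax Γ Θ Φ (Ex.allTm σ (Ex.allTm τ φ)) := by
  refine Prov.allTmI (Prov.allTmI ?_)
  rw [List.map_map]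
  have e : Ex.wkTm 1 ∘ Ex.wkTm 1 = (Ex.wkTm 2 : Fml S n → Fml S n) := by
    funext φ; exact Ex.wkTm_wkTm φ 1 1
  rwa [e]

theorem AllProp.wkTm_two (h : AllProp Ax Γ Θ Φ) (ω ω' : Ty S.toTySig n) :
    AllProp Ax (ω :: ω' :: Γ) Θ (Φ.map (Ex.wkTm 2)) := by
  have := (h.wkTm ω').wkTm ω
  rw [List.map_map] at this
  have e : Ex.wkTm 1 ∘ Ex.wkTm 1 = (Ex.wkTm 2 : Fml S n → Fml S n) := by
    funext φ; exact Ex.wkTm_wkTm φ 1 1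
  rwa [e] at this

theorem AllProp.binary (h : AllProp Ax Γ Θ Φ) (hρ : IsRel Ax Γ Θ ρ σ τ) :
    AllProp Ax (τ :: σ :: Γ) Θ
      (Ex.rapp (ρ.wkTm 2) (Tm.var 1) (Tm.var 0) :: Φ.map (Ex.wkTm 2)) :=
  (h.wkTm_two _ _).cons (.rapp (hρ.wkTm_two _ _) (.ivar rfl) (.ivar rfl))

theorem lolliR_intro (hΦ : AllProp Ax Γ Θ Φ) (hρ : IsRel Ax Γ Θ ρ σ τ)
    (hρ' : IsRel Ax Γ Θ ρ' σ' τ') (hf : HasTy (intCtx Γ) ∅ f (Ty.lolli σ σ'))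
    (hg : HasTy (intCtx Γ) ∅ g (Ty.lolli τ τ'))
    (h : Prov Ax (τ :: σ :: Γ) Θ (Ex.rapp (ρ.wkTm 2) (Tm.var 1) (Tm.var 0) :: Φ.map (Ex.wkTm 2))
      (Ex.rapp (ρ'.wkTm 2) (Tm.app f.wk.wk (Tm.var 1)) (Tm.app g.wk.wk (Tm.var 0)))) :
    Prov Ax Γ Θ Φ (Ex.rapp (Ex.lolliR σ τ σ' τ' ρ ρ') f g) :=
  Prov.iff_mpr hΦ (lolliR_iff hρ hρ' hf hg) (Prov.allTm_intro₂ h.impI)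

theorem arrowR_intro (hΦ : AllProp Ax Γ Θ Φ) (hρ : IsRel Ax Γ Θ ρ σ τ)
    (hρ' : IsRel Ax Γ Θ ρ' σ' τ') (hf : HasTy (intCtx Γ) ∅ f (Ty.arrow σ σ'))
    (hg : HasTy (intCtx Γ) ∅ g (Ty.arrow τ τ'))
    (h : Prov Ax (τ :: σ :: Γ) Θ (Ex.rapp (ρ.wkTm 2) (Tm.var 1) (Tm.var 0) :: Φ.map (Ex.wkTm 2))
      (Ex.rapp (ρ'.wkTm 2) (Tm.app f.wk.wk (Tm.bang (Tm.var 1)))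
        (Tm.app g.wk.wk (Tm.bang (Tm.var 0))))) :
    Prov Ax Γ Θ Φ (Ex.rapp (Ex.arrowR σ τ σ' τ' ρ ρ') f g) :=
  Prov.iff_mpr hΦ (arrowR_iff hρ hρ' hf hg) (Prov.allTm_intro₂ h.impI)

/-! ### Polymorphic relations -/

/-- The context of `∀(α, β, R : Adm(α, β))`. -/
abbrev piRels (Θ : List (RelDecl S.toTySig n)) : List (RelDecl S.toTySig (n + 2)) :=
  ⟨RelKind.adm, Ty.var 1, Ty.var 0⟩ :: (Θ.map RelDecl.wk).map RelDecl.wk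

/-- The context of `∀(α, β, R : Adm(α, β))`. -/
abbrev piTys (Γ : List (Ty S.toTySig n)) : List (Ty S.toTySig (n + 2)) :=
  (Γ.map Ty.wk).map Ty.wk

theorem Prov.allPi_elim {φ : Fml S (n + 2)} (hΦ : AllProp Ax Γ Θ Φ)
    (h : Prov Ax Γ Θ Φ (Ex.allTy (Ex.allTy (Ex.allAdm (Ty.var 1) (Ty.var 0) φ))))
    (hT : IsAdm Ax Γ Θ T A B) :
    Prov Ax Γ Θ Φ (φ.subst (Ty.pair A B) Tm.var (Ex.single T)) := by
  have h₁ := Prov.allTy_elim hΦ h A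
  rw [Ex.instTy, Ex.allTy, Ex.subst] at h₁
  have h₂ := Prov.allTy_elim hΦ h₁ B
  rw [Ex.instTy, Ex.subst_subst, Ty.up_single_subst_single] at h₂
  have h₃ := Prov.allAdm_elim hΦ h₂ hT
  rw [Ex.instRel, Ex.subst_subst] at h₃
  simp only [Ty.subst_var] at h₃
  convert h₃ using 2
  · funext i; rfl
  · funext i; cases i <;> rfl

theorem AllProp.wkPi (h : AllProp Ax Γ Θ Φ) :
    AllProp Ax (piTys Γ) (piRels Θ) (((Φ.map Ex.wkTy).map Ex.wkTy).map Ex.wkRel) :=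
  h.wkTy.wkTy.wkRel _

/-- The type of the instance at the type variable `a` of a weakened polymorphic function. -/
def Ty.atPi {T : TySig.{u}} {n : ℕ} (σ : Ty T (n + 1)) (a : Fin (n + 2)) : Ty T (n + 2) :=
  σ.subst (Fin.cases (Ty.var a) (fun i => Ty.var i.succ.succ))

theorem HasTy.tapp_atPi {G : List (TmDecl S.toTySig (n + 2))} {L : Finset ℕ}
    {t : Tm S (n + 2)} {σ : Ty S.toTySig (n + 1)} (h : HasTy G L t (Ty.pi σ).wk.wk)
    (a : Fin (n + 2)) : HasTy G L (Tm.tapp t (Ty.var a)) (σ.atPi a) := by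
  have := HasTy.tapp (Ty.var a) h
  rw [Ty.inst, Ty.rename_rename, Ty.subst_rename] at this
  convert this using 2
  rw [Ty.atPi]
  congr
  funext i
  cases i using Fin.cases <;> rfl

theorem isProp_pi_body {ρ : DRel S (n + 2)} {σ τ : Ty S.toTySig (n + 1)}
    (hρ : IsRel Ax (piTys Γ) (piRels Θ) ρ (σ.atPi 1) (τ.atPi 0)) :
    IsProp Ax (Ty.pi τ :: Ty.pi σ :: Γ) Θ
      (Ex.allTy (Ex.allTy (Ex.allAdm (Ty.var 1) (Ty.var 0)
      (Ex.rapp (ρ.wkTm 2) (Tm.tapp (Tm.var 1) (Ty.var 1)) (Tm.tapp (Tm.var 0) (Ty.var 0)))))) :=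
  .qTy _ (.qTy _ (.qRel _ (.rapp (hρ.wkTm_two _ _)
    (HasTy.tapp_atPi (HasTy.ivar (i := 1) rfl) 1) (HasTy.tapp_atPi (HasTy.ivar (i := 0) rfl) 0))))

theorem isRel_piR {ρ : DRel S (n + 2)} {σ τ : Ty S.toTySig (n + 1)}
    (hρ : IsRel Ax (piTys Γ) (piRels Θ) ρ (σ.atPi 1) (τ.atPi 0)) :
    IsRel Ax Γ Θ (Ex.piR σ τ ρ) (Ty.pi σ) (Ty.pi τ) :=
  .abs (isProp_pi_body hρ)

theorem piR_iff {ρ : DRel S (n + 2)} {σ τ : Ty S.toTySig (n + 1)}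
    (hρ : IsRel Ax (piTys Γ) (piRels Θ) ρ (σ.atPi 1) (τ.atPi 0))
    (hf : HasTy (intCtx Γ) ∅ f (Ty.pi σ)) (hg : HasTy (intCtx Γ) ∅ g (Ty.pi τ)) :
    Prov Ax Γ Θ [] (Ex.iff (Ex.rapp (Ex.piR σ τ ρ) f g)
      (Ex.allTy (Ex.allTy (Ex.allAdm (Ty.var 1) (Ty.var 0)
        (Ex.rapp ρ (Tm.tapp f.wkTy.wkTy (Ty.var 1)) (Tm.tapp g.wkTy.wkTy (Ty.var 0))))))) := by
  have := Prov.defRel (isProp_pi_body hρ) hf hg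
  have e := Ex.wkTm_subst_var ρ 0 2 (fun i => (Tm.pair f g i).wkTy.wkTy) (fun _ => rfl)
  simp only [Ex.instTm₂, Ex.allTy, Ex.allAdm, Ex.subst, Tm.subst, Ty.up_var, Ty.subst_var,
    Ex.wkTy_rvar, Ex.up_rvar, e, Ex.wkTm_zero] at this
  exact this

theorem piR_elim {ρ : DRel S (n + 2)} {σ τ : Ty S.toTySig (n + 1)} (hΦ : AllProp Ax Γ Θ Φ)
    (hρ : IsRel Ax (piTys Γ) (piRels Θ) ρ (σ.atPi 1) (τ.atPi 0))
    (hf : HasTy (intCtx Γ) ∅ f (Ty.pi σ)) (hg : HasTy (intCtx Γ) ∅ g (Ty.pi τ))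
    (h : Prov Ax Γ Θ Φ (Ex.rapp (Ex.piR σ τ ρ) f g)) (hT : IsAdm Ax Γ Θ T A B) :
    Prov Ax Γ Θ Φ (Ex.rapp (ρ.subst (Ty.pair A B) Tm.var (Ex.single T)) (Tm.tapp f A)
      (Tm.tapp g B)) := by
  have := Prov.allPi_elim hΦ (Prov.iff_mp hΦ (piR_iff hρ hf hg) h) hT
  have e (t : Tm S n) : t.wkTy.wkTy.subst (Ty.pair A B) Tm.var = t := by
    rw [Tm.wkTy, Tm.wkTy, Tm.subst_rename, Tm.subst_rename]; exact Tm.subst_var t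
  simp only [Ex.subst, Tm.subst, e] at this
  exact this

theorem piR_intro {ρ : DRel S (n + 2)} {σ τ : Ty S.toTySig (n + 1)} (hΦ : AllProp Ax Γ Θ Φ)
    (hρ : IsRel Ax (piTys Γ) (piRels Θ) ρ (σ.atPi 1) (τ.atPi 0))
    (hf : HasTy (intCtx Γ) ∅ f (Ty.pi σ)) (hg : HasTy (intCtx Γ) ∅ g (Ty.pi τ))
    (h : Prov Ax (piTys Γ) (piRels Θ) (((Φ.map Ex.wkTy).map Ex.wkTy).map Ex.wkRel)
      (Ex.rapp ρ (Tm.tapp f.wkTy.wkTy (Ty.var 1)) (Tm.tapp g.wkTy.wkTy (Ty.var 0)))) :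
    Prov Ax Γ Θ Φ (Ex.rapp (Ex.piR σ τ ρ) f g) :=
  Prov.iff_mpr hΦ (piR_iff hρ hf hg) (.allTyI (.allTyI (.allRelI h)))

/-! ### The modality -/

theorem Tm.rename_add_two (t : Tm S n) : t.rename id (· + 2) = t.wk.wk := by
  rw [wk, wk, rename_rename]; rfl

theorem Ex.rapp_wkTm_two (ρ : DRel S n) (t s : Tm S n) :
    (Ex.rapp ρ t s).wkTm 2 = Ex.rapp (ρ.wkTm 2) t.wk.wk s.wk.wk := by
  rw [← Tm.rename_add_two, ← Tm.rename_add_two]; rfl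

theorem Ex.rapp_wkPi (ρ : DRel S n) (t s : Tm S n) :
    (Ex.rapp ρ t s).wkTy.wkTy.wkRel = Ex.rapp (Ex.wkPi ρ) t.wkTy.wkTy s.wkTy.wkTy := by
  simp only [wkRel, wkTy, rename, Tm.rename_id]; rfl

theorem Ex.lolliR_wkTm (k : ℕ) : (Ex.lolliR σ τ σ' τ' ρ ρ').wkTm k =
    Ex.lolliR σ τ σ' τ' (ρ.wkTm k) (ρ'.wkTm k) := by
  rw [Ex.wkTm, Ex.lolliR_rename]; simp only [Ty.rename_id]; rfl

theorem Ex.arrowR_wkTm (k : ℕ) : (Ex.arrowR σ τ σ' τ' ρ ρ').wkTm k =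
    Ex.arrowR σ τ σ' τ' (ρ.wkTm k) (ρ'.wkTm k) := by
  rw [Ex.wkTm, Ex.arrowR_rename]; simp only [Ty.rename_id]; rfl

theorem Ex.imps_rename {m : ℕ} (Φ : List (Fml S n)) (φ : Fml S n) (ξ : Fin n → Fin m)
    (ζ η : ℕ → ℕ) :
    (Ex.imps Φ φ).rename ξ ζ η = Ex.imps (Φ.map (fun ψ => ψ.rename ξ ζ η)) (φ.rename ξ ζ η) := by
  induction Φ generalizing φ with
  | nil => rfl
  | cons ψ Φ ih => simp only [imps, ih, rename, List.map]

theorem Prov.weakening (hΦ : AllProp Ax Γ Θ Φ) (h : Prov Ax Γ Θ Φ φ) {m : ℕ}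
    {Γ' : List (Ty S.toTySig m)} {Θ' : List (RelDecl S.toTySig m)} {ξ : Fin n → Fin m}
    {ζ η : ℕ → ℕ} (w : Wk Γ Θ Γ' Θ' ξ ζ η) :
    Prov Ax Γ' Θ' (Φ.map (fun ψ => ψ.rename ξ ζ η)) (φ.rename ξ ζ η) := by
  have h₁ := w.prov (Prov.imps h)
  rw [Ex.imps_rename] at h₁
  refine Prov.of_imps (fun ψ hψ => ?_) h₁
  obtain ⟨χ, hχ, rfl⟩ := List.mem_map.1 hψ
  exact (hΦ χ hχ).weakening w

theorem Prov.wkTm (hΦ : AllProp Ax Γ Θ Φ) (h : Prov Ax Γ Θ Φ φ) (ω : Ty S.toTySig n) :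
    Prov Ax (ω :: Γ) Θ (Φ.map (Ex.wkTm 1)) (φ.wkTm 1) := h.weakening hΦ (Wk.tm _ _ ω)

theorem Prov.wkTm_two (hΦ : AllProp Ax Γ Θ Φ) (h : Prov Ax Γ Θ Φ φ) (ω ω' : Ty S.toTySig n) :
    Prov Ax (ω :: ω' :: Γ) Θ (Φ.map (Ex.wkTm 2)) (φ.wkTm 2) := by
  have := (h.wkTm hΦ ω').wkTm (hΦ.wkTm ω') ω
  rw [List.map_map, Ex.wkTm_wkTm] at this
  have e : Ex.wkTm 1 ∘ Ex.wkTm 1 = (Ex.wkTm 2 : Fml S n → Fml S n) := by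
    funext φ; exact Ex.wkTm_wkTm φ 1 1
  rwa [e] at this

theorem Prov.wkPi (hΦ : AllProp Ax Γ Θ Φ) (h : Prov Ax Γ Θ Φ φ) :
    Prov Ax (piTys Γ) (piRels Θ) (((Φ.map Ex.wkTy).map Ex.wkTy).map Ex.wkRel)
      φ.wkTy.wkTy.wkRel :=
  ((h.weakening hΦ (Wk.ty _ _)).weakening hΦ.wkTy (Wk.ty _ _)).weakening hΦ.wkTy.wkTy
    (Wk.rel _ _ _)

@[simp] theorem Ex.bangMap_rename {m : ℕ} (σ : Ty S.toTySig n) (ξ : Fin n → Fin m) (ζ : ℕ → ℕ) :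
    (Ex.bangMap σ : Tm S n).rename ξ ζ = Ex.bangMap (σ.rename ξ) := by
  simp only [bangMap, Tm.rename, Ty.rename, Ty.arrow, Ty.wk_rename_liftF]; rfl

theorem Ex.bangMap_app_wkTy (σ : Ty S.toTySig n) (t : Tm S n) :
    (Tm.app (Ex.bangMap σ) (Tm.bang t)).wkTy.wkTy =
      Tm.app (Ex.bangMap σ.wk.wk) (Tm.bang t.wkTy.wkTy) := by
  simp only [Tm.wkTy, Tm.rename, bangMap_rename]; rfl

theorem Ex.bangMap_tapp_wk (σ A : Ty S.toTySig n) (t : Tm S n) :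
    (Tm.tapp (Tm.app (Ex.bangMap σ) (Tm.bang t)) A).wk.wk =
      Tm.tapp (Tm.app (Ex.bangMap σ) (Tm.bang t.wk.wk)) A := by
  simp only [Tm.wk, Tm.rename, bangMap_rename, Ty.rename_id]

theorem HasTy.bangMap {G : List (TmDecl S.toTySig n)} (σ : Ty S.toTySig n) :
    HasTy G ∅ (Ex.bangMap σ)
      (Ty.lolli (Ty.bang σ) (Ty.pi (Ty.lolli (Ty.arrow σ.wk (Ty.var 0)) (Ty.var 0)))) := by
  refine HasTy.lam₀ (HasTy.tlam (HasTy.lam ?_))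
  exact HasTy.app (L := {0}) (L' := {1}) (HasTy.lvar rfl) (HasTy.lvar rfl) (by simp)

theorem Conv.bangMap {G : List (TmDecl S.toTySig n)} {t h : Tm S n} {σ A : Ty S.toTySig n}
    (ht : HasTy G ∅ t (Ty.bang σ)) (hh : HasTy G ∅ h (Ty.arrow σ A)) :
    Conv G ∅ (Tm.app (Tm.tapp (Tm.app (Ex.bangMap σ) t) A) h) (Tm.app h t) A := by
  have h₁ := Conv.beta₀ (G := G) (t := Tm.tlam (Tm.lam (Ty.arrow σ.wk (Ty.var 0))
    (Tm.app (Tm.var 0) (Tm.var 1)))) (τ := Ty.pi (Ty.lolli (Ty.arrow σ.wk (Ty.var 0)) (Ty.var 0)))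
    (σ := Ty.bang σ) (HasTy.tlam (HasTy.lam (HasTy.app (L := {0}) (L' := {1})
      (HasTy.lvar rfl) (HasTy.lvar rfl) (by simp)))) ht
  simp only [Tm.inst, Tm.subst, Ty.up_var, Ty.subst_var, Tm.up_zero, Tm.up_succ,
    Tm.single_zero] at h₁
  have b : HasTy (⟨true, Ty.arrow σ.wk (Ty.var 0)⟩ :: G.map TmDecl.wk) {0}
      (Tm.app (Tm.var 0) t.wkTy.wk) (Ty.var 0) := by
    exact (HasTy.app (L := {0}) (L' := ∅) (σ := (Ty.bang σ).wk) (HasTy.lvar rfl)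
      (ht.wkTy.wk₀ _) (by simp)).of_eq (by simp)
  have h₂ := Conv.betaTy (G := G) (HasTy.lam₀ b) A
  have e : t.wkTy.wk.subst (Ty.single A) (Tm.up Tm.var) = t.wk := by
    rw [Tm.wk_subst_up]; exact congrArg Tm.wk (Tm.wkTy_instTy t A)
  simp only [Tm.instTy, Ty.inst, Tm.subst, Ty.subst, Ty.arrow, Ty.wk_subst_single, e,
    Tm.up_zero] at h₂
  have b' : HasTy (⟨true, Ty.arrow σ A⟩ :: G) {0} (Tm.app (Tm.var 0) t.wk) A := by
    exact (HasTy.app (L := {0}) (L' := ∅) (σ := Ty.bang σ) (HasTy.lvar rfl)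
      (ht.wk₀ _) (by simp)).of_eq (by simp)
  have h₃ := Conv.beta₀ b' hh
  have e' : t.wk.subst Ty.var (Tm.single h) = t := Tm.wk_inst t h
  simp only [Tm.inst, Tm.subst, e', Tm.single_zero] at h₃
  have h₄ := h₁.tapp A
  simp only [Ty.inst, Ty.subst, Ty.arrow, Ty.wk_subst_single] at h₄
  exact ((h₄.trans h₂).app₀ (Conv.refl hh)).trans h₃

theorem isRel_bang_body (hρ : IsRel Ax Γ Θ ρ σ τ) :
    IsRel Ax (piTys Γ) (piRels Θ) (Ex.lolliR (Ty.arrow σ.wk.wk (Ty.var 1))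
      (Ty.arrow τ.wk.wk (Ty.var 0)) (Ty.var 1) (Ty.var 0)
        (Ex.arrowR σ.wk.wk τ.wk.wk (Ty.var 1) (Ty.var 0) (Ex.wkPi ρ) (Ex.rvar 0)) (Ex.rvar 0))
      (Ty.atPi (Ty.lolli (Ty.arrow σ.wk (Ty.var 0)) (Ty.var 0)) 1)
      (Ty.atPi (Ty.lolli (Ty.arrow τ.wk (Ty.var 0)) (Ty.var 0)) 0) := by
  have e (σ : Ty S.toTySig n) (a : Fin (n + 2)) :
      Ty.atPi (Ty.lolli (Ty.arrow σ.wk (Ty.var 0)) (Ty.var 0)) a =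
        Ty.lolli (Ty.arrow σ.wk.wk (Ty.var a)) (Ty.var a) := by
    have : σ.wk.subst (Fin.cases (Ty.var a) (fun i => Ty.var i.succ.succ)) = σ.wk.wk := by
      rw [Ty.wk, Ty.wk, Ty.rename_rename, Ty.subst_rename, ← Ty.subst_var_comp]; rfl
    simp only [Ty.atPi, Ty.arrow, Ty.subst, this]; rfl
  rw [e, e]
  exact isRel_lolliR (isRel_arrowR (hρ.wkPi _) (.ofAdm (.rvar rfl))) (.ofAdm (.rvar rfl))

theorem bangR_elim (hΦ : AllProp Ax Γ Θ Φ) (hρ : IsRel Ax Γ Θ ρ σ τ)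
    (ht : HasTy (intCtx Γ) ∅ t (Ty.bang σ)) (hs : HasTy (intCtx Γ) ∅ s (Ty.bang τ))
    (h : Prov Ax Γ Θ Φ (Ex.rapp (Ex.bangR σ τ ρ) t s)) (hT : IsAdm Ax Γ Θ T A B)
    (hf : HasTy (intCtx Γ) ∅ f (Ty.arrow σ A)) (hg : HasTy (intCtx Γ) ∅ g (Ty.arrow τ B))
    (hfg : Prov Ax Γ Θ Φ (Ex.rapp (Ex.arrowR σ τ A B ρ T) f g)) :
    Prov Ax Γ Θ Φ (Ex.rapp T (Tm.app f t) (Tm.app g s)) := by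
  have hb := isRel_bang_body hρ
  have h₁ := Prov.iff_mp hΦ
    (reindex_iff (isRel_piR hb) (HasTy.bangMap σ) (HasTy.bangMap τ) ht hs) h
  have h₂ := piR_elim hΦ hb ((HasTy.bangMap σ).app₀ ht) ((HasTy.bangMap τ).app₀ hs) h₁ hT
  have e (σ : Ty S.toTySig n) : σ.wk.wk.subst (Ty.pair A B) = σ := by
    rw [Ty.wk, Ty.wk, Ty.subst_rename, Ty.subst_rename]; exact Ty.subst_var σ
  have e₁ : (Ty.var 1 : Ty S.toTySig (n + 2)).subst (Ty.pair A B) = A := rfl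
  have e₀ : (Ty.var 0 : Ty S.toTySig (n + 2)).subst (Ty.pair A B) = B := rfl
  simp only [Ty.arrow, Ex.lolliR_subst, Ex.arrowR_subst, Ex.wkPi_subst, Ty.subst.eq_5,
    Ty.subst.eq_6, e, e₁, e₀, Ex.subst, Ex.single_zero] at h₂
  have hft := ((HasTy.bangMap (G := intCtx Γ) σ).app₀ ht).tapp A
  have hgs := ((HasTy.bangMap (G := intCtx Γ) τ).app₀ hs).tapp B
  simp only [Ty.inst, Ty.subst, Ty.arrow, Ty.wk_subst_single] at hft hgs
  have h₃ := lolliR_elim hΦ (isRel_arrowR hρ (.ofAdm hT)) (.ofAdm hT) hft hgs h₂ hf hg hfg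
  exact Prov.rapp_conv hΦ (.ofAdm hT) h₃ (Conv.bangMap ht hf) (Conv.bangMap hs hg)

theorem bangR_intro (hΦ : AllProp Ax Γ Θ Φ) (hρ : IsRel Ax Γ Θ ρ σ τ)
    (ht : HasTy (intCtx Γ) ∅ t σ) (hs : HasTy (intCtx Γ) ∅ s τ)
    (h : Prov Ax Γ Θ Φ (Ex.rapp ρ t s)) :
    Prov Ax Γ Θ Φ (Ex.rapp (Ex.bangR σ τ ρ) (Tm.bang t) (Tm.bang s)) := by
  have hb := isRel_bang_body hρ
  refine Prov.iff_mpr hΦ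
    (reindex_iff (isRel_piR hb) (HasTy.bangMap σ) (HasTy.bangMap τ) ht.bang hs.bang) ?_
  refine piR_intro hΦ hb ((HasTy.bangMap σ).app₀ ht.bang) ((HasTy.bangMap τ).app₀ hs.bang) ?_
  have hr : IsAdm Ax (piTys Γ) (piRels Θ) (Ex.rvar 0) (Ty.var 1) (Ty.var 0) := .rvar rfl
  have hρ' : IsRel Ax (piTys Γ) (piRels Θ) (Ex.wkPi ρ) σ.wk.wk τ.wk.wk := hρ.wkPi _
  have ht' := ht.wkTy_int.wkTy_int
  have hs' := hs.wkTy_int.wkTy_int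
  have hft := ((HasTy.bangMap (G := intCtx (piTys Γ)) σ.wk.wk).app₀ ht'.bang).tapp (Ty.var 1)
  have hgs := ((HasTy.bangMap (G := intCtx (piTys Γ)) τ.wk.wk).app₀ hs'.bang).tapp (Ty.var 0)
  simp only [Ty.inst, Ty.subst, Ty.arrow, Ty.wk_subst_single] at hft hgs
  have hA := isRel_arrowR hρ' (.ofAdm hr)
  rw [Ex.bangMap_app_wkTy, Ex.bangMap_app_wkTy]
  refine lolliR_intro hΦ.wkPi hA (.ofAdm hr) hft hgs ?_
  have hΦ' := hΦ.wkPi.binary hA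
  have h₁ := (h.wkPi hΦ).wkTm_two hΦ.wkPi (Ty.arrow τ.wk.wk (Ty.var 0))
    (Ty.arrow σ.wk.wk (Ty.var 1))
  rw [Ex.rapp_wkPi, Ex.rapp_wkTm_two] at h₁
  have h₂ := Prov.weaken hΦ' (List.subset_cons_self _ _) h₁
  have h₃ := (Prov.hyp hΦ' List.mem_cons_self).of_eq
    (congrArg (fun ρ => Ex.rapp ρ (Tm.var 1) (Tm.var 0)) (Ex.arrowR_wkTm 2))
  have h₄ := arrowR_elim hΦ' (hρ'.wkTm_two _ _) (.ofAdm (hr.wkTm_two _ _))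
    (HasTy.ivar (i := 1) rfl) (HasTy.ivar (i := 0) rfl) h₃ ((ht'.wkTm _).wkTm _) ((hs'.wkTm _).wkTm _) h₂
  rw [Ex.bangMap_tapp_wk, Ex.bangMap_tapp_wk]
  exact Prov.rapp_conv hΦ' (.ofAdm (hr.wkTm_two _ _)) h₄
    (Conv.bangMap ((ht'.wkTm _).wkTm _).bang (HasTy.ivar rfl)).symm
    (Conv.bangMap ((hs'.wkTm _).wkTm _).bang (HasTy.ivar rfl)).symm

end LAPL

namespace LAPL

universe u

variable {S : Sig.{u}} {Ax : Axioms S}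

variable {n : ℕ} {Γ : List (Ty S.toTySig n)} {Θ : List (RelDecl S.toTySig n)} {Φ : List (Fml S n)}
  {ρ ρ' T U : DRel S n} {τ τ' A A' B B' : Ty S.toTySig n} {a b t s f g x y : Tm S n}

/-! ### Relational interpretations -/

section interp

variable {k : ℕ} {ρs : Fin k → DRel S n} {τs τs' : Fin k → Ty S.toTySig n}

theorem isRel_interp (hρ : ∀ j, IsAdm Ax Γ Θ (ρs j) (τs j) (τs' j)) (σ : Ty S.toTySig k) :
    IsRel Ax Γ Θ (Ex.interp σ ρs) (σ.subst τs) (σ.subst τs') := .ofAdm (.interp σ hρ)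

theorem interp_lolli_elim (hΦ : AllProp Ax Γ Θ Φ)
    (hρ : ∀ j, IsAdm Ax Γ Θ (ρs j) (τs j) (τs' j)) {σ σ' : Ty S.toTySig k}
    (hf : HasTy (intCtx Γ) ∅ f ((Ty.lolli σ σ').subst τs))
    (hg : HasTy (intCtx Γ) ∅ g ((Ty.lolli σ σ').subst τs'))
    (h : Prov Ax Γ Θ Φ (Ex.rapp (Ex.interp (Ty.lolli σ σ') ρs) f g))
    (ha : HasTy (intCtx Γ) ∅ a (σ.subst τs)) (hb : HasTy (intCtx Γ) ∅ b (σ.subst τs'))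
    (hab : Prov Ax Γ Θ Φ (Ex.rapp (Ex.interp σ ρs) a b)) :
    Prov Ax Γ Θ Φ (Ex.rapp (Ex.interp σ' ρs) (Tm.app f a) (Tm.app g b)) :=
  lolliR_elim hΦ (isRel_interp hρ σ) (isRel_interp hρ σ') hf hg
    (Prov.equiv_mp hΦ (.interpLolli σ σ' hρ) hf hg h) ha hb hab

theorem interp_bang_intro (hΦ : AllProp Ax Γ Θ Φ)
    (hρ : ∀ j, IsAdm Ax Γ Θ (ρs j) (τs j) (τs' j)) {σ : Ty S.toTySig k}
    (ht : HasTy (intCtx Γ) ∅ t (σ.subst τs)) (hs : HasTy (intCtx Γ) ∅ s (σ.subst τs'))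
    (h : Prov Ax Γ Θ Φ (Ex.rapp (Ex.interp σ ρs) t s)) :
    Prov Ax Γ Θ Φ (Ex.rapp (Ex.interp (Ty.bang σ) ρs) (Tm.bang t) (Tm.bang s)) :=
  Prov.equiv_mpr hΦ (.interpBang σ hρ) ht.bang hs.bang
    (bangR_intro hΦ (isRel_interp hρ σ) ht hs h)

theorem Ty.subst_up_inst {T : TySig.{u}} {n k : ℕ} (σ : Ty T (k + 1)) (τs : Fin k → Ty T n)
    (A : Ty T n) : (σ.subst (up τs)).inst A = σ.subst (Fin.cases A τs) := by
  rw [inst, subst_subst]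
  congr; funext i; cases i using Fin.cases
  · rfl
  · exact wk_subst_single _ _

theorem Ty.subst_up_atPi {T : TySig.{u}} {n k : ℕ} (σ : Ty T (k + 1)) (τs : Fin k → Ty T n)
    (a : Fin (n + 2)) :
    (σ.subst (up τs)).atPi a = σ.subst (Fin.cases (Ty.var a) (fun j => (τs j).wk.wk)) := by
  rw [atPi, subst_subst]
  congr; funext i; cases i using Fin.cases with
  | zero => rfl
  | succ i =>
    show ((τs i).rename Fin.succ).subst _ = ((τs i).rename Fin.succ).rename Fin.succ
    rw [subst_rename, rename_rename, ← subst_var_comp]; rfl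

theorem interp_pi_elim (hΦ : AllProp Ax Γ Θ Φ)
    (hρ : ∀ j, IsAdm Ax Γ Θ (ρs j) (τs j) (τs' j)) {σ : Ty S.toTySig (k + 1)}
    (hf : HasTy (intCtx Γ) ∅ f ((Ty.pi σ).subst τs))
    (hg : HasTy (intCtx Γ) ∅ g ((Ty.pi σ).subst τs'))
    (h : Prov Ax Γ Θ Φ (Ex.rapp (Ex.interp (Ty.pi σ) ρs) f g)) (hT : IsAdm Ax Γ Θ T A B) :
    Prov Ax Γ Θ Φ (Ex.rapp (Ex.interp σ (Fin.cases T ρs)) (Tm.tapp f A) (Tm.tapp g B)) := by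
  have hr : IsRel Ax (piTys Γ) (piRels Θ)
      (Ex.interp σ (Fin.cases (Ex.rvar 0) (fun j => Ex.wkPi (ρs j))))
      ((σ.subst (Ty.up τs)).atPi 1) ((σ.subst (Ty.up τs')).atPi 0) := by
    rw [Ty.subst_up_atPi, Ty.subst_up_atPi]
    refine isRel_interp (fun j => ?_) σ
    cases j using Fin.cases with
    | zero => exact .rvar rfl
    | succ j => exact (hρ j).wkPi _
  have := piR_elim hΦ hr hf hg (Prov.equiv_mp hΦ (.interpPi σ hρ) hf hg h) hT
  rw [Ex.subst] at this
  convert this using 3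
  funext j
  cases j using Fin.cases with
  | zero => rfl
  | succ j => exact (Ex.wkPi_subst _ _ _ _).symm

theorem interp_at1 (hρ : ∀ j, IsAdm Ax Γ Θ (ρs j) (τs j) (τs' j)) (σ : Ty S.toTySig 1)
    (i : Fin k) :
    Prov Ax Γ Θ [] (Ex.equiv (σ.at1 (τs i)) (σ.at1 (τs' i)) (Ex.interp (σ.at1 (Ty.var i)) ρs)
      (Ex.interp σ (fun _ => ρs i))) := by
  have := Prov.interpRename σ (fun _ => i) (fun _ _ _ => Subsingleton.elim _ _) hρ
  rwa [Ty.subst_rename, Ty.subst_rename, ← Ty.subst_var_comp] at this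

theorem adm_cases (hρ : ∀ j, IsAdm Ax Γ Θ (ρs j) (τs j) (τs' j)) (hT : IsAdm Ax Γ Θ T A B)
    (j : Fin (k + 1)) :
    IsAdm Ax Γ Θ ((Fin.cases T ρs : Fin (k + 1) → DRel S n) j)
      ((Fin.cases A τs : Fin (k + 1) → Ty S.toTySig n) j)
      ((Fin.cases B τs' : Fin (k + 1) → Ty S.toTySig n) j) := by
  cases j using Fin.cases with
  | zero => exact hT
  | succ j => exact hρ j

end interp

theorem Prov.equiv_wkTm_two (h : Prov Ax Γ Θ [] (Ex.equiv A B ρ ρ')) (ω ω' : Ty S.toTySig n) :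
    Prov Ax (ω :: ω' :: Γ) Θ [] (Ex.equiv A B (ρ.wkTm 2) (ρ'.wkTm 2)) := by
  have := h.wkTm_two AllProp.nil ω ω'
  rw [Ex.wkTm, Ex.equiv_rename, Ty.rename_id, Ty.rename_id] at this
  exact this

/-- `ρ ⊸ ρ'` respects equivalence of relations. -/
theorem lolliR_congr {ρ₁ ρ₁' : DRel S n} (hΦ : AllProp Ax Γ Θ Φ) (hρ : IsRel Ax Γ Θ ρ A B)
    (hρ' : IsRel Ax Γ Θ ρ' A' B') (hρ₁ : IsRel Ax Γ Θ ρ₁ A B) (hρ₁' : IsRel Ax Γ Θ ρ₁' A' B')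
    (h : Prov Ax Γ Θ [] (Ex.equiv A B ρ₁ ρ)) (h' : Prov Ax Γ Θ [] (Ex.equiv A' B' ρ₁' ρ'))
    (hf : HasTy (intCtx Γ) ∅ f (Ty.lolli A A')) (hg : HasTy (intCtx Γ) ∅ g (Ty.lolli B B'))
    (hfg : Prov Ax Γ Θ Φ (Ex.maps A B A' B' ρ ρ' f g)) :
    Prov Ax Γ Θ Φ (Ex.maps A B A' B' ρ₁ ρ₁' f g) := by
  refine lolliR_intro hΦ hρ₁ hρ₁' hf hg ?_
  have hΦ' := hΦ.binary hρ₁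
  have h₁ := Prov.equiv_mp hΦ' (h.equiv_wkTm_two B A) (HasTy.ivar (i := 1) rfl)
    (HasTy.ivar (i := 0) rfl) (Prov.hyp hΦ' List.mem_cons_self)
  have h₂ := (Prov.weaken hΦ' (List.subset_cons_self _ _) (hfg.wkTm_two hΦ B A)).of_eq
    (ψ := Ex.maps A B A' B' (ρ.wkTm 2) (ρ'.wkTm 2) f.wk.wk g.wk.wk)
    (by rw [Ex.maps, Ex.maps, Ex.rapp_wkTm_two, Ex.lolliR_wkTm])
  have hf' := (hf.wkTm A).wkTm B
  have hg' := (hg.wkTm A).wkTm B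
  have h₃ := lolliR_elim hΦ' (hρ.wkTm_two _ _) (hρ'.wkTm_two _ _) hf' hg' h₂
    (HasTy.ivar (i := 1) rfl) (HasTy.ivar (i := 0) rfl) h₁
  exact Prov.equiv_mpr hΦ' (h'.equiv_wkTm_two B A) (hf'.app₀ (HasTy.ivar rfl))
    (hg'.app₀ (HasTy.ivar rfl)) h₃

theorem Ex.reindex_wkTm_two (f g : Tm S n) (ρ : DRel S n) :
    (reindex A B f g ρ).wkTm 2 = reindex A B f.wk.wk g.wk.wk (ρ.wkTm 2) := by
  rw [Ex.wkTm, reindex_rename, Tm.rename_add_two, Tm.rename_add_two, Ty.rename_id, Ty.rename_id]; rfl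

theorem maps_reindex (hΦ : AllProp Ax Γ Θ Φ) (hρ : IsRel Ax Γ Θ ρ A' B')
    (hf : HasTy (intCtx Γ) ∅ f (Ty.lolli A A')) (hg : HasTy (intCtx Γ) ∅ g (Ty.lolli B B')) :
    Prov Ax Γ Θ Φ (Ex.maps A B A' B' (Ex.reindex A B f g ρ) ρ f g) := by
  have hr : IsRel Ax Γ Θ (Ex.reindex A B f g ρ) A B :=
    .abs (.rapp (hρ.wkTm_two _ _) (((hf.wkTm _).wkTm _).app₀ (HasTy.ivar (i := 1) rfl))
      (((hg.wkTm _).wkTm _).app₀ (HasTy.ivar (i := 0) rfl)))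
  refine lolliR_intro hΦ hr hρ hf hg ?_
  have hΦ' := hΦ.binary hr
  have h := (Prov.hyp hΦ' List.mem_cons_self).of_eq
    (congrArg (fun ρ => Ex.rapp ρ (Tm.var 1) (Tm.var 0)) (Ex.reindex_wkTm_two f g ρ))
  exact Prov.iff_mp hΦ' (reindex_iff (hρ.wkTm_two _ _) ((hf.wkTm _).wkTm _)
    ((hg.wkTm _).wkTm _) (HasTy.ivar rfl) (HasTy.ivar rfl)) h

/-- Application of an intuitionistic function preserves internal equality. -/
theorem eq_app_bang (hΦ : AllProp Ax Γ Θ Φ) (hf : HasTy (intCtx Γ) ∅ f (Ty.arrow A B))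
    (ht : HasTy (intCtx Γ) ∅ t A) (hs : HasTy (intCtx Γ) ∅ s A)
    (h : Prov Ax Γ Θ Φ (Ex.eq A t s)) :
    Prov Ax Γ Θ Φ (Ex.eq B (Tm.app f (Tm.bang t)) (Tm.app f (Tm.bang s))) := by
  have hf' := (hf.wkTm A).wkTm A
  have hP : IsProp Ax (A :: A :: Γ) Θ (Ex.eq B (Tm.app f.wk.wk (Tm.bang (Tm.var 1)))
      (Tm.app f.wk.wk (Tm.bang (Tm.var 0)))) :=
    .eq (hf'.app_bang (HasTy.ivar rfl)) (hf'.app_bang (HasTy.ivar rfl))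
  have hi {s : Tm S n} (hs : HasTy (intCtx Γ) ∅ s A) := Prov.defRel hP ht hs
  simp only [Ex.instTm₂, Ex.subst, Tm.subst, Tm.wk_subst_pair, Tm.pair_zero,
    Tm.pair_one, Ty.subst_var] at hi
  exact Prov.iff_mp hΦ (hi hs) (Prov.rapp_eq hΦ (.abs hP) ht ht ht hs
    (Prov.iff_mpr hΦ (hi ht) (Prov.eq_refl hΦ (hf.app_bang ht))) (Prov.eq_refl hΦ ht) h)

/-! ### Parametricity -/

/-- The logical relations theorem, at the equality relations. -/
theorem interp_eqRel_refl {k : ℕ} (hΦ : AllProp ExtIdExt Γ Θ Φ) (σ : Ty S.toTySig k)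
    (τs : Fin k → Ty S.toTySig n) (hx : HasTy (intCtx Γ) ∅ x (σ.subst τs)) :
    Prov ExtIdExt Γ Θ Φ (Ex.rapp (Ex.interp σ (fun i => Ex.eqRel (τs i))) x x) :=
  Prov.equiv_mpr hΦ (.ax (.idExt σ τs)) hx hx (eqRel_intro hΦ hx hx (Prov.eq_refl hΦ hx))

theorem mu_param {σ : Ty S.toTySig 1} (hΦ : AllProp ExtIdExt Γ Θ Φ)
    (hx : HasTy (intCtx Γ) ∅ x σ.mu) (hT : IsAdm ExtIdExt Γ Θ T A B)
    (hf : HasTy (intCtx Γ) ∅ f (Ty.lolli (σ.at1 A) A))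
    (hg : HasTy (intCtx Γ) ∅ g (Ty.lolli (σ.at1 B) B))
    (h : Prov ExtIdExt Γ Θ Φ
      (Ex.maps (σ.at1 A) (σ.at1 B) A B (Ex.interp σ (fun _ => T)) T f g)) :
    Prov ExtIdExt Γ Θ Φ (Ex.rapp T (Tm.app (Tm.tapp x A) (Tm.bang f))
      (Tm.app (Tm.tapp x B) (Tm.bang g))) := by
  let τs : Fin 0 → Ty S.toTySig n := Fin.elim0
  have hρ (j : Fin 0) : IsAdm ExtIdExt Γ Θ (Ex.eqRel (τs j)) (τs j) (τs j) := .eqRel _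
  have hρ' := adm_cases hρ hT
  have hx' : HasTy (intCtx Γ) ∅ x ((σ.mu : Ty S.toTySig 0).subst τs) := by rwa [Ty.mu_subst]
  have h₁ := interp_pi_elim hΦ hρ hx' hx' (interp_eqRel_refl hΦ σ.mu τs hx') hT
  have hxA := hx'.tapp A
  have hxB := hx'.tapp B
  rw [Ty.subst_up_inst] at hxA hxB
  have hf' : HasTy (intCtx Γ) ∅ f
      ((Ty.lolli (σ.at1 (Ty.var 0)) (Ty.var 0) : Ty S.toTySig 1).subst (Fin.cases A τs)) := by
    rw [Ty.subst, Ty.at1_subst]; exact hf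
  have hg' : HasTy (intCtx Γ) ∅ g
      ((Ty.lolli (σ.at1 (Ty.var 0)) (Ty.var 0) : Ty S.toTySig 1).subst (Fin.cases B τs)) := by
    rw [Ty.subst, Ty.at1_subst]; exact hg
  have e := interp_at1 hρ' σ 0
  have hr := isRel_interp hρ' (σ.at1 (Ty.var 0))
  rw [Ty.at1_subst, Ty.at1_subst] at hr
  have h₂ := lolliR_congr hΦ (isRel_interp (τs := fun _ => A) (τs' := fun _ => B)
    (fun _ => hT) σ) (.ofAdm hT) hr (isRel_interp hρ' (Ty.var 0)) e
    (.interpVar 0 hρ') hf hg h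
  have h₃ := Prov.equiv_mpr hΦ (.interpLolli (σ.at1 (Ty.var 0)) (Ty.var 0) hρ') hf' hg'
    (by rw [Ty.at1_subst, Ty.at1_subst]; exact h₂)
  have h₄ := interp_lolli_elim hΦ hρ' hxA hxB h₁ hf'.bang hg'.bang
    (interp_bang_intro hΦ hρ' hf' hg' h₃)
  exact Prov.equiv_mp hΦ (.interpVar 0 hρ') (hxA.app_bang hf') (hxB.app_bang hg') h₄

theorem mapTy_subst {T : TySig.{u}} {n m : ℕ} (σ : Ty T 1) (θ : Fin n → Ty T m) :
    (mapTy σ : Ty T n).subst θ = mapTy σ := by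
  simp only [mapTy, Ty.arrow, Ty.subst, Ty.at1_subst]; rfl

/-- The functorial action preserves admissible relations. -/
theorem fmap_param {σ : Ty S.toTySig 1} (hpos : σ.OnlyPositive 0) (hΦ : AllProp ExtIdExt Γ Θ Φ)
    (hT : IsAdm ExtIdExt Γ Θ T A A') (hU : IsAdm ExtIdExt Γ Θ U B B')
    (hf : HasTy (intCtx Γ) ∅ f (Ty.lolli A B)) (hg : HasTy (intCtx Γ) ∅ g (Ty.lolli A' B'))
    (h : Prov ExtIdExt Γ Θ Φ (Ex.maps A A' B B' T U f g))
    (ha : HasTy (intCtx Γ) ∅ a (σ.at1 A)) (hb : HasTy (intCtx Γ) ∅ b (σ.at1 A'))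
    (hab : Prov ExtIdExt Γ Θ Φ (Ex.rapp (Ex.interp σ (fun _ => T)) a b)) :
    Prov ExtIdExt Γ Θ Φ (Ex.rapp (Ex.interp σ (fun _ => U)) (Tm.app (fmap σ A B f) a)
      (Tm.app (fmap σ A' B' g) b)) := by
  let τs : Fin 0 → Ty S.toTySig n := Fin.elim0
  have hρ (j : Fin 0) : IsAdm ExtIdExt Γ Θ (Ex.eqRel (τs j)) (τs j) (τs j) := .eqRel _
  have hρ₁ := adm_cases hρ hT
  have hρ₂ := adm_cases hρ₁ hU
  have hM : HasTy (intCtx Γ) ∅ (act σ true (fun _ => Role.hole)) ((mapTy σ).subst τs) := by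
    rw [mapTy_subst]; exact HasTy.act hpos
  have h₁ := interp_pi_elim hΦ hρ hM hM (interp_eqRel_refl hΦ (mapTy σ) τs hM) hT
  have hMA := hM.tapp A
  have hMA' := hM.tapp A'
  rw [Ty.subst_up_inst] at hMA hMA'
  have h₂ := interp_pi_elim hΦ hρ₁ hMA hMA' h₁ hU
  have hMB := hMA.tapp B
  have hMB' := hMA'.tapp B'
  rw [Ty.subst_up_inst] at hMB hMB'
  have h₃ := Prov.equiv_mpr hΦ (.interpLolli (Ty.var 1) (Ty.var 0) hρ₂) hf hg
    (lolliR_congr hΦ (.ofAdm hT) (.ofAdm hU) (isRel_interp hρ₂ (Ty.var 1))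
      (isRel_interp hρ₂ (Ty.var 0)) (.interpVar 1 hρ₂) (.interpVar 0 hρ₂) hf hg h)
  have h₄ := interp_lolli_elim hΦ hρ₂ hMB hMB' h₂ hf.bang hg.bang
    (interp_bang_intro hΦ hρ₂ hf hg h₃)
  have hMf := hMB.app_bang hf
  have hMg := hMB'.app_bang hg
  have h₅ := interp_lolli_elim hΦ hρ₂ hMf hMg h₄ (a := a) (b := b)
    (by rw [Ty.at1_subst]; exact ha) (by rw [Ty.at1_subst]; exact hb)
    (Prov.equiv_mpr hΦ (interp_at1 hρ₂ σ 1) ha hb hab)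
  exact Prov.equiv_mp hΦ (interp_at1 hρ₂ σ 0) ((HasTy.fmap hpos hf).app₀ ha)
    ((HasTy.fmap hpos hg).app₀ hb) h₅

/-- The interpretation of `σ` at the graph of `g` is contained in the graph of `σ(g)`. -/
theorem interp_graph {σ : Ty S.toTySig 1} (hpos : σ.OnlyPositive 0)
    (hΦ : AllProp ExtIdExt Γ Θ Φ) (hg : HasTy (intCtx Γ) ∅ g (Ty.lolli A B))
    (ha : HasTy (intCtx Γ) ∅ a (σ.at1 A)) (hb : HasTy (intCtx Γ) ∅ b (σ.at1 B))
    (h : Prov ExtIdExt Γ Θ Φ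
      (Ex.rapp (Ex.interp σ (fun _ => Ex.reindex A B g (Tm.idm B) (Ex.eqRel B))) a b)) :
    Prov ExtIdExt Γ Θ Φ (Ex.eq (σ.at1 B) (Tm.app (fmap σ A B g) a) b) := by
  have hT : IsAdm ExtIdExt Γ Θ (Ex.reindex A B g (Tm.idm B) (Ex.eqRel B)) A B :=
    .reindex (.eqRel B) hg (HasTy.idm B)
  have h₁ := fmap_param hpos hΦ hT (.eqRel B) hg (HasTy.idm B)
    (maps_reindex hΦ (.ofAdm (.eqRel B)) hg (HasTy.idm B)) ha hb h
  have hga := (HasTy.fmap hpos hg).app₀ ha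
  have hib := (HasTy.fmap hpos (HasTy.idm B)).app₀ hb
  have h₂ := eqRel_elim hΦ hga hib
    (Prov.equiv_mp hΦ (.ax (.idExt σ (fun _ => B))) hga hib h₁)
  exact h₂.eqTrans (Prov.of_conv hΦ
    (((Conv.fmap_idm hpos B).app₀ (Conv.refl hb)).trans (Conv.idm hb)))

/-- Two maps out of `!A` which agree on all `!x` are equal. -/
theorem bang_ext (hf : HasTy (intCtx Γ) ∅ f (Ty.arrow A B))
    (hg : HasTy (intCtx Γ) ∅ g (Ty.arrow A B)) (ht : HasTy (intCtx Γ) ∅ t (Ty.bang A))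
    (h : Prov ExtIdExt (A :: Γ) Θ [] (Ex.eq B (Tm.app f.wk (Tm.bang (Tm.var 0)))
      (Tm.app g.wk (Tm.bang (Tm.var 0))))) :
    Prov ExtIdExt Γ Θ [] (Ex.eq B (Tm.app f t) (Tm.app g t)) := by
  let τs : Fin 1 → Ty S.toTySig n := fun _ => A
  have hρ (j : Fin 1) : IsAdm ExtIdExt Γ Θ (Ex.eqRel (τs j)) (τs j) (τs j) := .eqRel _
  have hr := isRel_interp hρ (Ty.var 0)
  have h₁ := Prov.equiv_mp AllProp.nil (.interpBang (Ty.var 0) hρ) ht ht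
    (interp_eqRel_refl AllProp.nil (Ty.bang (Ty.var 0)) τs ht)
  refine eqRel_elim AllProp.nil (hf.app₀ ht) (hg.app₀ ht)
    (bangR_elim AllProp.nil hr ht ht h₁ (.eqRel B) hf hg ?_)
  refine arrowR_intro AllProp.nil hr (.ofAdm (.eqRel B)) hf hg ?_
  have hΦ := (AllProp.nil (Ax := ExtIdExt) (Γ := Γ) (Θ := Θ)).binary hr
  have hf' := (hf.wkTm A).wkTm A
  have hg' := (hg.wkTm A).wkTm A
  have hx : HasTy (intCtx (A :: A :: Γ)) ∅ (Tm.var 1) A := HasTy.ivar rfl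
  have hy : HasTy (intCtx (A :: A :: Γ)) ∅ (Tm.var 0) A := HasTy.ivar rfl
  have h₂ := Prov.equiv_mp hΦ ((Prov.interpVar 0 hρ).equiv_wkTm_two A A) hx hy
    (Prov.hyp hΦ List.mem_cons_self)
  have e : (Ex.eqRel A).wkTm 2 = (Ex.eqRel A : DRel S n) := by
    rw [Ex.wkTm, Ex.eqRel_rename, Ty.rename_id]
  have e' : (Ex.eqRel B).wkTm 2 = (Ex.eqRel B : DRel S n) := by
    rw [Ex.wkTm, Ex.eqRel_rename, Ty.rename_id]
  rw [e] at h₂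
  rw [e']
  have h₃ := h.wkTm AllProp.nil A
  rw [Ex.wkTm, Ex.rename, Ty.rename_id] at h₃
  refine eqRel_intro hΦ (hf'.app_bang hx) (hg'.app_bang hy)
    (Prov.eqTrans (s := Tm.app g.wk.wk (Tm.bang (Tm.var 1))) (Prov.of_nil hΦ h₃) ?_)
  exact eq_app_bang hΦ hg' hx hy (eqRel_elim hΦ hx hy h₂)

/-! ### Induction -/

theorem foldAt_wk (σ : Ty S.toTySig 1) (A : Ty S.toTySig n) (f : Tm S n) :
    (foldAt σ A f).wk = foldAt σ A f.wk := by
  rw [Tm.wk, ← Tm.subst_var_comp, foldAt_subst, Tm.subst_var_comp]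
  exact congrArg (fun B => foldAt σ B f.wk) (Ty.subst_var A)

/-- `f` and `in` are related along the graph of `fold A !f`. -/
theorem maps_in {σ : Ty S.toTySig 1} (hpos : σ.OnlyPositive 0)
    (hf : HasTy (intCtx Γ) ∅ f (Ty.lolli (σ.at1 A) A)) :
    Prov ExtIdExt Γ Θ [] (Ex.maps (σ.at1 σ.mu) (σ.at1 A) σ.mu A
      (Ex.interp σ (fun _ => Ex.reindex σ.mu A (foldAt σ A f) (Tm.idm A) (Ex.eqRel A)))
      (Ex.reindex σ.mu A (foldAt σ A f) (Tm.idm A) (Ex.eqRel A)) (inMap σ) f) := by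
  have hT : IsAdm ExtIdExt Γ Θ (Ex.reindex σ.mu A (foldAt σ A f) (Tm.idm A) (Ex.eqRel A))
      σ.mu A := .reindex (.eqRel A) hf.foldAt (HasTy.idm A)
  have hr := isRel_interp (τs := fun _ => σ.mu) (τs' := fun _ => A) (fun _ => hT) σ
  refine lolliR_intro AllProp.nil hr (.ofAdm hT) (HasTy.inMap hpos) hf ?_
  have hΦ := (AllProp.nil (Ax := ExtIdExt) (Γ := Γ) (Θ := Θ)).binary hr
  have hf' := (hf.wkTm (σ.at1 σ.mu)).wkTm (σ.at1 A)
  have hx : HasTy (intCtx (σ.at1 A :: σ.at1 σ.mu :: Γ)) ∅ (Tm.var 1) (σ.at1 σ.mu) :=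
    HasTy.ivar rfl
  have hy : HasTy (intCtx (σ.at1 A :: σ.at1 σ.mu :: Γ)) ∅ (Tm.var 0) (σ.at1 A) := HasTy.ivar rfl
  have e : (Ex.reindex σ.mu A (foldAt σ A f) (Tm.idm A) (Ex.eqRel A)).wkTm 2 =
      Ex.reindex σ.mu A (foldAt σ A f.wk.wk) (Tm.idm A) (Ex.eqRel A) := by
    rw [Ex.reindex_wkTm_two, foldAt_wk, foldAt_wk, Ex.wkTm, Ex.eqRel_rename, Ty.rename_id]
    simp only [Tm.idm, Tm.wk, Tm.rename, Ty.rename_id]; rfl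
  have h := (Prov.hyp hΦ List.mem_cons_self).of_eq
    (congrArg (fun T => Ex.rapp (Ex.interp σ (fun _ => T)) (Tm.var 1) (Tm.var 0)) e)
  rw [e]
  have ein : (inMap σ : Tm S n).wk.wk = inMap σ := by simp only [Tm.wk, inMap_rename]
  rw [ein]
  have hix := (HasTy.inMap hpos).app₀ hx
  have hfy := hf'.app₀ hy
  refine Prov.iff_mpr hΦ (reindex_iff (.ofAdm (.eqRel A)) hf'.foldAt (HasTy.idm A) hix hfy) ?_
  refine eqRel_intro hΦ (hf'.foldAt.app₀ hix) ((HasTy.idm A).app₀ hfy) ?_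
  refine Prov.eqTrans (Prov.of_conv hΦ ((Conv.foldAt_app hf' hix).trans (Conv.in_app hpos hf' hx)))
    (Prov.eqTrans ?_ (Prov.of_conv hΦ (Conv.idm hfy).symm))
  exact eq_app hΦ hf' ((HasTy.fmap hpos hf'.foldAt).app₀ hx) hy
    (interp_graph hpos hΦ hf'.foldAt hx hy h)

theorem mu_eta_app {σ : Ty S.toTySig 1} (hpos : σ.OnlyPositive 0)
    (hx : HasTy (intCtx Γ) ∅ x σ.mu) (hf : HasTy (intCtx Γ) ∅ f (Ty.lolli (σ.at1 A) A)) :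
    Prov ExtIdExt Γ Θ [] (Ex.eq A
      (Tm.app (Tm.tapp (Tm.app (Tm.tapp x σ.mu) (Tm.bang (inMap σ))) A) (Tm.bang f))
      (Tm.app (Tm.tapp x A) (Tm.bang f))) := by
  have hin := HasTy.inMap (G := intCtx Γ) hpos
  have h := mu_param (Θ := Θ) AllProp.nil hx (.reindex (.eqRel A) hf.foldAt (HasTy.idm A)) hin hf
    (maps_in hpos hf)
  have hy := (hx.mu_tapp σ.mu).app_bang hin
  have hz := (hx.mu_tapp A).app_bang hf
  have h₁ := eqRel_elim AllProp.nil (hf.foldAt.app₀ hy) ((HasTy.idm A).app₀ hz)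
    (Prov.iff_mp AllProp.nil
      (reindex_iff (.ofAdm (.eqRel A)) hf.foldAt (HasTy.idm A) hy hz) h)
  exact (Prov.of_conv AllProp.nil (Conv.foldAt_app hf hy).symm).eqTrans
    (h₁.eqTrans (Prov.of_conv AllProp.nil (Conv.idm hz)))

theorem mu_eta_tapp {σ : Ty S.toTySig 1} (hpos : σ.OnlyPositive 0)
    (hx : HasTy (intCtx Γ) ∅ x σ.mu) (A : Ty S.toTySig n) :
    Prov ExtIdExt Γ Θ [] (Ex.eq (Ty.arrow (Ty.lolli (σ.at1 A) A) A)
      (Tm.tapp (Tm.app (Tm.tapp x σ.mu) (Tm.bang (inMap σ))) A) (Tm.tapp x A)) := by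
  have hin {Γ : List (Ty S.toTySig n)} := HasTy.inMap (G := intCtx Γ) hpos
  have hy := ((hx.mu_tapp σ.mu).app_bang hin).mu_tapp A
  have hz := hx.mu_tapp A
  refine (Prov.ax (.extTm hy hz)).impE (Prov.allTmI ?_)
  refine bang_ext (hy.wkTm _) (hz.wkTm _) (HasTy.ivar rfl) ?_
  have := mu_eta_app (Θ := Θ) hpos
    ((hx.wkTm (Ty.bang (Ty.lolli (σ.at1 A) A))).wkTm (Ty.lolli (σ.at1 A) A)) (A := A)
    (f := Tm.var 0) (HasTy.ivar rfl)
  simp only [Tm.wk, Tm.rename, inMap_rename, Ty.rename_id] at this ⊢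
  exact this

/-- Folding along `in` is the identity. -/
theorem mu_eta {σ : Ty S.toTySig 1} (hpos : σ.OnlyPositive 0)
    (hx : HasTy (intCtx Γ) ∅ x σ.mu) :
    Prov ExtIdExt Γ Θ [] (Ex.eq σ.mu (Tm.app (Tm.tapp x σ.mu) (Tm.bang (inMap σ))) x) := by
  have hy := (hx.mu_tapp σ.mu).app_bang (HasTy.inMap hpos)
  refine (Prov.ax (.extTy hy hx)).impE (Prov.allTyI ?_)
  have hx' := hx.wkTy_int
  rw [Ty.mu_wk] at hx'
  have := mu_eta_tapp (Θ := Θ.map RelDecl.wk) hpos hx' (Ty.var 0)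
  simp only [Tm.wkTy, Tm.rename, inMap_rename, Ty.mu_rename] at this ⊢
  exact this

end LAPL

theorem mainTheorem9 {S : LAPL.Sig} (σ : LAPL.Ty S.toTySig 1) (hind : σ.IndCon)
    (hpos : σ.OnlyPositive 0) {n : ℕ} (Γ : List (LAPL.Ty S.toTySig n))
    (Θ : List (LAPL.RelDecl S.toTySig n)) (Φ : List (LAPL.Fml S n))
    (hΦ : ∀ φ ∈ Φ, LAPL.IsProp LAPL.ExtIdExt Γ Θ φ) (R : LAPL.DRel S n)
    (hR : LAPL.IsAdm LAPL.ExtIdExt Γ Θ R σ.mu σ.mu) :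
    LAPL.Prov LAPL.ExtIdExt Γ Θ Φ
      (LAPL.Ex.imp
        (LAPL.Ex.maps (σ.at1 σ.mu) (σ.at1 σ.mu) σ.mu σ.mu (LAPL.Ex.interp σ (fun _ => R)) R
          (LAPL.inMap σ) (LAPL.inMap σ))
        (LAPL.Ex.allTm σ.mu
          (LAPL.Ex.rapp (R.wkTm 1) (LAPL.Tm.var 0) (LAPL.Tm.var 0)))) := by
  open LAPL in
  have hin {Γ : List (Ty S.toTySig n)} := HasTy.inMap (G := intCtx Γ) hpos
  have hI := isRel_lolliR (isRel_interp (τs := fun _ => σ.mu) (τs' := fun _ => σ.mu)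
    (fun _ => hR) σ) (.ofAdm hR)
  have hΨ : AllProp ExtIdExt Γ Θ
      (Ex.maps (σ.at1 σ.mu) (σ.at1 σ.mu) σ.mu σ.mu (Ex.interp σ (fun _ => R)) R
        (inMap σ) (inMap σ) :: Φ) := AllProp.cons (.rapp hI hin hin) hΦ
  have hΨ' := hΨ.wkTm σ.mu
  have hR' := hR.wkTm σ.mu
  have hx : HasTy (intCtx (σ.mu :: Γ)) ∅ (Tm.var 0) σ.mu := HasTy.ivar rfl
  refine Prov.impI (Prov.allTmI ?_)
  have h := (Prov.hyp hΨ List.mem_cons_self).wkTm hΨ σ.mu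
  have e : (Ex.maps (σ.at1 σ.mu) (σ.at1 σ.mu) σ.mu σ.mu (Ex.interp σ (fun _ => R)) R
        (inMap σ) (inMap σ)).wkTm 1 = Ex.maps (σ.at1 σ.mu) (σ.at1 σ.mu) σ.mu σ.mu
        (Ex.interp σ (fun _ => R.wkTm 1)) (R.wkTm 1) (inMap σ) (inMap σ) := by
    rw [Ex.maps, Ex.wkTm, Ex.rename, Ex.lolliR_rename, inMap_rename]
    simp only [Ty.rename_id]; rfl
  rw [e] at h
  have h₁ := mu_param hΨ' hx hR' hin hin h
  have h₂ := Prov.of_nil hΨ' (mu_eta (Θ := Θ) hpos hx)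
  have hy := (hx.mu_tapp σ.mu).app_bang hin
  exact Prov.rapp_eq hΨ' (.ofAdm hR') hy hx hy hx h₁ h₂ h₂
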